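/- Let $K$ be a field of characteristic $0$, let $t\in K^\times$ not be a root of unity, and let $u_1,u_2\in K^\times$. **Operators.** Let $q$ be an indeterminate, $p=q/t$, and work over $K(p^{1/2})$. Let $a^{(i)}_n$ ($i=1,2$, $n\neq0$) be bosons with $[a^{(i)}_n,a^{(j)}_m]=n\frac{1-q^{|n|}}{1-t^{|n|}}\delta_{i,j}\delta_{n+m,0}$, acting on the Fock space $\mathcal F_{\vec u}$ generated by $|\vec u\rangle$ with $a^{(i)}_n|\vec u\rangle=0$ ($n>0$), on which the zero mode $U_i$ acts as $u_i$; $\langle\vec u|$ is the dual vector with $\langle\vec u|a^{(i)}_{-n}=0$ ($n>0$) and $\langle\vec u|\vec u\rangle=1$. Put $$\eta^{(i)}(z)=\exp\Big(\sum_{n\ge1}\tfrac{1-t^{-n}}{n}z^na^{(i)}_{-n}\Big)\exp\Big(-\sum_{n\ge1}\tfrac{1-t^{n}}{n}z^{-n}a^{(i)}_{n}\Big),\qquad \varphi^{(1)}(z)=\exp\Big(\sum_{n\ge1}\tfrac{1-t^{-n}}{n}(1-p^{-n})z^na^{(1)}_{-n}\Big),$$ $$X^{(1)}(z)=\eta^{(1)}(p^{1/2}z)U_1+\varphi^{(1)}(p^{1/2}z)\,\eta^{(2)}(p^{-1/2}z)U_2,\qquad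 X^{(2)}(z)=X^{(1)}(pz)X^{(1)}(z),$$ where the matrix coefficients of the last product are the values of the rational functions whose expansions in $|z_1|>|z_2|$ are the matrix coefficients of $X^{(1)}(z_1)X^{(1)}(z_2)$. Write $X^{(i)}(z)=\sum_{n\in\mathbb Z}X^{(i)}_nz^{-n}$ and let $$\tilde X^{(1)}_n=\lim_{q\to0}p^{|n|/2}X^{(1)}_n,\qquad \tilde X^{(2)}_n=\lim_{q\to0}p^{n/2}X^{(2)}_n$$ (limits of matrix coefficients, i.e. values at $p^{1/2}=0$ of rational functions; the products and the limits exist). For a pair of partitions $\vec\lambda=(\lambda^1,\lambda^2)$ set $$|\tilde X_{\vec\lambda}\rangle=\tilde X^{(2)}_{-\lambda^2_1}\tilde X^{(2)}_{-\lambda^2_2}\cdots\tilde X^{(1)}_{-\lambda^1_1}\tilde X^{(1)}_{-\lambda^1_2}\cdots|\vec u\rangle,\qquad \langle\tilde X_{\vec\lambda}|=\langle\vec u|\cdots\tilde X^{(1)}_{\lambda^1_2}\tilde X^{(1)}_{\lambda^1_1}\cdots\tilde X^{(2)}_{\lambda^2_2}\tilde X^{(2)}_{\lambda^2_1},$$ and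 $S_{\vec\lambda,\vec\mu}=\langle\tilde X_{\vec\lambda}|\tilde X_{\vec\mu}\rangle$ (the Shapovalov matrix). **Hall–Littlewood functions.** On the ring $K[p_1,p_2,\dots]$ of symmetric functions ($p_n$ the power sums) and for a parameter $r\in K^\times$ that is not a root of unity, let $\langle p_\lambda,p_\mu\rangle_{0,r}=\delta_{\lambda,\mu}z_\lambda\prod_{k=1}^{\ell(\lambda)}(1-r^{\lambda_k})^{-1}$ with $z_\lambda=\prod_{i\ge1}i^{m_i}m_i!$, where $m_i=m_i(\lambda)$ is the multiplicity of $i$ in $\lambda$. Let $P_\lambda(p_n;r)$ be the unique family of symmetric functions with $\langle P_\lambda,P_\mu\rangle_{0,r}=0$ for $\lambda\ne\mu$ and $P_\lambda\in m_\lambda+\sum_{\mu<\lambda}K\,m_\mu$ (monomial symmetric functions, dominance order); it exists and is unique. Let $b_\lambda(r)=\prod_{i\ge1}\prod_{k=1}^{m_i(\lambda)}(1-r^k)$ and $Q_\lambda(p_n;r)=b_\lambda(r)P_\lambda(p_n;r)$; $Q_\lambda(-p_n;r)$ denotes the result of substituting $p_n\mapsto-p_n$ for all $n$. **Statement.** For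 all pairs of partitions $\vec\lambda=(\lambda^1,\lambda^2)$ and $\vec\mu=(\mu^1,\mu^2)$, $$S_{\vec\lambda,\vec\mu}=(u_1u_2)^{\ell(\lambda^2)+\ell(\mu^2)}u_1^{\ell(\lambda^1)}u_2^{\ell(\mu^1)}\;b_{\lambda^1}(t^{-1})\;\big\langle Q_{\lambda^2}(p_n;t^{-1}),Q_{\mu^2}(-p_n;t^{-1})\big\rangle_{0,t^{-1}}\;\delta_{\lambda^1,\mu^1}.$$ The matrix $S$ has finitely many nonzero entries in each row and column, and it has a two-sided inverse with the same property, whose entries are $$S^{\vec\lambda,\vec\mu}=(u_1u_2)^{-\ell(\mu^2)-\ell(\lambda^2)}u_1^{-\ell(\mu^1)}u_2^{-\ell(\lambda^1)}\;\frac{1}{b_{\mu^1}(t^{-1})\,b_{\lambda^2}(t^{-1})\,b_{\mu^2}(t^{-1})}\;\big\langle Q_{\lambda^2}(-p_n;t^{-1}),Q_{\mu^2}(p_n;t^{-1})\big\rangle_{0,t^{-1}}\;\delta_{\lambda^1,\mu^1}.$$ -/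

import Mathlib

/-! ### Partitions -/

namespace Crystal

/-- A partition of an arbitrary size. -/
abbrev Ptn : Type := Σ n : ℕ, n.Partition

/-- A pair of partitions `(λ¹, λ²)`. -/
abbrev PtnPair : Type := Ptn × Ptn

/-- The parts `λ₁ ≥ λ₂ ≥ …` of a partition in decreasing order. -/
def Ptn.rows (l : Ptn) : List ℕ := l.2.parts.sort (fun a b => b ≤ a)

/-- The length `ℓ(λ)`. -/
def Ptn.len (l : Ptn) : ℕ := l.2.parts.card

/-- Dominance: `l ≥ m`, for partitions of the same number. -/
def Dominates {n : ℕ} (l m : n.Partition) : Prop :=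
  ∀ k : ℕ, ((Ptn.rows ⟨n, m⟩).take k).sum ≤ ((Ptn.rows ⟨n, l⟩).take k).sum

/-- `b_λ(t) = ∏_{i ≥ 1} ∏_{k=1}^{m_i(λ)} (1 - t^k)`. -/
def bFactor {K : Type*} [Field K] (t : K) (l : Ptn) : K :=
  ∏ i ∈ l.2.parts.toFinset, ∏ k ∈ Finset.Icc 1 (l.2.parts.count i), (1 - t ^ k)

/-! ### Symmetric functions as polynomials in the power sums -/

/-- The ring of symmetric functions over `K`, as the polynomial ring in the power sums
`p_n`, `n ≥ 1` (the variable `X n` is `p_n`). -/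
abbrev Sym (K : Type*) [Field K] : Type _ := MvPolynomial ℕ+ K

/-- The symmetric polynomial in `x_1, …, x_N` obtained by `p_n ↦ x_1^n + ⋯ + x_N^n`. -/
noncomputable def Sym.toVars {K : Type*} [Field K] (N : ℕ) :
    Sym K →ₐ[K] MvPolynomial (Fin N) K :=
  MvPolynomial.aeval fun n : ℕ+ => MvPolynomial.psum (Fin N) K (n : ℕ)

/-- The substitution `p_n ↦ -p_n`. -/
noncomputable def Sym.negVars {K : Type*} [Field K] : Sym K →ₐ[K] Sym K :=
  MvPolynomial.aeval fun n : ℕ+ => -MvPolynomial.X n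

/-- `⟨p_λ, p_λ⟩_{q,t} = z_λ ∏_k (1 - q^{λ_k}) / (1 - t^{λ_k})`, where the partition `λ` is given
by its multiplicities `n ↦ d n = m_n(λ)`. -/
noncomputable def powerSumNorm {K : Type*} [Field K] (q t : K) (d : ℕ+ →₀ ℕ) : K :=
  d.prod fun n m =>
    ((n : ℕ) : K) ^ m * (m.factorial : K) * ((1 - q ^ (n : ℕ)) / (1 - t ^ (n : ℕ))) ^ m

/-- The bilinear form `⟨f, g⟩_{q,t}`, for which the power sum products `p_λ` are orthogonal. -/
noncomputable def innerQT {K : Type*} [Field K] (q t : K) (f g : Sym K) : K :=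
  ∑ d ∈ f.support, f.coeff d * g.coeff d * powerSumNorm q t d

/-- The characterization of the Macdonald functions: orthogonality for `⟨-,-⟩_{q,t}` and
`P_λ = m_λ + ∑_{μ < λ} c_{λμ} m_μ` for the dominance order. An identity of symmetric functions
is an identity of symmetric polynomials in any number `N` of variables. -/
def IsMacdonald {K : Type*} [Field K] (q t : K) (P : Ptn → Sym K) : Prop :=
  (∀ l m : Ptn, l ≠ m → innerQT q t (P l) (P m) = 0) ∧
  ∀ (n : ℕ) (l : n.Partition), ∃ c : n.Partition → K,
    (∀ m, c m ≠ 0 → Dominates l m ∧ m ≠ l) ∧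
    ∀ N : ℕ, Sym.toVars N (P ⟨n, l⟩) =
      MvPolynomial.msymm (Fin N) K l + ∑ m : n.Partition, c m • MvPolynomial.msymm (Fin N) K m

open Classical in
/-- The Macdonald functions `P_λ(p; q, t)`. -/
noncomputable def macdonaldP {K : Type*} [Field K] (q t : K) : Ptn → Sym K :=
  if h : ∃ P : Ptn → Sym K, IsMacdonald q t P then h.choose else 0

/-- The Hall-Littlewood functions `P_λ(p; t) = P_λ(p; 0, t)`. -/
noncomputable def hallLittlewoodP {K : Type*} [Field K] (t : K) (l : Ptn) : Sym K :=
  macdonaldP 0 t l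

/-- `Q_λ(p; t) = b_λ(t) P_λ(p; t)`. -/
noncomputable def hallLittlewoodQ {K : Type*} [Field K] (t : K) (l : Ptn) : Sym K :=
  bFactor t l • hallLittlewoodP t l

/-! ### The Fock space of two bosons and vertex operators -/

/-- The Fock module: polynomials in the creation operators `a^{(i)}_{-n}`, `i = 1, 2`, `n ≥ 1`,
applied to the highest weight vector, which is `1`. The index `i` runs through `Fin 2 = {0, 1}`. -/
abbrev Fock (L : Type*) [Field L] : Type _ := MvPolynomial (Fin 2 × ℕ+) L

/-- The operator `a^{(i)}_{-n}`, `n ≥ 1`. -/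
noncomputable def creation {L : Type*} [Field L] (i : Fin 2) (n : ℕ+) :
    Module.End L (Fock L) :=
  LinearMap.mulLeft L (MvPolynomial.X (i, n))

/-- The operator `a^{(i)}_n`, `n ≥ 1`. It kills the highest weight vector and
`[a^{(i)}_n, a^{(j)}_{-m}] = n (1 - q^n) / (1 - t^n) δ_{ij} δ_{nm}`. -/
noncomputable def annihilation {L : Type*} [Field L] (q t : L) (i : Fin 2) (n : ℕ+) :
    Module.End L (Fock L) :=
  (((n : ℕ) : L) * ((1 - q ^ (n : ℕ)) / (1 - t ^ (n : ℕ)))) •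
    (MvPolynomial.pderiv (R := L) (i, n)).toLinearMap

/-- The coefficient of `x^k` in `exp (∑_{n ≥ 1} A_n x^n) = ∑_j (∑_n A_n x^n)^j / j!`
(the terms with `j > k` do not contribute). -/
noncomputable def expCoeff {L : Type*} [Field L] (A : ℕ+ → Module.End L (Fock L)) (k : ℕ) :
    Module.End L (Fock L) :=
  ∑ j ∈ Finset.range (k + 1), ((j.factorial : L)⁻¹) •
    PowerSeries.coeff k
      ((PowerSeries.mk fun m : ℕ => if h : 0 < m then A ⟨m, h⟩ else 0) ^ j)

/-- The coefficient of `z^{-n}` in `exp (∑_{m ≥ 1} A_m z^m) exp (∑_{m ≥ 1} B_m z^{-m})`, applied to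
the vector `v`. For `B_m` of degree `-m` only finitely many terms of the sum are nonzero. -/
noncomputable def vertexMode {L : Type*} [Field L] (A B : ℕ+ → Module.End L (Fock L)) (n : ℤ)
    (v : Fock L) : Fock L :=
  ∑ᶠ k : ℕ, if n ≤ (k : ℤ) then expCoeff A ((k : ℤ) - n).toNat (expCoeff B k v) else 0

/-- The coefficients of the creation part of `η^{(i)}(c z)`. -/
noncomputable def etaCreation {L : Type*} [Field L] (t : L) (i : Fin 2) (c : L) (n : ℕ+) :
    Module.End L (Fock L) :=
  ((1 - t⁻¹ ^ (n : ℕ)) / ((n : ℕ) : L) * c ^ (n : ℕ)) • creation i n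

/-- The coefficients of the annihilation part of `η^{(i)}(c z)`. -/
noncomputable def etaAnnihilation {L : Type*} [Field L] (q t : L) (i : Fin 2) (c : L) (n : ℕ+) :
    Module.End L (Fock L) :=
  (-((1 - t ^ (n : ℕ)) / ((n : ℕ) : L)) * c⁻¹ ^ (n : ℕ)) • annihilation q t i n

/-- The coefficients in the exponent of `φ^{(i)}(c z)`, where `p = q / t`. -/
noncomputable def phiCreation {L : Type*} [Field L] (p t : L) (i : Fin 2) (c : L) (n : ℕ+) :
    Module.End L (Fock L) :=
  ((1 - t⁻¹ ^ (n : ℕ)) / ((n : ℕ) : L) * (1 - p⁻¹ ^ (n : ℕ)) * c ^ (n : ℕ)) • creation i n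

/-! ### The algebra for generic `q`

The parameter `s` is `p^{1/2}`, so that `p = s ^ 2` and `q = t * s ^ 2`. On the Fock module of
highest weight `(u₁, u₂)` the zero mode `U_i` is the scalar `u_i`. -/

/-- The modes of `Λ¹(z) = η^{(1)}(p^{1/2} z) U_1`. -/
noncomputable def lambdaOne {L : Type*} [Field L] (s t : L) (u : Fin 2 → L) (n : ℤ)
    (v : Fock L) : Fock L :=
  u 0 • vertexMode (etaCreation t 0 s) (etaAnnihilation (t * s ^ 2) t 0 s) n v

/-- The modes of `Λ²(z) = φ^{(1)}(p^{1/2} z) η^{(2)}(p^{-1/2} z) U_2`. -/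
noncomputable def lambdaTwo {L : Type*} [Field L] (s t : L) (u : Fin 2 → L) (n : ℤ)
    (v : Fock L) : Fock L :=
  u 1 • vertexMode (fun m => phiCreation (s ^ 2) t 0 s m + etaCreation t 1 s⁻¹ m)
    (etaAnnihilation (t * s ^ 2) t 1 s⁻¹) n v

/-- The modes `X^{(1)}_n` of `X^{(1)}(z) = Λ¹(z) + Λ²(z)`. -/
noncomputable def genXOne {L : Type*} [Field L] (s t : L) (u : Fin 2 → L) (n : ℤ)
    (v : Fock L) : Fock L :=
  lambdaOne s t u n v + lambdaTwo s t u n v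

/-- The formal Laurent series `∑_j c_j x^j`, with only finitely many nonzero `c_j`, `j < 0`, is the
expansion at `x = 0` of the rational function `x^{-N} P(x) / Q(x)`, which is regular at `x₀ ≠ 0`
and has the value `y` there. -/
def HasRationalValue {L : Type*} [Field L] (c : ℤ → L) (x₀ y : L) : Prop :=
  ∃ (N : ℕ) (P Q : Polynomial L),
    (∀ j : ℤ, j < -(N : ℤ) → c j = 0) ∧
    (PowerSeries.mk fun k : ℕ => c ((k : ℤ) - N)) * (Q : PowerSeries L) = (P : PowerSeries L) ∧
    x₀ ≠ 0 ∧ Q.eval x₀ ≠ 0 ∧ y = x₀⁻¹ ^ N * P.eval x₀ / Q.eval x₀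

/-- `B` is the mode `X^{(2)}_n` of `X^{(2)}(z) = X^{(1)}(p z) X^{(1)}(z)`. The product is understood
as usual: a matrix coefficient of the total degree `n` part of `X^{(1)}(z₁) X^{(1)}(z₂)` is
`z₁^{-n} R(z₂/z₁)` with `R(x) = ∑_j ⟨X^{(1)}_{n+j} X^{(1)}_{-j}⟩ x^j` the expansion of a rational
function in `|z₁| > |z₂|`, and at `z₁ = p z`, `z₂ = z` this is `z^{-n} p^{-n} R(p^{-1})`. -/
def IsGenXTwo {L : Type*} [Field L] (s t : L) (u : Fin 2 → L) (n : ℤ)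
    (B : Fock L → Fock L) : Prop :=
  ∀ (v : Fock L) (d : Fin 2 × ℕ+ →₀ ℕ),
    HasRationalValue
      (fun j : ℤ => MvPolynomial.coeff d (genXOne s t u (n + j) (genXOne s t u (-j) v)))
      (s ^ 2)⁻¹ ((s ^ 2) ^ n * MvPolynomial.coeff d (B v))

open Classical in
/-- The modes `X^{(2)}_n`. -/
noncomputable def genXTwo {L : Type*} [Field L] (s t : L) (u : Fin 2 → L) (n : ℤ) :
    Fock L → Fock L :=
  if h : ∃ B, IsGenXTwo s t u n B then h.choose else fun _ => 0

/-! ### The limit `q → 0`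

Here `q` is an indeterminate: the ground field is the field `K(s)` of rational functions of
`s = p^{1/2} = (q/t)^{1/2}`, and `q → 0` means `s → 0`. -/

/-- The rational function `f` has no pole at `0`, and its value there is `a`. -/
def HasValueAtZero {K : Type*} [Field K] (f : RatFunc K) (a : K) : Prop :=
  ∃ P Q : Polynomial K, Q.eval 0 ≠ 0 ∧
    f = algebraMap (Polynomial K) (RatFunc K) P / algebraMap (Polynomial K) (RatFunc K) Q ∧
    a = P.eval 0 / Q.eval 0

/-- The operator `B` is the limit of the operator `A` as `q → 0`, coefficient by coefficient. -/
def IsCrystalLimit {K : Type*} [Field K] (A : Fock (RatFunc K) → Fock (RatFunc K))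
    (B : Fock K → Fock K) : Prop :=
  ∀ (v : Fock K) (d : Fin 2 × ℕ+ →₀ ℕ),
    HasValueAtZero (MvPolynomial.coeff d (A (MvPolynomial.map RatFunc.C v)))
      (MvPolynomial.coeff d (B v))

open Classical in
/-- The limit of an operator as `q → 0`. -/
noncomputable def crystalLimit {K : Type*} [Field K]
    (A : Fock (RatFunc K) → Fock (RatFunc K)) : Fock K → Fock K :=
  if h : ∃ B, IsCrystalLimit A B then h.choose else fun _ => 0

/-- `p^{|n|/2} X^{(1)}_n` over `K(p^{1/2})`. -/
noncomputable def scaledXOne {K : Type*} [Field K] (t : K) (u : Fin 2 → K) (n : ℤ)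
    (v : Fock (RatFunc K)) : Fock (RatFunc K) :=
  (RatFunc.X : RatFunc K) ^ n.natAbs •
    genXOne RatFunc.X (RatFunc.C t) (fun i => RatFunc.C (u i)) n v

/-- `p^{n/2} X^{(2)}_n` over `K(p^{1/2})`. -/
noncomputable def scaledXTwo {K : Type*} [Field K] (t : K) (u : Fin 2 → K) (n : ℤ)
    (v : Fock (RatFunc K)) : Fock (RatFunc K) :=
  (RatFunc.X : RatFunc K) ^ n •
    genXTwo RatFunc.X (RatFunc.C t) (fun i => RatFunc.C (u i)) n v

/-- `X̃^{(1)}_n = lim_{q → 0} p^{|n|/2} X^{(1)}_n`. -/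
noncomputable def crystalXOne {K : Type*} [Field K] (t : K) (u : Fin 2 → K) (n : ℤ) :
    Fock K → Fock K :=
  crystalLimit (scaledXOne t u n)

/-- `X̃^{(2)}_n = lim_{q → 0} p^{n/2} X^{(2)}_n`. -/
noncomputable def crystalXTwo {K : Type*} [Field K] (t : K) (u : Fin 2 → K) (n : ℤ) :
    Fock K → Fock K :=
  crystalLimit (scaledXTwo t u n)

/-! ### The Shapovalov matrix -/

/-- The vector `|X̃_λ⟩ = X̃²_{-λ²₁} X̃²_{-λ²₂} ⋯ X̃¹_{-λ¹₁} X̃¹_{-λ¹₂} ⋯ |u⟩`. -/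
noncomputable def ketX {K : Type*} [Field K] (t : K) (u : Fin 2 → K) (l : PtnPair) : Fock K :=
  l.2.rows.foldr (fun k v => crystalXTwo t u (-(k : ℤ)) v)
    (l.1.rows.foldr (fun k v => crystalXOne t u (-(k : ℤ)) v) 1)

/-- The functional `⟨X̃_λ| = ⟨u| ⋯ X̃¹_{λ¹₂} X̃¹_{λ¹₁} ⋯ X̃²_{λ²₂} X̃²_{λ²₁}`, where `⟨u|` kills every
`b^{(i)}_{-n}` with `n ≥ 1` and `⟨u|u⟩ = 1`, so that it is the constant term. -/
noncomputable def braX {K : Type*} [Field K] (t : K) (u : Fin 2 → K) (l : PtnPair)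
    (v : Fock K) : K :=
  MvPolynomial.constantCoeff
    (l.1.rows.foldl (fun w k => crystalXOne t u (k : ℤ) w)
      (l.2.rows.foldl (fun w k => crystalXTwo t u (k : ℤ) w) v))

/-- The Shapovalov matrix `S_{λ,μ} = ⟨X̃_λ|X̃_μ⟩`. -/
noncomputable def shapovalov {K : Type*} [Field K] (t : K) (u : Fin 2 → K) (l m : PtnPair) : K :=
  braX t u l (ketX t u m)

/-- `S` and `T` are mutually inverse matrices with finitely supported rows and columns. -/
def IsInverseMatrix {ι K : Type*} [DecidableEq ι] [Field K] (S T : ι → ι → K) : Prop :=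
  (∀ i, {j | S i j ≠ 0}.Finite ∧ {j | S j i ≠ 0}.Finite) ∧
  (∀ i, {j | T i j ≠ 0}.Finite ∧ {j | T j i ≠ 0}.Finite) ∧
  (∀ i k, ∑ᶠ j, S i j * T j k = if i = k then 1 else 0) ∧
  (∀ i k, ∑ᶠ j, T i j * S j k = if i = k then 1 else 0)

end Crystal

/-! At generic `q` every generator is a sum of vertex operators, each of which is a creation
exponential, a power series in z, followed by an annihilation exponential. By Taylor's formula the
latter is a translation of the variables, so it is modelled by `shift` and a mode by `pair`. Moving
a translation past a creation exponential produces a scalar contraction in z₂/z₁. For the product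
X^(1)(z₁) X^(1)(z₂) the four contractions are rational functions. At z₂/z₁ = 1/p three of them
vanish because of the factor 1 - p z₂/z₁, and only Λ²(pz) Λ¹(z) survives, without any contraction
(`isGenXTwo_normXTwo`). Pulling the powers of s = p^{1/2} out by homogeneity leaves operators with
polynomial dependence on s, so the limit is evaluation at s = 0. For X^(1)_n only Λ¹ survives if n >
0 and only Λ² if n < 0 (`crystalXOne_spec`, `crystalXTwo_spec`). The limits are Jing's
Hall–Littlewood vertex operators J_n (`jing` with ε = 1), with r = 1/t. The modes of X^(2) act as
J_n on functions of a^(2) and commute with functions of a^(2) - a^(1). The negative modes of X^(1)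
act as J on functions of a^(2) - a^(1). Hence a ket is, up to powers of the u_i, Q_{μ²}(a^(2))
Q_{μ¹}(a^(2) - a^(1)) (`ketX_eq`). On the bra side the positive modes of X^(1) only see the quotient
a^(2) = 0, a^(1) = -p_n, where they are the dual operators, adjoint to J. So the matrix element
factors into ⟨Q_{λ¹}, Q_{μ¹}⟩, which is diagonal, and a pairing of Q_{λ²}(-p) with Q_{μ²}
(`braX_eq`). That J_{-λ₁} J_{-λ₂} ⋯ 1 is Q_λ is proved from the definition of P_λ. Orthogonality
follows from the commutation relation `jing_dual_mul`. Triangularity follows from the expansion of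
these vectors in the products q_μ, since pairing with q_μ extracts the coefficient of m_μ
(`coeff_toVars`). The inverse comes from Parseval's formula in the basis Q_λ, because p_n ↦ -p_n is
a self-adjoint involution (`finsum_signedPairing`). -/

namespace Crystal
open Finset

/-! ### Exponentials of formal power series -/

section Theta
variable {A : Type*} [Ring A]

/-- The Euler operator `z d/dz` on power series over a ring that need not be commutative. -/
noncomputable def theta (f : PowerSeries A) : PowerSeries A :=
  PowerSeries.mk fun k => (k : A) * PowerSeries.coeff k f

@[simp] lemma coeff_theta (f : PowerSeries A) (k : ℕ) :
    PowerSeries.coeff k (theta f) = (k : A) * PowerSeries.coeff k f := by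
  simp [theta]

lemma theta_add (f g : PowerSeries A) : theta (f + g) = theta f + theta g := by
  ext k; simp [mul_add]

lemma theta_mul (f g : PowerSeries A) : theta (f * g) = theta f * g + f * theta g := by
  ext k
  simp only [coeff_theta, map_add, PowerSeries.coeff_mul, Finset.mul_sum]
  rw [← Finset.sum_add_distrib]
  refine Finset.sum_congr rfl fun x hx => ?_
  rw [← mem_antidiagonal.1 hx]
  push_cast
  rw [add_mul, ← mul_assoc, ← mul_assoc, ← mul_assoc,
    (Nat.cast_commute x.2 (PowerSeries.coeff x.1 f)).eq]

lemma theta_one : theta (1 : PowerSeries A) = 0 := by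
  ext k
  rcases eq_or_ne k 0 with rfl | hk <;> simp [PowerSeries.coeff_one, *]

lemma theta_map {B : Type*} [Ring B] (φ : A →+* B) (f : PowerSeries A) :
    theta (f.map φ) = (theta f).map φ := by
  ext k; simp

/-- The power rule over a noncommutative ring needs only that `f` commutes with its own derivative.
This generality is needed because the exponents are series of operators. -/
lemma theta_pow_succ {f : PowerSeries A} (h : f * theta f = theta f * f) (j : ℕ) :
    theta (f ^ (j + 1)) = ((j + 1 : ℕ) : PowerSeries A) * (f ^ j * theta f) := by
  induction j with
  | zero => simp
  | succ j ih =>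
    rw [pow_succ, theta_mul, ih, mul_assoc, mul_assoc, ← h, ← mul_assoc (f ^ j), ← pow_succ]
    push_cast
    noncomm_ring

/-- The power series `∑_{m ≥ 1} a_m z^m`. -/
noncomputable def ogf (a : ℕ+ → A) : PowerSeries A :=
  PowerSeries.mk fun m : ℕ => if h : 0 < m then a ⟨m, h⟩ else 0

lemma coeff_ogf (a : ℕ+ → A) (m : ℕ+) : PowerSeries.coeff (m : ℕ) (ogf a) = a m := by
  rw [ogf, PowerSeries.coeff_mk, dif_pos m.pos]
  rfl

@[simp] lemma coeff_zero_ogf (a : ℕ+ → A) : PowerSeries.coeff 0 (ogf a) = 0 := by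
  simp [ogf]

@[simp] lemma constantCoeff_ogf (a : ℕ+ → A) : PowerSeries.constantCoeff (ogf a) = 0 := by
  rw [← PowerSeries.coeff_zero_eq_constantCoeff_apply, coeff_zero_ogf]

lemma ogf_ext {f g : PowerSeries A} (h0 : PowerSeries.coeff 0 f = PowerSeries.coeff 0 g)
    (h : ∀ m : ℕ+, PowerSeries.coeff (m : ℕ) f = PowerSeries.coeff (m : ℕ) g) : f = g := by
  ext k
  rcases Nat.eq_zero_or_pos k with rfl | hk
  · exact h0
  · exact h ⟨k, hk⟩

lemma ogf_add (a b : ℕ+ → A) : ogf (fun m => a m + b m) = ogf a + ogf b :=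
  ogf_ext (by simp) fun m => by simp [coeff_ogf]

lemma ogf_map {B : Type*} [Ring B] (φ : A →+* B) (a : ℕ+ → A) :
    (ogf a).map φ = ogf fun m => φ (a m) :=
  ogf_ext (by simp) fun m => by simp [coeff_ogf]

/-- `E = exp F`, expressed by the differential equation `z E' = E · z F'` and `E(0) = 1`. -/
def IsExp (F E : PowerSeries A) : Prop :=
  PowerSeries.coeff 0 E = 1 ∧ theta E = E * theta F

lemma IsExp.coeff_rec {F E : PowerSeries A} (h : IsExp F E) (k : ℕ) :
    (k : A) * PowerSeries.coeff k E = ∑ x ∈ antidiagonal k,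
      PowerSeries.coeff x.1 E * ((x.2 : A) * PowerSeries.coeff x.2 F) := by
  rw [← coeff_theta, h.2, PowerSeries.coeff_mul]
  simp

lemma IsExp.map {B : Type*} [Ring B] (φ : A →+* B) {F E : PowerSeries A} (h : IsExp F E) :
    IsExp (F.map φ) (E.map φ) :=
  ⟨by rw [PowerSeries.coeff_map, h.1, map_one], by rw [theta_map, h.2, map_mul, theta_map]⟩

/-- Since `theta F` has no constant term, k times the k-th coefficient of E is determined by the
lower ones, and k is a unit in an algebra over a field of characteristic 0. Identities between
exponentials are thereby reduced to identities between exponents. -/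
lemma IsExp.unique (L : Type*) [Field L] [CharZero L] [Algebra L A] {F E E' : PowerSeries A}
    (h : IsExp F E) (h' : IsExp F E') : E = E' := by
  ext k
  induction k using Nat.strong_induction_on with
  | _ k ih =>
    rcases Nat.eq_zero_or_pos k with rfl | hk
    · rw [h.1, h'.1]
    · have key : (k : A) * PowerSeries.coeff k E = (k : A) * PowerSeries.coeff k E' := by
        rw [h.coeff_rec, h'.coeff_rec]
        refine Finset.sum_congr rfl fun x hx => ?_
        rcases Nat.eq_zero_or_pos x.2 with h0 | h0
        · simp [h0]
        · rw [ih x.1 (by have := mem_antidiagonal.1 hx; omega)]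
      have hu : IsUnit (k : A) := by
        have : (k : A) = algebraMap L A (k : L) := by simp
        rw [this]
        exact (IsUnit.mk0 (k : L) (by exact_mod_cast hk.ne')).map _
      exact hu.mul_left_cancel key

/-- The exponential of a power series without constant term. -/
noncomputable def expSeries (L : Type*) [Field L] [Algebra L A] (F : PowerSeries A) :
    PowerSeries A :=
  PowerSeries.mk fun k => ∑ j ∈ Finset.range (k + 1),
    ((j.factorial : L)⁻¹) • PowerSeries.coeff k (F ^ j)

lemma coeff_pow_eq_zero {F : PowerSeries A} (h : PowerSeries.coeff 0 F = 0) {j k : ℕ}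
    (hk : k < j) : PowerSeries.coeff k (F ^ j) = 0 := by
  induction j generalizing k with
  | zero => omega
  | succ j ih =>
    rw [pow_succ, PowerSeries.coeff_mul]
    refine Finset.sum_eq_zero fun x hx => ?_
    rcases Nat.eq_zero_or_pos x.2 with h0 | h0
    · rw [h0, h, mul_zero]
    · rw [ih (by have := mem_antidiagonal.1 hx; omega), zero_mul]

variable {L : Type*} [Field L] [Algebra L A]

lemma coeff_expSeries {F : PowerSeries A} (h : PowerSeries.coeff 0 F = 0) {k n : ℕ}
    (hk : k < n) : PowerSeries.coeff k (expSeries L F) =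
      ∑ j ∈ Finset.range n, ((j.factorial : L)⁻¹) • PowerSeries.coeff k (F ^ j) := by
  rw [expSeries, PowerSeries.coeff_mk]
  refine Finset.sum_subset (fun x hx => ?_) fun x _ hx => ?_
  · simp only [Finset.mem_range] at *; omega
  · rw [coeff_pow_eq_zero h (by simp only [Finset.mem_range] at hx; omega), smul_zero]

lemma isExp_expSeries_of_commute [CharZero L] {F : PowerSeries A} (h : PowerSeries.coeff 0 F = 0)
    (hc : F * theta F = theta F * F) : IsExp F (expSeries L F) := by
  refine ⟨by simp [expSeries], ?_⟩
  ext k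
  -- The exponential sum is cut at k + 2 instead of k + 1: the term j = 0 is killed by the
  -- derivation, and the remaining k + 1 terms match those on the right.
  rw [coeff_theta, coeff_expSeries h (Nat.lt_succ_of_lt (Nat.lt_succ_self k)),
    PowerSeries.coeff_mul, Finset.sum_range_succ', mul_add, Finset.mul_sum]
  have h0 : (k : A) * ((Nat.factorial 0 : L)⁻¹ • PowerSeries.coeff k (F ^ 0)) = 0 := by
    rcases eq_or_ne k 0 with rfl | hk <;> simp [PowerSeries.coeff_one, *]
  rw [h0, add_zero]
  have h1 : ∀ x ∈ antidiagonal k,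
      PowerSeries.coeff x.1 (expSeries L F) * PowerSeries.coeff x.2 (theta F) =
      ∑ j ∈ Finset.range (k + 1), ((j.factorial : L)⁻¹) •
        (PowerSeries.coeff x.1 (F ^ j) * PowerSeries.coeff x.2 (theta F)) := by
    intro x hx
    rw [coeff_expSeries h (show x.1 < k + 1 by have := mem_antidiagonal.1 hx; omega),
      Finset.sum_mul]
    simp
  rw [Finset.sum_congr rfl h1, Finset.sum_comm]
  refine Finset.sum_congr rfl fun j _ => ?_
  rw [← Finset.smul_sum, ← PowerSeries.coeff_mul, mul_smul_comm, ← coeff_theta,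
    theta_pow_succ hc, ← nsmul_eq_mul, map_nsmul, ← Nat.cast_smul_eq_nsmul L, smul_smul]
  congr 1
  rw [Nat.factorial_succ]
  have : ((j + 1 : ℕ) : L) ≠ 0 := by exact_mod_cast Nat.succ_ne_zero j
  have h2 : (j.factorial : L) ≠ 0 := by exact_mod_cast j.factorial_ne_zero
  push_cast at *
  field_simp

end Theta

section ExpComm
variable {A : Type*} [CommRing A]

lemma IsExp.mul {F E F' E' : PowerSeries A} (h : IsExp F E) (h' : IsExp F' E') :
    IsExp (F + F') (E * E') := by
  refine ⟨by simp [PowerSeries.coeff_mul, h.1, h'.1], ?_⟩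
  rw [theta_mul, theta_add, h.2, h'.2]
  ring

lemma isExp_zero : IsExp (0 : PowerSeries A) 1 := by
  refine ⟨by simp, ?_⟩
  rw [theta_one]
  ext; simp

lemma IsExp.rescale (c : A) {F E : PowerSeries A} (h : IsExp F E) :
    IsExp (PowerSeries.rescale c F) (PowerSeries.rescale c E) := by
  have hθ : ∀ G : PowerSeries A,
      theta (PowerSeries.rescale c G) = PowerSeries.rescale c (theta G) := fun G => by
    ext k; simp [PowerSeries.coeff_rescale]; ring
  exact ⟨by simp [PowerSeries.coeff_rescale, -PowerSeries.coeff_zero_eq_constantCoeff, h.1], by rw [hθ, h.2, map_mul, hθ]⟩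

lemma isExp_expSeries (L : Type*) [Field L] [CharZero L] [Algebra L A] (a : ℕ+ → A) :
    IsExp (ogf a) (expSeries L (ogf a)) :=
  isExp_expSeries_of_commute (by simp) (mul_comm _ _)

lemma ogf_rescale (c : A) (a : ℕ+ → A) :
    PowerSeries.rescale c (ogf a) = ogf fun m => c ^ (m : ℕ) * a m :=
  ogf_ext (by simp [PowerSeries.coeff_rescale]) fun m => by
    simp [coeff_ogf, PowerSeries.coeff_rescale]

end ExpComm

/-! ### Shift operators and modes of vertex operators -/

section Shift
variable {R : Type*} [CommRing R] {σ : Type*} (deg : σ → ℕ)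

/-- The homomorphism `X_i ↦ X_i + β_i T^{deg i}`, which is `exp (∑_i β_i T^{deg i} ∂_i)`. -/
noncomputable def shift (β : σ → R) :
    MvPolynomial σ R →ₐ[R] Polynomial (MvPolynomial σ R) :=
  MvPolynomial.aeval fun i =>
    Polynomial.C (MvPolynomial.X i) + Polynomial.C (MvPolynomial.C (β i)) * Polynomial.X ^ deg i

@[simp] lemma shift_X (β : σ → R) (i : σ) : shift deg β (MvPolynomial.X i) =
    Polynomial.C (MvPolynomial.X i) + Polynomial.C (MvPolynomial.C (β i)) * Polynomial.X ^ deg i := by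
  simp [shift]

@[simp] lemma shift_C (β : σ → R) (c : R) : shift deg β (MvPolynomial.C c) =
    Polynomial.C (MvPolynomial.C c) := by
  rw [← MvPolynomial.algebraMap_eq, AlgHom.commutes]; rfl

lemma shift_zero (v : MvPolynomial σ R) : shift deg (0 : σ → R) v = Polynomial.C v := by
  induction v using MvPolynomial.induction_on with
  | C a => simp
  | add p q hp hq => simp [hp, hq]
  | mul_X p i hp => simp [hp]

lemma shift_map {R' : Type*} [CommRing R'] (φ : R →+* R') (β : σ → R) (v : MvPolynomial σ R) :
    shift deg (fun i => φ (β i)) (MvPolynomial.map φ v) =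
      (shift deg β v).map (MvPolynomial.map φ) := by
  induction v using MvPolynomial.induction_on with
  | C a => simp
  | add p q hp hq => simp [hp, hq]
  | mul_X p i hp => simp [hp]

/-- Rescaling the translation vector by weights is the substitution T ↦ cT. -/
lemma coeff_shift_smul (c : R) (β : σ → R) (v : MvPolynomial σ R) (k : ℕ) :
    (shift deg (fun i => c ^ deg i * β i) v).coeff k =
      MvPolynomial.C (c ^ k) * (shift deg β v).coeff k := by
  have h : shift deg (fun i => c ^ deg i * β i) v =
      (shift deg β v).comp (Polynomial.C (MvPolynomial.C c) * Polynomial.X) := by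
    induction v using MvPolynomial.induction_on with
    | C a => simp
    | add p q hp hq => simp [hp, hq]
    | mul_X p i hp => simp [hp, mul_pow]; ring
  rw [h, Polynomial.comp_C_mul_X_coeff, ← map_pow, mul_comm]

end Shift

/-! ### Pairing a power series in z with a polynomial in 1/z. -/

section Pair
variable {A : Type*} [CommRing A]

/-- The coefficient of `z^n`, for an integer `n`. -/
noncomputable def coeffZ (E : PowerSeries A) (n : ℤ) : A := if 0 ≤ n then PowerSeries.coeff n.toNat E else 0

@[simp] lemma coeffZ_natCast (E : PowerSeries A) (n : ℕ) :
    coeffZ E n = PowerSeries.coeff n E := by simp [coeffZ]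

lemma coeffZ_of_neg (E : PowerSeries A) {n : ℤ} (h : n < 0) : coeffZ E n = 0 := by
  simp [coeffZ, h]

lemma coeffZ_map {B : Type*} [CommRing B] (φ : A →+* B) (E : PowerSeries A) (n : ℤ) :
    coeffZ (E.map φ) n = φ (coeffZ E n) := by
  unfold coeffZ; split_ifs <;> simp

/-- The coefficient of `z^{-n}` in `E(z) P(z^{-1})`. -/
noncomputable def pair (E : PowerSeries A) (n : ℤ) : Polynomial A →ₗ[A] A :=
  Polynomial.lsum fun k => LinearMap.mulLeft A (coeffZ E ((k : ℤ) - n))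

lemma pair_apply (E : PowerSeries A) (n : ℤ) (P : Polynomial A) :
    pair E n P = P.sum fun k c => coeffZ E ((k : ℤ) - n) * c := by
  simp [pair, Polynomial.lsum_apply]

lemma pair_eq_sum (E : PowerSeries A) (n : ℤ) (P : Polynomial A) {M : ℕ}
    (hM : P.natDegree < M) :
    pair E n P = ∑ k ∈ Finset.range M, coeffZ E ((k : ℤ) - n) * P.coeff k := by
  rw [pair_apply, Polynomial.sum_over_range' P (by simp) M hM]

@[simp] lemma pair_monomial (E : PowerSeries A) (n : ℤ) (k : ℕ) (c : A) :
    pair E n (Polynomial.monomial k c) = coeffZ E ((k : ℤ) - n) * c := by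
  rw [pair_apply, Polynomial.sum_monomial_index _ _ (by simp)]

lemma pair_C (E : PowerSeries A) (n : ℤ) (c : A) :
    pair E n (Polynomial.C c) = coeffZ E (-n) * c := by
  rw [← Polynomial.monomial_zero_left, pair_monomial]; simp

lemma pair_C_mul (E : PowerSeries A) (n : ℤ) (c : A) (P : Polynomial A) :
    pair E n (Polynomial.C c * P) = c * pair E n P := by
  rw [← Polynomial.smul_eq_C_mul, map_smul, smul_eq_mul]

lemma pair_X_pow_mul (E : PowerSeries A) (n : ℤ) (i : ℕ) (P : Polynomial A) :
    pair E n (Polynomial.X ^ i * P) = pair E (n - i) P := by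
  induction P using Polynomial.induction_on' with
  | add p q hp hq => rw [mul_add, map_add, map_add, hp, hq]
  | monomial k c =>
    rw [Polynomial.X_pow_mul_monomial, pair_monomial, pair_monomial]
    congr 2; push_cast; ring

lemma pair_map {B : Type*} [CommRing B] (φ : A →+* B) (E : PowerSeries A) (n : ℤ)
    (P : Polynomial A) : pair (E.map φ) n (P.map φ) = φ (pair E n P) := by
  induction P using Polynomial.induction_on' with
  | add p q hp hq => rw [Polynomial.map_add, map_add, map_add, map_add, hp, hq]
  | monomial k c => simp [coeffZ_map]

end Pair

end Crystal
namespace Crystal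
open Finset

/-! ### Products of two vertex operators -/

section Product
variable {A : Type*} [CommRing A]

lemma bivariate_induction {p : Polynomial (Polynomial A) → Prop} (W : Polynomial (Polynomial A))
    (hadd : ∀ V W, p V → p W → p (V + W))
    (hmono : ∀ (a b : ℕ) (c : A), p (Polynomial.monomial b (Polynomial.monomial a c))) : p W := by
  induction W using Polynomial.induction_on' with
  | add V W hV hW => exact hadd _ _ hV hW
  | monomial b Q =>
    induction Q using Polynomial.induction_on' with
    | add V W hV hW => rw [map_add]; exact hadd _ _ hV hW
    | monomial a c => exact hmono a b c

/-- The coefficient of `z₁^{-c} z₂^{-d}` in `E₁(z₁) E₂(z₂) W(z₁^{-1}, z₂^{-1})`; the inner variable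
of `W` is `z₁^{-1}`. -/
noncomputable def nord (E₁ E₂ : PowerSeries A) (c d : ℤ) (W : Polynomial (Polynomial A)) : A :=
  W.sum fun b Q => coeffZ E₂ ((b : ℤ) - d) * pair E₁ c Q

variable (E₁ E₂ : PowerSeries A)

lemma nord_add (c d : ℤ) (V W : Polynomial (Polynomial A)) :
    nord E₁ E₂ c d (V + W) = nord E₁ E₂ c d V + nord E₁ E₂ c d W := by
  unfold nord
  rw [Polynomial.sum_add_index _ _ _ (by simp) (by intros; rw [map_add, mul_add])]

lemma nord_monomial' (c d : ℤ) (b : ℕ) (Q : Polynomial A) :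
    nord E₁ E₂ c d (Polynomial.monomial b Q) = coeffZ E₂ ((b : ℤ) - d) * pair E₁ c Q := by
  unfold nord
  rw [Polynomial.sum_monomial_index _ _ (by simp)]

lemma nord_monomial (c d : ℤ) (a b : ℕ) (x : A) :
    nord E₁ E₂ c d (Polynomial.monomial b (Polynomial.monomial a x)) =
      coeffZ E₂ ((b : ℤ) - d) * (coeffZ E₁ ((a : ℤ) - c) * x) := by
  rw [nord_monomial', pair_monomial]

/-- A polynomial W has bounded degrees, so normally ordered modes of large index annihilate. This
makes all the `finsum`s over modes genuinely finite. -/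
lemma exists_nord_eq_zero (W : Polynomial (Polynomial A)) :
    ∃ M : ℕ, ∀ c d : ℤ, (M : ℤ) ≤ c ∨ (M : ℤ) ≤ d → nord E₁ E₂ c d W = 0 := by
  induction W using bivariate_induction with
  | hadd V W hV hW =>
    obtain ⟨M, hM⟩ := hV
    obtain ⟨M', hM'⟩ := hW
    refine ⟨M + M', fun c d h => ?_⟩
    rw [nord_add, hM c d (by push_cast at h; omega), hM' c d (by push_cast at h; omega), add_zero]
  | hmono a b x =>
    refine ⟨a + b + 1, fun c d h => ?_⟩
    rw [nord_monomial]
    rcases h with h | h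
    · rw [coeffZ_of_neg E₁ (by push_cast at h; omega)]; simp
    · rw [coeffZ_of_neg E₂ (by push_cast at h; omega)]; simp

lemma finite_nord_line (n : ℤ) (W : Polynomial (Polynomial A)) :
    (Function.support fun k : ℤ => nord E₁ E₂ (n - k) k W).Finite := by
  obtain ⟨M, hM⟩ := exists_nord_eq_zero E₁ E₂ W
  refine (Set.finite_Ioo (n - M) (M : ℤ)).subset fun k hk => ?_
  by_contra h
  refine hk (hM _ _ ?_)
  simp only [Set.mem_Ioo, not_and_or, not_lt] at h
  omega

lemma finite_nord_ray (g : ℕ → A) (c d : ℤ) (W : Polynomial (Polynomial A)) :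
    (Function.support fun i : ℕ => g i * nord E₁ E₂ (c - i) (d + i) W).Finite := by
  obtain ⟨M, hM⟩ := exists_nord_eq_zero E₁ E₂ W
  refine (Set.finite_Iio (M + d.natAbs)).subset fun k hk => ?_
  by_contra h
  simp only [Set.mem_Iio, not_lt] at h
  refine hk ?_
  simp only
  rw [hM _ _ (Or.inr (by omega)), mul_zero]

lemma coeffZ_mul (n : ℤ) : coeffZ (E₁ * E₂) n = ∑ᶠ k : ℤ, coeffZ E₂ k * coeffZ E₁ (n - k) := by
  rcases lt_or_ge n 0 with hn | hn
  · rw [coeffZ_of_neg _ hn]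
    symm
    apply finsum_eq_zero_of_forall_eq_zero
    intro k
    rcases lt_or_ge k 0 with hk | hk
    · rw [coeffZ_of_neg _ hk, zero_mul]
    · rw [coeffZ_of_neg E₁ (by omega), mul_zero]
  · lift n to ℕ using hn
    rw [finsum_eq_sum_of_support_subset (s := (range (n + 1)).map Nat.castEmbedding),
      Finset.sum_map, coeffZ_natCast, mul_comm E₁, PowerSeries.coeff_mul,
      Finset.Nat.sum_antidiagonal_eq_sum_range_succ_mk]
    · refine Finset.sum_congr rfl fun k hk => ?_
      have hk' := Finset.mem_range.1 hk
      simp only [Nat.castEmbedding_apply, coeffZ_natCast]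
      rw [← Nat.cast_sub (by omega), coeffZ_natCast]
    · intro k hk
      by_contra h
      apply hk
      simp only
      rcases lt_or_ge k 0 with hk | hk
      · rw [coeffZ_of_neg _ hk, zero_mul]
      · rw [coeffZ_of_neg E₁, mul_zero]
        lift k to ℕ using hk
        simp only [coe_map, Nat.castEmbedding_apply, Set.mem_image, mem_coe,
          Finset.mem_range, Nat.cast_inj, exists_eq_right] at h
        omega

lemma finite_coeffZ_mul (n : ℤ) :
    (Function.support fun k : ℤ => coeffZ E₂ k * coeffZ E₁ (n - k)).Finite := by
  refine (Set.finite_Icc 0 n).subset fun k hk => ?_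
  by_contra h
  simp only [Set.mem_Icc, not_and_or, not_le] at h
  apply hk
  simp only
  rcases h with h | h
  · rw [coeffZ_of_neg _ h, zero_mul]
  · rw [coeffZ_of_neg E₁ (by omega), mul_zero]

/-- The specialization `z₁ = z₂` of a normally ordered product. -/
lemma finsum_nord (n : ℤ) (W : Polynomial (Polynomial A)) :
    ∑ᶠ k : ℤ, nord E₁ E₂ (n - k) k W = pair (E₁ * E₂) n (W.eval Polynomial.X) := by
  induction W using bivariate_induction with
  | hadd V W hV hW =>
    simp_rw [nord_add]
    rw [finsum_add_distrib (finite_nord_line _ _ _ _) (finite_nord_line _ _ _ _), hV, hW,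
      Polynomial.eval_add, map_add]
  | hmono a b x =>
    rw [Polynomial.eval_monomial, Polynomial.monomial_mul_X_pow, pair_monomial, coeffZ_mul,
      finsum_mul' _ _ (finite_coeffZ_mul _ _ _), ← finsum_comp_equiv (Equiv.subLeft (b : ℤ))]
    refine finsum_congr fun k => ?_
    rw [nord_monomial, mul_assoc, Equiv.subLeft_apply]
    have h : (a : ℤ) - (n - (b - k)) = (a + b : ℕ) - n - k := by push_cast; ring
    rw [h, sub_sub_cancel]

/-- Normal ordering does not depend on the order of the two factors. With `swap_map_shift` it allows
the two orders of a product to be expanded in the same normally ordered terms. -/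
lemma nord_swap (c d : ℤ) (W : Polynomial (Polynomial A)) :
    nord E₂ E₁ d c (Polynomial.Bivariate.swap W) = nord E₁ E₂ c d W := by
  induction W using bivariate_induction with
  | hadd V W hV hW => rw [map_add, nord_add, nord_add, hV, hW]
  | hmono a b x =>
    rw [Polynomial.Bivariate.swap_monomial_monomial, nord_monomial, nord_monomial]
    ring

/-- The product formula: the annihilation part `S` of the first operator, moved past the creation
part of the second one, produces the contraction `∑ g_i (z₂/z₁)^i`. -/
lemma pair_map_pair (S : A →+* Polynomial A) (g : ℕ → A)
    (hg : E₂.map S = E₂.map Polynomial.C * PowerSeries.mk fun i =>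
      Polynomial.C (g i) * Polynomial.X ^ i) (n₁ n₂ : ℤ) (P : Polynomial A) :
    pair E₁ n₁ (S (pair E₂ n₂ P)) =
      ∑ᶠ i : ℕ, g i * nord E₁ E₂ (n₁ - i) (n₂ + i) (P.map S) := by
  induction P using Polynomial.induction_on' with
  | add p q hp hq =>
    rw [map_add, map_add, map_add, hp, hq, Polynomial.map_add]
    simp_rw [nord_add, mul_add]
    rw [finsum_add_distrib (finite_nord_ray _ _ _ _ _ _) (finite_nord_ray _ _ _ _ _ _)]
  | monomial b c =>
    rw [pair_monomial, map_mul, Polynomial.map_monomial, ← coeffZ_map, hg]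
    simp_rw [nord_monomial', sub_add_eq_sub_sub]
    generalize (b : ℤ) - n₂ = m
    rcases lt_or_ge m 0 with hm | hm
    · rw [coeffZ_of_neg _ hm, zero_mul, map_zero]
      symm
      apply finsum_eq_zero_of_forall_eq_zero
      intro i
      rw [coeffZ_of_neg _ (by omega)]; ring
    · lift m to ℕ using hm
      rw [finsum_eq_sum_of_support_subset (s := range (m + 1)), coeffZ_natCast, mul_comm (E₂.map _),
        PowerSeries.coeff_mul, Finset.Nat.sum_antidiagonal_eq_sum_range_succ_mk, Finset.sum_mul,
        map_sum]
      · refine Finset.sum_congr rfl fun i hi => ?_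
        have hi' := Finset.mem_range.1 hi
        rw [PowerSeries.coeff_mk, PowerSeries.coeff_map, ← Nat.cast_sub (by omega), coeffZ_natCast,
          ← pair_X_pow_mul, ← pair_C_mul, ← pair_C_mul]
        congr 1
        ring
      · intro i hi
        by_contra h
        apply hi
        simp only [coe_range, Set.mem_Iio, not_lt] at h
        simp only
        rw [coeffZ_of_neg _ (by omega)]; ring

end Product

/-! ### Composition of translations and their contraction with exponentials. -/

section Shift
variable {R : Type*} [CommRing R] {σ : Type*} (deg : σ → ℕ)

/-- `shift`, as a homomorphism of rings. -/
noncomputable abbrev shiftHom (β : σ → R) :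
    MvPolynomial σ R →+* Polynomial (MvPolynomial σ R) := shift deg β

/-- Two successive translations with the same parameter add up; this is the annihilation part of a
product of vertex operators at z₁ = z₂. -/
lemma eval_map_shift (β γ : σ → R) (v : MvPolynomial σ R) :
    ((shift deg γ v).map (shiftHom deg β)).eval Polynomial.X =
      shift deg (fun i => β i + γ i) v := by
  induction v using MvPolynomial.induction_on with
  | C a => simp
  | add p q hp hq => simp only [map_add, Polynomial.map_add, Polynomial.eval_add, hp, hq]
  | mul_X p i hp =>
    simp only [map_mul, Polynomial.map_mul, Polynomial.eval_mul, hp]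
    simp
    ring

lemma swap_map_shift (β γ : σ → R) (v : MvPolynomial σ R) :
    Polynomial.Bivariate.swap ((shift deg γ v).map (shiftHom deg β)) =
      (shift deg β v).map (shiftHom deg γ) := by
  induction v using MvPolynomial.induction_on with
  | C a => simp [Polynomial.Bivariate.swap_C_C]
  | add p q hp hq => simp only [map_add, Polynomial.map_add, hp, hq]
  | mul_X p i hp =>
    simp only [map_mul, Polynomial.map_mul, hp]
    simp only [shift_X, Polynomial.map_add, Polynomial.map_mul, Polynomial.map_pow,
      Polynomial.map_X, Polynomial.map_C, map_add, map_mul, map_pow, RingHom.coe_coe, shift_C,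
      Polynomial.Bivariate.swap_C_C, Polynomial.Bivariate.swap_X, Polynomial.Bivariate.swap_Y]
    ring

/-- The contraction of an annihilation exponential with a creation exponential whose exponent is
linear. -/
lemma map_shift_exp (L : Type*) [Field L] [CharZero L] [Algebra L R] (β : σ → R)
    {a : ℕ+ → MvPolynomial σ R} {γ : ℕ+ → R} {E : PowerSeries (MvPolynomial σ R)}
    {g : PowerSeries R} (hE : IsExp (ogf a) E) (hg : IsExp (ogf γ) g)
    (ha : ∀ m : ℕ+, shift deg β (a m) = Polynomial.C (a m) +
      Polynomial.C (MvPolynomial.C (γ m)) * Polynomial.X ^ (m : ℕ)) :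
    E.map (shiftHom deg β) = E.map Polynomial.C * PowerSeries.mk fun i =>
      Polynomial.C (MvPolynomial.C (PowerSeries.coeff i g)) * Polynomial.X ^ i := by
  have h1 := hE.map (shiftHom deg β)
  have h2 := hE.map (Polynomial.C : MvPolynomial σ R →+* _)
  have h3 := (hg.map ((Polynomial.C : MvPolynomial σ R →+* _).comp MvPolynomial.C)).rescale
    Polynomial.X
  rw [ogf_map] at h1 h2 h3
  rw [ogf_rescale] at h3
  have h4 := h2.mul h3
  rw [← ogf_add] at h4
  have h5 : (PowerSeries.mk fun i => Polynomial.C (MvPolynomial.C (PowerSeries.coeff i g)) *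
      Polynomial.X ^ i) = PowerSeries.rescale Polynomial.X
        (g.map ((Polynomial.C : MvPolynomial σ R →+* _).comp MvPolynomial.C)) := by
    ext1 i
    rw [PowerSeries.coeff_mk, PowerSeries.coeff_rescale, PowerSeries.coeff_map, mul_comm]
    rfl
  rw [h5]
  -- Both sides are exponentials, so only the exponents have to be compared, and for these the claim
  -- is the hypothesis `ha`.
  refine h1.unique L ?_
  have h6 : (fun m => shiftHom deg β (a m)) = fun m => Polynomial.C (a m) +
      Polynomial.X ^ (m : ℕ) * (Polynomial.C.comp MvPolynomial.C) (γ m) :=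
    funext fun m => by rw [mul_comm]; exact ha m
  rw [h6]
  exact h4

end Shift
end Crystal
namespace Crystal
open Finset

/-! ### The modes of vertex operators as pairings -/

section Modes
variable {L : Type*} [Field L]

/-- The degree of a boson. -/
def bosonDeg (x : Fin 2 × ℕ+) : ℕ := x.2

/-- The coefficients `β_n` in the direction of the boson `i`. -/
def bosonDir {R : Type*} [Zero R] (i : Fin 2) (β : ℕ+ → R) (x : Fin 2 × ℕ+) : R := if x.1 = i then β x.2 else 0

lemma expCoeff_eq (A : ℕ+ → Module.End L (Fock L)) (k : ℕ) :
    expCoeff A k = PowerSeries.coeff k (expSeries L (ogf A)) := by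
  rw [expSeries, PowerSeries.coeff_mk]
  rfl

/-- Left multiplication is an algebra homomorphism, so it carries the exponential of a series of
polynomials to the exponential of the multiplication operators. -/
lemma expCoeff_mulLeft [CharZero L] (a : ℕ+ → Fock L) (k : ℕ) (v : Fock L) :
    expCoeff (fun m => LinearMap.mulLeft L (a m)) k v =
      PowerSeries.coeff k (expSeries L (ogf a)) * v := by
  have h := (isExp_expSeries L a).map (Algebra.lmul L (Fock L)).toRingHom
  rw [ogf_map] at h
  have h2 : IsExp (ogf fun m => (Algebra.lmul L (Fock L)).toRingHom (a m))
      (expSeries L (ogf fun m => (Algebra.lmul L (Fock L)).toRingHom (a m))) := by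
    apply isExp_expSeries_of_commute (by simp)
    rw [← ogf_map, theta_map, ← map_mul, ← map_mul, mul_comm]
  rw [expCoeff_eq]
  have h3 := h2.unique L h
  have h4 : (fun m => LinearMap.mulLeft L (a m)) =
    fun m => (Algebra.lmul L (Fock L)).toRingHom (a m) := rfl
  rw [h4, h3]
  simp

/-- The commutator of two derivations is a derivation, and this one kills the variables. -/
lemma pderiv_comm' {σ : Type*} (i j : σ) (v : MvPolynomial σ L) :
    MvPolynomial.pderiv i (MvPolynomial.pderiv j v) =
      MvPolynomial.pderiv j (MvPolynomial.pderiv i v) := by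
  have h : ⁅(MvPolynomial.pderiv i : Derivation L (MvPolynomial σ L) (MvPolynomial σ L)),
      (MvPolynomial.pderiv j : Derivation L (MvPolynomial σ L) (MvPolynomial σ L))⁆ = 0 := by
    refine MvPolynomial.derivation_ext fun k => ?_
    classical
    simp [Derivation.commutator_apply, MvPolynomial.pderiv_X, Pi.single_apply, apply_ite]
  have h2 := congrArg (fun D => D v) h
  simp only [Derivation.commutator_apply, Derivation.zero_apply] at h2
  exact sub_eq_zero.1 h2

lemma mul_theta_ogf_comm {A : Type*} [Ring A] {B : ℕ+ → A} (h : ∀ m n, B m * B n = B n * B m) :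
    ogf B * theta (ogf B) = theta (ogf B) * ogf B := by
  have hc : ∀ i j : ℕ, PowerSeries.coeff i (ogf B) * PowerSeries.coeff j (ogf B) =
      PowerSeries.coeff j (ogf B) * PowerSeries.coeff i (ogf B) := by
    intro i j
    rcases Nat.eq_zero_or_pos i with rfl | hi
    · simp
    rcases Nat.eq_zero_or_pos j with rfl | hj
    · simp
    have h1 : PowerSeries.coeff i (ogf B) = B ⟨i, hi⟩ := coeff_ogf B ⟨i, hi⟩
    have h2 : PowerSeries.coeff j (ogf B) = B ⟨j, hj⟩ := coeff_ogf B ⟨j, hj⟩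
    rw [h1, h2]
    exact h _ _
  ext k
  rw [PowerSeries.coeff_mul, PowerSeries.coeff_mul, ← Finset.Nat.sum_antidiagonal_swap]
  refine Finset.sum_congr rfl fun x _ => ?_
  simp only [coeff_theta, Prod.fst_swap, Prod.snd_swap]
  rw [mul_assoc, ← hc, ← mul_assoc, ← mul_assoc, (Nat.cast_commute x.1 _).eq]

section Euler
variable {σ : Type*} {deg : σ → ℕ} {ι : ℕ+ → σ}
  {β : σ → L}

/-- The Euler identity for shifts. -/
lemma X_mul_derivative_shift (hdeg : ∀ m, deg (ι m) = m) (hβ : ∀ x ∉ Set.range ι, β x = 0)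
    (v : MvPolynomial σ L) :
    ∀ᶠ M in Filter.atTop, Polynomial.X * Polynomial.derivative (shift deg β v) =
      ∑ m ∈ range M, ((m + 1 : ℕ) : Polynomial (MvPolynomial σ L)) * Polynomial.X ^ (m + 1) *
        shift deg β (β (ι m.succPNat) • MvPolynomial.pderiv (ι m.succPNat) v) := by
  classical
  have hι : Function.Injective ι := fun m n h => PNat.eq (by rw [← hdeg, ← hdeg, h])
  induction v using MvPolynomial.induction_on with
  | C a => simp
  | add p q hp hq =>
    filter_upwards [hp, hq] with M h1 h2
    simp only [map_add, smul_add, mul_add, h1, h2, Finset.sum_add_distrib]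
  | mul_X p j hp =>
    -- The range must reach the degree of the new variable `j`, whose derivative contributes the
    -- term m + 1 = deg j.
    filter_upwards [hp, Filter.eventually_ge_atTop (deg j)] with M h1 hM
    have h2 : ∀ m : ℕ, shift deg β (β (ι m.succPNat) •
          MvPolynomial.pderiv (ι m.succPNat) (p * MvPolynomial.X j)) =
        shift deg β (β (ι m.succPNat) • MvPolynomial.pderiv (ι m.succPNat) p) *
          shift deg β (MvPolynomial.X j) +
        shift deg β p * (if ι m.succPNat = j then
            Polynomial.C (MvPolynomial.C (β (ι m.succPNat))) else 0) := by
      intro m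
      rw [Derivation.leibniz, MvPolynomial.pderiv_X, Pi.single_apply]
      simp only [smul_eq_mul, smul_add, map_add, MvPolynomial.smul_eq_C_mul, map_mul, shift_C,
        eq_comm (a := j)]
      split_ifs <;> simp <;> ring
    have h3 : ∑ m ∈ range M, ((m + 1 : ℕ) : Polynomial (MvPolynomial σ L)) *
          Polynomial.X ^ (m + 1) *
        (if ι m.succPNat = j then Polynomial.C (MvPolynomial.C (β (ι m.succPNat))) else 0) =
        Polynomial.X * Polynomial.derivative (shift deg β (MvPolynomial.X j)) := by
      by_cases hj : j ∈ Set.range ι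
      · obtain ⟨j, rfl⟩ := hj
        rw [hdeg] at hM
        have hj : ((j : ℕ) - 1).succPNat = j := by
          apply PNat.eq; have := j.pos; simp only [Nat.succPNat_coe]; omega
        have hj' : (j : ℕ) - 1 + 1 = j := by have := j.pos; omega
        rw [Finset.sum_eq_single ((j : ℕ) - 1)]
        · rw [hj, hj', if_pos rfl, shift_X, map_add, Polynomial.derivative_C,
            Polynomial.derivative_C_mul_X_pow, zero_add, hdeg]
          nth_rewrite 2 [← hj']
          rw [pow_succ]
          simp
          ring
        · intro b _ hb
          rw [if_neg, mul_zero]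
          intro h
          exact hb (by rw [← hι h]; simp)
        · intro h
          have := j.pos
          simp only [Finset.mem_range, not_lt] at h
          omega
      · rw [Finset.sum_eq_zero, shift_X, hβ j hj]
        · simp
        · intro m _
          rw [if_neg (fun h => hj ⟨_, h⟩), mul_zero]
    simp only [h2]
    generalize shift deg β = S at *
    rw [map_mul, Polynomial.derivative_mul, mul_add, ← mul_assoc, h1, Finset.sum_mul,
      mul_left_comm, ← h3, Finset.mul_sum, ← Finset.sum_add_distrib]
    refine Finset.sum_congr rfl fun m _ => ?_
    ring

/-- The Euler identity read off at T^k. It is the recursion of `IsExp.coeff_rec` for the exponential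
of ∑ β_m T^m ∂_m. -/
lemma coeff_shift_rec (hdeg : ∀ m, deg (ι m) = m) (hβ : ∀ x ∉ Set.range ι, β x = 0)
    (v : MvPolynomial σ L) (k : ℕ) :
    (k : L) • (shift deg β v).coeff k =
      ∑ m ∈ range k, ((m + 1 : ℕ) : L) •
        (shift deg β (β (ι m.succPNat) • MvPolynomial.pderiv (ι m.succPNat) v)).coeff
          (k - (m + 1)) := by
  obtain ⟨M, hM, hk⟩ :=
    ((X_mul_derivative_shift hdeg hβ v).and (Filter.eventually_ge_atTop k)).exists
  have h := congrArg (fun P => Polynomial.coeff P k) hM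
  simp only [Polynomial.finsetSum_coeff] at h
  rw [← Finset.sum_subset (Finset.range_subset_range.2 hk)] at h
  · rcases k with _ | k
    · simp
    · rw [Polynomial.coeff_X_mul, Polynomial.coeff_derivative] at h
      rw [MvPolynomial.smul_eq_C_mul, mul_comm]
      push_cast at h ⊢
      simp only [map_add, map_one, map_natCast]
      rw [h]
      refine Finset.sum_congr rfl fun m hm => ?_
      have := Finset.mem_range.1 hm
      rw [mul_assoc, ← Nat.cast_one, ← Nat.cast_add, ← Polynomial.C_eq_natCast,
        Polynomial.coeff_C_mul, Polynomial.coeff_X_pow_mul', if_pos (by omega),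
        MvPolynomial.smul_eq_C_mul]
      simp [MvPolynomial.smul_eq_C_mul]
  · intro m _ hm
    rw [mul_assoc, ← Polynomial.C_eq_natCast, Polynomial.coeff_C_mul,
      Polynomial.coeff_X_pow_mul', if_neg (by simp at hm; omega), mul_zero]

end Euler

variable [CharZero L]

/-- Taylor's formula: the exponential of a constant vector field is a translation. Both sides
satisfy the same recursion in k and agree for k = 0, where positivity of the degrees is used. -/
lemma expCoeff_pderiv (i : Fin 2) (β : ℕ+ → L) (k : ℕ) (v : Fock L) :
    expCoeff (fun m => β m • (MvPolynomial.pderiv (R := L) (i, m)).toLinearMap) k v =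
      (shift bosonDeg (bosonDir i β) v).coeff k := by
  set B : ℕ+ → Module.End L (Fock L) :=
    fun m => β m • (MvPolynomial.pderiv (R := L) (i, m)).toLinearMap with hB
  have hE : IsExp (ogf B) (expSeries L (ogf B)) := by
    apply isExp_expSeries_of_commute (by simp)
    apply mul_theta_ogf_comm
    intro m n
    refine LinearMap.ext fun w => ?_
    change β m • MvPolynomial.pderiv (i, m) (β n • MvPolynomial.pderiv (i, n) w) =
      β n • MvPolynomial.pderiv (i, n) (β m • MvPolynomial.pderiv (i, m) w)
    rw [Derivation.map_smul, Derivation.map_smul, smul_comm, pderiv_comm']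
  rw [expCoeff_eq]
  induction k using Nat.strong_induction_on generalizing v with
  | _ k ih =>
    rcases Nat.eq_zero_or_pos k with rfl | hk
    · rw [hE.1]
      clear ih hE
      induction v using MvPolynomial.induction_on with
      | C a => simp
      | add p q hp hq => simp only [map_add, Polynomial.coeff_add, ← hp, ← hq]
      | mul_X p j hp =>
        have := j.2.pos
        have h0 : (Polynomial.X ^ bosonDeg j : Polynomial (Fock L)).coeff 0 = 0 := by
          rw [Polynomial.coeff_X_pow, if_neg (by rw [bosonDeg]; omega)]
        simp only [map_mul, Polynomial.mul_coeff_zero, ← hp, shift_X, Polynomial.coeff_add, h0,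
          Polynomial.coeff_C_zero, mul_zero, add_zero, Module.End.one_apply]
    · have h1 : (k : L) • PowerSeries.coeff k (expSeries L (ogf B)) v =
          (k : L) • (shift bosonDeg (bosonDir i β) v).coeff k := by
        rw [coeff_shift_rec (deg := bosonDeg) (β := bosonDir i β) (ι := fun m => (i, m))
          (fun m => rfl) (fun x hx => if_neg fun h => hx ⟨x.2, Prod.ext h.symm rfl⟩)]
        have h2 := congrArg (fun f => f v) (hE.coeff_rec k)
        simp only [LinearMap.sum_apply, Module.End.mul_apply] at h2
        have h3 : ∀ (n : ℕ) (w : Fock L), ((n : Module.End L (Fock L)) w) = (n : L) • w := by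
          intro n w; simp [Module.End.natCast_apply, Nat.cast_smul_eq_nsmul]
        simp only [h3] at h2
        rw [h2, ← Finset.Nat.sum_antidiagonal_swap]
        simp only [Prod.fst_swap, Prod.snd_swap]
        rw [Finset.Nat.sum_antidiagonal_eq_sum_range_succ_mk, Finset.sum_range_succ']
        simp only [coeff_zero_ogf, LinearMap.zero_apply, smul_zero, map_zero, add_zero]
        refine Finset.sum_congr rfl fun m hm => ?_
        have := Finset.mem_range.1 hm
        have h4 : PowerSeries.coeff (m + 1) (ogf B) = B m.succPNat := coeff_ogf B m.succPNat
        rw [map_smul, ih _ (by omega), h4, bosonDir, if_pos rfl]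
        rfl
      exact smul_right_injective _ (show (k : L) ≠ 0 by exact_mod_cast hk.ne') h1

/-- The modes of a vertex operator with creation exponent `∑ a_m z^m` which annihilates the
boson `i`. -/
lemma vertexMode_eq (i : Fin 2) (a : ℕ+ → Fock L) (β : ℕ+ → L)
    {E : PowerSeries (Fock L)} (hE : IsExp (ogf a) E)
    {A B : ℕ+ → Module.End L (Fock L)} (hA : ∀ m, A m = LinearMap.mulLeft L (a m))
    (hB : ∀ m, B m = β m • (MvPolynomial.pderiv (R := L) (i, m)).toLinearMap) (n : ℤ)
    (v : Fock L) :
    vertexMode A B n v = pair E n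
      (shift bosonDeg (bosonDir i β) v) := by
  rw [hE.unique L (isExp_expSeries L a)]
  obtain rfl : A = _ := funext hA
  obtain rfl : B = _ := funext hB
  unfold vertexMode
  simp only [expCoeff_pderiv, expCoeff_mulLeft]
  set P := shift bosonDeg (bosonDir i β) v
  rw [pair_eq_sum _ _ P (Nat.lt_succ_self _), finsum_eq_sum_of_support_subset
    (s := range (P.natDegree + 1))]
  · refine Finset.sum_congr rfl fun k _ => ?_
    unfold coeffZ
    simp only [sub_nonneg]
    split_ifs <;> simp
  · intro k hk
    by_contra h
    apply hk
    simp only [coe_range, Set.mem_Iio, not_lt] at h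
    simp [Polynomial.coeff_eq_zero_of_natDegree_lt (show P.natDegree < k by omega)]

end Modes

/-! ### Expansions of rational functions -/

section Rational
variable {L : Type*} [Field L] {c c' : ℤ → L} {x y y' : L}

/-- The bound N on the pole order may be increased at will, multiplying the numerator by X each
time; two expansions can then be compared with a common N. -/
lemma HasRationalValue.raise (h : HasRationalValue c x y) :
    ∃ N₀ : ℕ, ∀ N ≥ N₀, ∃ P Q : Polynomial L, (∀ j : ℤ, j < -(N : ℤ) → c j = 0) ∧
      (PowerSeries.mk fun k : ℕ => c ((k : ℤ) - N)) * (Q : PowerSeries L) = (P : PowerSeries L) ∧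
      Q.eval x ≠ 0 ∧ y = x⁻¹ ^ N * P.eval x / Q.eval x := by
  obtain ⟨N, P, Q, h1, h2, h3, h4, h5⟩ := h
  refine ⟨N, fun M hM => ?_⟩
  induction M, hM using Nat.le_induction with
  | base => exact ⟨P, Q, h1, h2, h4, h5⟩
  | succ M hM ih =>
    obtain ⟨P, Q, h1, h2, h4, h5⟩ := ih
    refine ⟨Polynomial.X * P, Q, fun j hj => h1 j (by push_cast at hj; omega), ?_, h4, ?_⟩
    · rw [Polynomial.coe_mul, Polynomial.coe_X, ← h2, ← mul_assoc]
      congr 1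
      ext k
      rcases k with _ | k
      · rw [PowerSeries.coeff_zero_X_mul, PowerSeries.coeff_mk]
        exact h1 _ (by push_cast; omega)
      · rw [PowerSeries.coeff_succ_X_mul, PowerSeries.coeff_mk, PowerSeries.coeff_mk]
        congr 1; push_cast; ring
    · rw [h5, Polynomial.eval_mul, Polynomial.eval_X, pow_succ]
      field_simp

lemma HasRationalValue.ne_zero (h : HasRationalValue c x y) : x ≠ 0 := by
  obtain ⟨N, P, Q, h1, h2, h3, h4, h5⟩ := h
  exact h3

lemma HasRationalValue.add (h : HasRationalValue c x y) (h' : HasRationalValue c' x y') :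
    HasRationalValue (fun j => c j + c' j) x (y + y') := by
  obtain ⟨N, hN⟩ := h.raise
  obtain ⟨N', hN'⟩ := h'.raise
  obtain ⟨P, Q, h1, h2, h4, h5⟩ := hN (N + N') (by omega)
  obtain ⟨P', Q', h1', h2', h4', h5'⟩ := hN' (N + N') (by omega)
  refine ⟨N + N', P * Q' + P' * Q, Q * Q', fun j hj => by simp only [h1 j hj, h1' j hj, add_zero], ?_,
    h.ne_zero, by rw [Polynomial.eval_mul]; exact mul_ne_zero h4 h4', ?_⟩
  · have : (PowerSeries.mk fun k : ℕ => c ((k : ℤ) - (N + N' : ℕ)) + c' ((k : ℤ) - (N + N' : ℕ))) =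
      (PowerSeries.mk fun k : ℕ => c ((k : ℤ) - (N + N' : ℕ))) +
        PowerSeries.mk fun k : ℕ => c' ((k : ℤ) - (N + N' : ℕ)) := by ext; simp
    rw [this]
    push_cast at *
    rw [← h2, ← h2']
    ring
  · rw [h5, h5']
    simp only [Polynomial.eval_add, Polynomial.eval_mul]
    field_simp

lemma HasRationalValue.const_mul (a : L) (h : HasRationalValue c x y) :
    HasRationalValue (fun j => a * c j) x (a * y) := by
  obtain ⟨N, P, Q, h1, h2, h3, h4, h5⟩ := h
  refine ⟨N, Polynomial.C a * P, Q, fun j hj => by simp only [h1 j hj, mul_zero], ?_, h3, h4, ?_⟩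
  · have : (PowerSeries.mk fun k : ℕ => a * c ((k : ℤ) - N)) =
      PowerSeries.C a * PowerSeries.mk fun k : ℕ => c ((k : ℤ) - N) := by ext; simp
    rw [this, mul_assoc, h2]
    simp
  · rw [h5, Polynomial.eval_mul, Polynomial.eval_C]; ring

lemma hasRationalValue_zero (hx : x ≠ 0) : HasRationalValue (fun _ => (0 : L)) x 0 :=
  ⟨0, 0, 1, fun _ _ => rfl, by ext; simp, hx, by simp, by simp⟩

lemma HasRationalValue.sum {ι : Type*} (s : Finset ι) {c : ι → ℤ → L} {y : ι → L} (hx : x ≠ 0)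
    (h : ∀ i ∈ s, HasRationalValue (c i) x (y i)) :
    HasRationalValue (fun j => ∑ i ∈ s, c i j) x (∑ i ∈ s, y i) := by
  classical
  induction s using Finset.induction_on with
  | empty => simpa using hasRationalValue_zero hx
  | insert i s hi ih =>
    simp only [Finset.sum_insert hi]
    exact (h i (by simp)).add (ih fun j hj => h j (by simp [hj]))

lemma HasRationalValue.shift (k : ℤ) (h : HasRationalValue c x y) :
    HasRationalValue (fun j => c (j + k)) x (x ^ (-k) * y) := by
  obtain ⟨N, hN⟩ := h.raise
  obtain ⟨P, Q, h1, h2, h4, h5⟩ := hN (N + k.natAbs) (by omega)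
  obtain ⟨N', hN'⟩ : ∃ N' : ℕ, (N' : ℤ) = (N + k.natAbs : ℕ) + k :=
    ⟨((N + k.natAbs : ℕ) + k).toNat, by rw [Int.toNat_of_nonneg]; omega⟩
  refine ⟨N', P, Q, fun j hj => h1 _ (by omega), ?_, h.ne_zero, h4, ?_⟩
  · rw [← h2]
    congr 2
    funext i
    change c ((i : ℤ) - N' + k) = c ((i : ℤ) - (N + k.natAbs : ℕ))
    rw [hN']
    congr 1; ring
  · rw [h5, ← zpow_natCast x⁻¹ N', hN', zpow_add₀ (inv_ne_zero h.ne_zero), zpow_natCast, inv_zpow']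
    ring

/-- Cross-multiplying the two presentations gives an identity of power series, hence of polynomials.
Therefore the chosen operator `genXTwo` is determined by its specification. -/
lemma HasRationalValue.unique (h : HasRationalValue c x y) (h' : HasRationalValue c x y') :
    y = y' := by
  obtain ⟨N, hN⟩ := h.raise
  obtain ⟨N', hN'⟩ := h'.raise
  obtain ⟨P, Q, h1, h2, h4, h5⟩ := hN (N + N') (by omega)
  obtain ⟨P', Q', h1', h2', h4', h5'⟩ := hN' (N + N') (by omega)
  have key : P * Q' = P' * Q := by
    apply Polynomial.coe_injective L
    rw [Polynomial.coe_mul, Polynomial.coe_mul, ← h2, ← h2']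
    ring
  have h6 := congrArg (Polynomial.eval x) key
  simp only [Polynomial.eval_mul] at h6
  rw [h5, h5', div_eq_div_iff h4 h4', mul_assoc, mul_assoc, h6]

lemma hasRationalValue_coeffZ {g : PowerSeries L} {P Q : Polynomial L}
    (h : g * (Q : PowerSeries L) = (P : PowerSeries L)) (hx : x ≠ 0) (hQ : Q.eval x ≠ 0) :
    HasRationalValue (coeffZ g) x (P.eval x / Q.eval x) := by
  refine ⟨0, P, Q, fun j hj => coeffZ_of_neg _ (by simpa using hj), ?_, hx, hQ, by simp⟩
  rw [← h]
  congr 1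
  ext k
  simp

end Rational

end Crystal
namespace Crystal
open Finset

/-! ### Products of modes as sums over all integers. -/

section Product
variable {A : Type*} [CommRing A]

lemma finsum_int_eq_finsum_nat (f : ℤ → A) (h : ∀ i < 0, f i = 0) :
    ∑ᶠ i : ℤ, f i = ∑ᶠ i : ℕ, f i := by
  rw [← finsum_mem_range Nat.cast_injective, ← finsum_mem_univ]
  refine finsum_mem_inter_support_eq' _ _ _ fun x hx => ?_
  simp only [Set.mem_univ, Set.mem_range, true_iff]
  have : 0 ≤ x := by
    by_contra hc
    exact hx (h x (by omega))
  exact ⟨x.toNat, by simp [this]⟩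

lemma pair_map_pair' (E₁ E₂ : PowerSeries A) (S : A →+* Polynomial A) (g : PowerSeries A)
    (hg : E₂.map S = E₂.map Polynomial.C * PowerSeries.mk fun i =>
      Polynomial.C (PowerSeries.coeff i g) * Polynomial.X ^ i) (n₁ n₂ : ℤ) (P : Polynomial A) :
    pair E₁ n₁ (S (pair E₂ n₂ P)) =
      ∑ᶠ k : ℤ, coeffZ g (k - n₂) * nord E₁ E₂ (n₁ + n₂ - k) k (P.map S) := by
  rw [pair_map_pair E₁ E₂ S _ hg, ← finsum_comp_equiv (Equiv.addRight n₂),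
    finsum_int_eq_finsum_nat]
  · refine finsum_congr fun i => ?_
    rw [Equiv.coe_addRight, add_sub_cancel_right, coeffZ_natCast]
    congr 2 <;> ring
  · intro i hi
    rw [Equiv.coe_addRight, add_sub_cancel_right, coeffZ_of_neg _ hi, zero_mul]

end Product

/-! ### Homogeneity in z, and rationality of matrix coefficients of products. -/

section Rescale
variable {L : Type*} [Field L] {σ : Type*} (deg : σ → ℕ)

lemma coeffZ_rescale (c : L) (E : PowerSeries (MvPolynomial σ L)) (n : ℤ) :
    coeffZ (PowerSeries.rescale (MvPolynomial.C c) E) n = MvPolynomial.C (c ^ n) * coeffZ E n := by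
  unfold coeffZ
  split_ifs with h
  · lift n to ℕ using h
    simp [PowerSeries.coeff_rescale]
  · simp

lemma pair_rescale {c : L} (hc : c ≠ 0) (E : PowerSeries (MvPolynomial σ L)) (n : ℤ)
    (β : σ → L) (v : MvPolynomial σ L) :
    pair (PowerSeries.rescale (MvPolynomial.C c) E) n
        (shift deg (fun i => c⁻¹ ^ deg i * β i) v) =
      MvPolynomial.C (c ^ (-n)) * pair E n (shift deg β v) := by
  set M := (shift deg (fun i => c⁻¹ ^ deg i * β i) v).natDegree +
    (shift deg β v).natDegree + 1 with hM
  rw [pair_eq_sum _ _ _ (show _ < M by omega), pair_eq_sum _ _ (shift deg β v) (show _ < M by omega),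
    Finset.mul_sum]
  refine Finset.sum_congr rfl fun k _ => ?_
  rw [coeffZ_rescale, coeff_shift_smul]
  have h : c ^ ((k : ℤ) - n) * c⁻¹ ^ k = c ^ (-n) := by
    rw [← zpow_natCast, inv_zpow', ← zpow_add₀ hc]; congr 1; ring
  rw [← h, map_mul]
  ring

/-- Only z₁ is replaced by c z₁, so only the mode index n₁ enters the factor. It is used for the
specialization z₁ = pz, z₂ = z. -/
lemma nord_rescale {c : L} (hc : c ≠ 0) (E₁ E₂ : PowerSeries (MvPolynomial σ L)) (n₁ n₂ : ℤ)
    (β : σ → L) (P : Polynomial (MvPolynomial σ L)) :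
    nord (PowerSeries.rescale (MvPolynomial.C c) E₁) E₂ n₁ n₂
        (P.map (shiftHom deg (fun i => c⁻¹ ^ deg i * β i))) =
      MvPolynomial.C (c ^ (-n₁)) * nord E₁ E₂ n₁ n₂ (P.map (shiftHom deg β)) := by
  induction P using Polynomial.induction_on' with
  | add p q hp hq => rw [Polynomial.map_add, Polynomial.map_add, nord_add, nord_add, hp, hq, mul_add]
  | monomial b x =>
    rw [Polynomial.map_monomial, Polynomial.map_monomial, nord_monomial', nord_monomial']
    have h := pair_rescale deg hc E₁ n₁ β x
    simp only [RingHom.coe_coe]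
    rw [h]
    ring

variable [CharZero L]

/-- Matrix coefficients of a product of two vertex operators are expansions of rational
functions. -/
lemma hasRationalValue_product {E₁ E₂ : PowerSeries (MvPolynomial σ L)} {β₁ : σ → L}
    (β₂ : σ → L) {a : ℕ+ → MvPolynomial σ L} {γ : ℕ+ → L} {g : PowerSeries L} (hE : IsExp (ogf a) E₂)
    (hg : IsExp (ogf γ) g)
    (ha : ∀ m : ℕ+, shift deg β₁ (a m) = Polynomial.C (a m) +
      Polynomial.C (MvPolynomial.C (γ m)) * Polynomial.X ^ (m : ℕ)) {P Q : Polynomial L}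
    (hPQ : g * (Q : PowerSeries L) = (P : PowerSeries L)) {x : L} (hx : x ≠ 0) (hQ : Q.eval x ≠ 0)
    (n : ℤ) (v : MvPolynomial σ L) (d : σ →₀ ℕ) :
    HasRationalValue
      (fun j : ℤ => MvPolynomial.coeff d
        (pair E₁ (n + j) (shift deg β₁ (pair E₂ (-j) (shift deg β₂ v))))) x
      (P.eval x / Q.eval x * MvPolynomial.coeff d (∑ᶠ k : ℤ, MvPolynomial.C (x ^ (-k)) *
        nord E₁ E₂ (n - k) k ((shift deg β₂ v).map (shiftHom deg β₁)))) := by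
  set W := (shift deg β₂ v).map (shiftHom deg β₁)
  have hfin := finite_nord_line E₁ E₂ n W
  set T := hfin.toFinset with hT
  have hsub : ∀ f : ℤ → MvPolynomial σ L,
      (Function.support fun k : ℤ => f k * nord E₁ E₂ (n - k) k W) ⊆ T := by
    intro f k hk
    simp only [hT, Set.Finite.coe_toFinset, Function.mem_support] at *
    exact right_ne_zero_of_mul hk
  -- The coefficient sequence is a finite combination of translates of the coefficients of the
  -- contraction `g`; the translate by k multiplies the value by x^{-k}.
  have h := HasRationalValue.sum T hx fun k _ =>
    ((hasRationalValue_coeffZ hPQ hx hQ).shift k).const_mul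
      (MvPolynomial.coeff d (nord E₁ E₂ (n - k) k W))
  convert h using 1
  · funext j
    have h2 := pair_map_pair' E₁ E₂ (shiftHom deg β₁) (g.map MvPolynomial.C)
      (by simpa using map_shift_exp deg L β₁ hE hg ha) (n + j) (-j) (shift deg β₂ v)
    rw [RingHom.coe_coe] at h2
    rw [h2]
    simp only [add_neg_cancel_right, sub_neg_eq_add, coeffZ_map]
    rw [finsum_eq_sum_of_support_subset _ (hsub _), MvPolynomial.coeff_sum]
    refine Finset.sum_congr rfl fun k _ => ?_
    rw [MvPolynomial.coeff_C_mul, add_comm j, mul_comm]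
  · rw [finsum_eq_sum_of_support_subset _ (hsub _), MvPolynomial.coeff_sum, Finset.mul_sum]
    refine Finset.sum_congr rfl fun k _ => ?_
    rw [MvPolynomial.coeff_C_mul]
    ring

end Rescale

section Linear
variable {L : Type*} [Field L] [CharZero L]

/-- The logarithm of 1 - cx. Contractions are recognized as rational functions by writing their
exponents as combinations of such logarithms. -/
lemma isExp_one_sub (c : L) : IsExp (ogf fun m : ℕ+ => -(c ^ (m : ℕ) / (m : ℕ)))
    ((1 - Polynomial.C c * Polynomial.X : Polynomial L) : PowerSeries L) := by
  have hcoe : ((1 - Polynomial.C c * Polynomial.X : Polynomial L) : PowerSeries L) =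
      1 - PowerSeries.C c * PowerSeries.X := by simp
  refine ⟨by simp, ?_⟩
  rw [hcoe]
  have h1 : theta (ogf fun m : ℕ+ => -(c ^ (m : ℕ) / (m : ℕ))) =
      PowerSeries.mk fun k => if k = 0 then 0 else -c ^ k := by
    refine ogf_ext (by simp) fun m => ?_
    have hm : ((m : ℕ) : L) ≠ 0 := by exact_mod_cast m.ne_zero
    rw [coeff_theta, coeff_ogf, PowerSeries.coeff_mk, if_neg m.ne_zero]
    field_simp
  rw [h1, sub_mul, one_mul, mul_comm (PowerSeries.C c), mul_assoc]
  ext k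
  rcases k with _ | k
  · simp
  · rw [map_sub, PowerSeries.coeff_succ_X_mul, PowerSeries.coeff_C_mul, PowerSeries.coeff_mk,
      PowerSeries.coeff_mk, coeff_theta, map_sub, PowerSeries.coeff_mul_C, PowerSeries.coeff_X,
      PowerSeries.coeff_one]
    rcases k with _ | k
    · simp
    · simp [pow_succ]; ring

end Linear

end Crystal
namespace Crystal
open Finset

/-! ### Exponents that are linear in the two bosons. -/

section Lin
variable {R : Type*} [CommRing R]

/-- The linear forms `x_m a^{(1)}_{-m} + y_m a^{(2)}_{-m}`. -/
noncomputable def lin (x y : ℕ+ → R) (m : ℕ+) : MvPolynomial (Fin 2 × ℕ+) R :=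
  MvPolynomial.C (x m) * MvPolynomial.X (0, m) + MvPolynomial.C (y m) * MvPolynomial.X (1, m)

lemma lin_add (x y x' y' : ℕ+ → R) (m : ℕ+) :
    lin x y m + lin x' y' m = lin (fun m => x m + x' m) (fun m => y m + y' m) m := by
  simp only [lin, map_add]; ring

lemma C_mul_lin (c : ℕ+ → R) (x y : ℕ+ → R) (m : ℕ+) :
    MvPolynomial.C (c m) * lin x y m = lin (fun m => c m * x m) (fun m => c m * y m) m := by
  simp only [lin, map_mul]; ring

lemma map_lin {R' : Type*} [CommRing R'] (φ : R →+* R') (x y : ℕ+ → R) (m : ℕ+) :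
    MvPolynomial.map φ (lin x y m) = lin (fun m => φ (x m)) (fun m => φ (y m)) m := by
  simp [lin]

lemma shift_lin (β : Fin 2 × ℕ+ → R) (x y : ℕ+ → R) (m : ℕ+) :
    shift bosonDeg β (lin x y m) = Polynomial.C (lin x y m) +
      Polynomial.C (MvPolynomial.C (x m * β (0, m) + y m * β (1, m))) *
        Polynomial.X ^ (m : ℕ) := by
  simp only [lin, map_add, map_mul, shift_C, shift_X, bosonDeg]
  ring

end Lin

/-! ### The generators at generic `q` -/

section Generic
variable {L : Type*} [Field L]

lemma etaCreation_zero (s t : L) (m : ℕ+) : etaCreation t 0 s m = LinearMap.mulLeft L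
    (lin (fun m : ℕ+ => (1 - t⁻¹ ^ (m : ℕ)) / (m : ℕ) * s ^ (m : ℕ)) (fun _ => 0) m) := by
  refine LinearMap.ext fun v => ?_
  simp only [etaCreation, creation, lin, LinearMap.smul_apply, LinearMap.mulLeft_apply,
    MvPolynomial.smul_eq_C_mul, map_zero]
  ring

lemma phiCreation_add_etaCreation (s t : L) (hs : s ≠ 0) (m : ℕ+) :
    phiCreation (s ^ 2) t 0 s m + etaCreation t 1 s⁻¹ m = LinearMap.mulLeft L
    (lin (fun m : ℕ+ => (1 - t⁻¹ ^ (m : ℕ)) / (m : ℕ) * (s ^ (m : ℕ) - s⁻¹ ^ (m : ℕ)))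
      (fun m : ℕ+ => (1 - t⁻¹ ^ (m : ℕ)) / (m : ℕ) * s⁻¹ ^ (m : ℕ)) m) := by
  have h : (1 - (s ^ 2)⁻¹ ^ (m : ℕ)) * s ^ (m : ℕ) = s ^ (m : ℕ) - s⁻¹ ^ (m : ℕ) := by
    rw [inv_pow, inv_pow, ← pow_mul, two_mul, pow_add]
    have : s ^ (m : ℕ) ≠ 0 := pow_ne_zero _ hs
    field_simp
  refine LinearMap.ext fun v => ?_
  simp only [phiCreation, etaCreation, creation, lin, LinearMap.smul_apply, LinearMap.add_apply,
    LinearMap.mulLeft_apply, MvPolynomial.smul_eq_C_mul, ← h, map_mul]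
  ring

/-- The factor (1 - t^m)/m of the exponent cancels against the commutator m(1 - q^m)/(1 - t^m). -/
lemma etaAnnihilation_eq (q t c : L) (ht : ∀ n : ℕ, 0 < n → t ^ n ≠ 1) [CharZero L] (i : Fin 2)
    (m : ℕ+) : etaAnnihilation q t i c m = (-(1 - q ^ (m : ℕ)) * c⁻¹ ^ (m : ℕ)) •
      (MvPolynomial.pderiv (R := L) (i, m)).toLinearMap := by
  rw [etaAnnihilation, annihilation, smul_smul]
  congr 1
  have h1 : ((m : ℕ) : L) ≠ 0 := by exact_mod_cast m.ne_zero
  have h2 : 1 - t ^ (m : ℕ) ≠ 0 := sub_ne_zero.2 (ht _ m.pos).symm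
  field_simp

variable [CharZero L] {s t : L} (u : Fin 2 → L)

/-- `Λ¹` and `Λ²` as vertex operators. -/
lemma lambdaOne_eq (ht : ∀ n : ℕ, 0 < n → t ^ n ≠ 1) {E : PowerSeries (Fock L)} (hE : IsExp (ogf (lin
    (fun m : ℕ+ => (1 - t⁻¹ ^ (m : ℕ)) / (m : ℕ) * s ^ (m : ℕ)) (fun _ => 0))) E) (n : ℤ)
    (v : Fock L) : lambdaOne s t u n v = MvPolynomial.C (u 0) * pair E n (shift bosonDeg
      (bosonDir 0 fun m => -(1 - (t * s ^ 2) ^ (m : ℕ)) * s⁻¹ ^ (m : ℕ)) v) := by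
  rw [lambdaOne, MvPolynomial.smul_eq_C_mul, vertexMode_eq 0 _ _ hE (etaCreation_zero s t)
    (etaAnnihilation_eq _ t s ht 0)]

lemma lambdaTwo_eq (ht : ∀ n : ℕ, 0 < n → t ^ n ≠ 1) (hs : s ≠ 0) {E : PowerSeries (Fock L)} (hE : IsExp (ogf (lin
    (fun m : ℕ+ => (1 - t⁻¹ ^ (m : ℕ)) / (m : ℕ) * (s ^ (m : ℕ) - s⁻¹ ^ (m : ℕ)))
    (fun m : ℕ+ => (1 - t⁻¹ ^ (m : ℕ)) / (m : ℕ) * s⁻¹ ^ (m : ℕ)))) E) (n : ℤ)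
    (v : Fock L) : lambdaTwo s t u n v = MvPolynomial.C (u 1) * pair E n (shift bosonDeg
      (bosonDir 1 fun m => -(1 - (t * s ^ 2) ^ (m : ℕ)) * s⁻¹⁻¹ ^ (m : ℕ)) v) := by
  rw [lambdaTwo, MvPolynomial.smul_eq_C_mul, vertexMode_eq 1 _ _ hE
    (phiCreation_add_etaCreation s t hs) (etaAnnihilation_eq _ t s⁻¹ ht 1)]

end Generic

/-! ### Vertex operators over an arbitrary base ring. -/

section VOp
variable (K : Type*) [Field K] {R R' : Type*} [CommRing R] [CommRing R'] [Algebra K R]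
  [Algebra K R'] {σ : Type*} (deg : σ → ℕ)

/-- The mode `V_n` of the vertex operator `V(z) = exp (∑ a_m z^m) exp (∑_i β_i z^{-deg i} ∂_i)`. -/
noncomputable def vop (a : ℕ+ → MvPolynomial σ R) (β : σ → R) (n : ℤ) :
    MvPolynomial σ R →ₗ[R] MvPolynomial σ R :=
  (pair (expSeries K (ogf a)) n).restrictScalars R ∘ₗ (shift deg β).toLinearMap

lemma vop_apply (a : ℕ+ → MvPolynomial σ R) (β : σ → R) (n : ℤ) (v : MvPolynomial σ R) :
    vop K deg a β n v = pair (expSeries K (ogf a)) n (shift deg β v) := rfl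

variable [CharZero K]

lemma map_vop (φ : R →+* R') (a : ℕ+ → MvPolynomial σ R) (β : σ → R) (n : ℤ)
    (v : MvPolynomial σ R) : MvPolynomial.map φ (vop K deg a β n v) =
      vop K deg (fun m => MvPolynomial.map φ (a m)) (fun i => φ (β i)) n
        (MvPolynomial.map φ v) := by
  rw [vop_apply, vop_apply, shift_map, ← pair_map]
  have h := (isExp_expSeries K a).map (MvPolynomial.map φ)
  rw [ogf_map] at h
  rw [h.unique K (isExp_expSeries K _)]

lemma vop_eq {a : ℕ+ → MvPolynomial σ R} {E : PowerSeries (MvPolynomial σ R)}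
    (hE : IsExp (ogf a) E) (β : σ → R) (n : ℤ) (v : MvPolynomial σ R) :
    pair E n (shift deg β v) = vop K deg a β n v := by
  rw [vop_apply, hE.unique K (isExp_expSeries K a)]

end VOp

section VOpField
variable {L : Type*} [Field L] [CharZero L] (K : Type*) [Field K] [CharZero K] [Algebra K L]
  {σ : Type*} (deg : σ → ℕ)

/-- Homogeneity of vertex operators. -/
lemma pair_eq_vop_of_scaled {c : L} (hc : c ≠ 0) {a a' : ℕ+ → MvPolynomial σ L}
    (ha : ∀ m, a' m = MvPolynomial.C (c ^ (m : ℕ)) * a m) {E : PowerSeries (MvPolynomial σ L)}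
    (hE : IsExp (ogf a') E) {β β' : σ → L} (hβ : ∀ i, β' i = c⁻¹ ^ deg i * β i) (n : ℤ)
    (v : MvPolynomial σ L) :
    pair E n (shift deg β' v) = MvPolynomial.C (c ^ (-n)) * vop K deg a β n v := by
  have h := (isExp_expSeries K a).rescale (MvPolynomial.C c)
  rw [ogf_rescale] at h
  obtain rfl : a' = fun m : ℕ+ => MvPolynomial.C c ^ (m : ℕ) * a m := funext fun m => by rw [ha, map_pow]
  obtain rfl : β' = fun i => c⁻¹ ^ deg i * β i := funext hβ
  rw [hE.unique L h, pair_rescale deg hc, vop_apply]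

end VOpField

/-! ### The modes of X^(1) and the fusion giving X^(2) at generic `q`. -/

section GenX
variable {L : Type*} [Field L] [CharZero L] {s t : L} (u : Fin 2 → L)

/-- Λ¹ is rescaled by s and Λ² by 1/s. Afterwards negative powers of s occur only in the scalars
s^{-n} and s^n, while the vertex operators depend polynomially on s. -/
lemma genXOne_eq (K : Type*) [Field K] [CharZero K] [Algebra K L]
    (ht : ∀ n : ℕ, 0 < n → t ^ n ≠ 1) (hs : s ≠ 0) (n : ℤ) (v : Fock L) :
    genXOne s t u n v =
      MvPolynomial.C (u 0 * s ^ (-n)) * vop K bosonDeg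
        (lin (fun m : ℕ+ => (1 - t⁻¹ ^ (m : ℕ)) / (m : ℕ)) (fun _ => 0))
        (bosonDir 0 fun m => -(1 - (t * s ^ 2) ^ (m : ℕ))) n v +
      MvPolynomial.C (u 1 * s ^ n) * vop K bosonDeg
        (lin (fun m : ℕ+ => (1 - t⁻¹ ^ (m : ℕ)) / (m : ℕ) * ((s ^ 2) ^ (m : ℕ) - 1))
          (fun m : ℕ+ => (1 - t⁻¹ ^ (m : ℕ)) / (m : ℕ)))
        (bosonDir 1 fun m => -(1 - (t * s ^ 2) ^ (m : ℕ))) n v := by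
  rw [genXOne, lambdaOne_eq u ht (isExp_expSeries L _), lambdaTwo_eq u ht hs (isExp_expSeries L _),
    pair_eq_vop_of_scaled K bosonDeg hs _ (isExp_expSeries L _)
      (β := bosonDir 0 fun m => -(1 - (t * s ^ 2) ^ (m : ℕ))),
    pair_eq_vop_of_scaled K bosonDeg (inv_ne_zero hs) _ (isExp_expSeries L _)
      (β := bosonDir 1 fun m => -(1 - (t * s ^ 2) ^ (m : ℕ)))]
  · rw [map_mul, map_mul, mul_assoc, mul_assoc, inv_zpow', neg_neg]
  · intro i
    simp only [bosonDir, bosonDeg]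
    split_ifs <;> ring
  · intro m
    rw [C_mul_lin (fun m => s⁻¹ ^ (m : ℕ))]
    have h : s⁻¹ ^ (m : ℕ) * (s ^ 2) ^ (m : ℕ) = s ^ (m : ℕ) := by
      rw [← mul_pow]; congr 1; field_simp
    simp only [lin]
    rw [← h]
    congr 3 <;> ring
  · intro i
    simp only [bosonDir, bosonDeg]
    split_ifs <;> ring
  · intro m
    rw [C_mul_lin (fun m => s ^ (m : ℕ))]
    simp only [lin, mul_zero]
    congr 3; ring

lemma isExp_prod (l : List L) : IsExp (ogf fun m : ℕ+ => (l.map fun c : L => -(c ^ (m : ℕ) / ((m : ℕ) : L))).sum)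
    (((l.map fun c => 1 - Polynomial.C c * Polynomial.X).prod : Polynomial L) : PowerSeries L) := by
  induction l with
  | nil =>
    have h : ogf (fun _ : ℕ+ => (0 : L)) = 0 := ogf_ext (by simp) fun m => by simp [coeff_ogf]
    simpa [h] using isExp_zero (A := L)
  | cons c l ih =>
    have h := (isExp_one_sub c).mul ih
    rw [← ogf_add, ← Polynomial.coe_mul] at h
    simpa using h

/-- Contractions which are rational functions. -/
lemma contraction_eq {γ : ℕ+ → L} {g : PowerSeries L} (hg : IsExp (ogf γ) g) (l l' : List L)
    (h : ∀ m : ℕ+, γ m + (l.map fun c : L => -(c ^ (m : ℕ) / ((m : ℕ) : L))).sum =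
      (l'.map fun c : L => -(c ^ (m : ℕ) / ((m : ℕ) : L))).sum) :
    g * (((l.map fun c => 1 - Polynomial.C c * Polynomial.X).prod : Polynomial L) : PowerSeries L) =
      (((l'.map fun c => 1 - Polynomial.C c * Polynomial.X).prod : Polynomial L) :
        PowerSeries L) := by
  have h1 := hg.mul (isExp_prod l)
  rw [← ogf_add, funext h] at h1
  exact h1.unique L (isExp_prod l')

/-- The form of the modes of `X^{(2)}(z)`. -/
noncomputable def normXTwo (K : Type*) [Field K] [Algebra K L] (s t : L) (u : Fin 2 → L) (n : ℤ)
    (v : Fock L) : Fock L :=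
  MvPolynomial.C (u 0 * u 1 * s ^ (-n)) * vop K bosonDeg
    (lin (fun m : ℕ+ => (1 - t⁻¹ ^ (m : ℕ)) / (m : ℕ) * (s ^ 2) ^ (m : ℕ))
      (fun m : ℕ+ => (1 - t⁻¹ ^ (m : ℕ)) / (m : ℕ)))
    (fun x => -(1 - (t * s ^ 2) ^ (x.2 : ℕ))) n v

/-- The product Λ²(pz) Λ¹(z) is a single vertex operator. In the creation exponent the part -p^m
s^{-m} of Λ² cancels the s^m of Λ¹ since p = s², leaving p^m s^m for the first boson. -/
lemma normXTwo_eq (K : Type*) [Field K] [CharZero K] [Algebra K L] (hs : s ≠ 0) (n : ℤ)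
    (v : Fock L) {E₁ E₂ : PowerSeries (Fock L)}
    (hE₁ : IsExp (ogf (lin
      (fun m : ℕ+ => (1 - t⁻¹ ^ (m : ℕ)) / (m : ℕ) * s ^ (m : ℕ)) (fun _ => 0))) E₁)
    (hE₂ : IsExp (ogf (lin
      (fun m : ℕ+ => (1 - t⁻¹ ^ (m : ℕ)) / (m : ℕ) * (s ^ (m : ℕ) - s⁻¹ ^ (m : ℕ)))
      (fun m : ℕ+ => (1 - t⁻¹ ^ (m : ℕ)) / (m : ℕ) * s⁻¹ ^ (m : ℕ)))) E₂) :
    MvPolynomial.C (u 1 * u 0) *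
      ∑ᶠ k : ℤ, MvPolynomial.C ((s ^ 2)⁻¹ ^ (-k)) * nord E₂ E₁ (n - k) k
        ((shift bosonDeg (bosonDir 0 fun m => -(1 - (t * s ^ 2) ^ (m : ℕ)) * s⁻¹ ^ (m : ℕ)) v).map
          (shiftHom bosonDeg
            (bosonDir 1 fun m => -(1 - (t * s ^ 2) ^ (m : ℕ)) * s⁻¹⁻¹ ^ (m : ℕ)))) =
      MvPolynomial.C ((s ^ 2) ^ n) * normXTwo K s t u n v := by
  have hp : s ^ 2 ≠ 0 := pow_ne_zero _ hs
  set W := shift bosonDeg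
    (bosonDir 0 fun m => -(1 - (t * s ^ 2) ^ (m : ℕ)) * s⁻¹ ^ (m : ℕ)) v with hW
  have h1 : ∀ k : ℤ, MvPolynomial.C ((s ^ 2)⁻¹ ^ (-k)) * nord E₂ E₁ (n - k) k
        (W.map (shiftHom bosonDeg
            (bosonDir 1 fun m => -(1 - (t * s ^ 2) ^ (m : ℕ)) * s⁻¹⁻¹ ^ (m : ℕ)))) =
      MvPolynomial.C ((s ^ 2) ^ n) *
        nord (PowerSeries.rescale (MvPolynomial.C (s ^ 2)) E₂) E₁ (n - k) k
        (W.map (shiftHom bosonDeg fun i => (s ^ 2)⁻¹ ^ bosonDeg i *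
            bosonDir 1 (fun m => -(1 - (t * s ^ 2) ^ (m : ℕ)) * s⁻¹⁻¹ ^ (m : ℕ)) i)) := by
    intro k
    rw [nord_rescale _ hp, ← mul_assoc, ← map_mul, ← zpow_add₀ hp, inv_zpow']
    congr 3; ring_nf
  rw [finsum_congr h1, ← mul_finsum' _ _ (finite_nord_line _ _ _ _), finsum_nord, hW,
    eval_map_shift]
  have h2 := (hE₂.rescale (MvPolynomial.C (s ^ 2))).mul hE₁
  rw [ogf_rescale, ← ogf_add] at h2
  rw [pair_eq_vop_of_scaled K bosonDeg hs _ h2 (β := fun x => -(1 - (t * s ^ 2) ^ (x.2 : ℕ))),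
    normXTwo]
  · simp only [map_mul]
    ring
  · rintro ⟨i, m⟩
    have h3 : (s ^ 2)⁻¹ ^ (m : ℕ) * s⁻¹⁻¹ ^ (m : ℕ) = s⁻¹ ^ (m : ℕ) := by
      rw [← mul_pow]; congr 1; field_simp
    fin_cases i
    · simp [bosonDir, bosonDeg]; ring
    · simp only [bosonDir, bosonDeg]
      simp [mul_left_comm, ← h3]; ring
  · intro m
    rw [← map_pow, C_mul_lin (fun m => (s ^ 2) ^ (m : ℕ)), lin_add,
      C_mul_lin (fun m => s ^ (m : ℕ))]
    have h3 : (s ^ 2) ^ (m : ℕ) * s⁻¹ ^ (m : ℕ) = s ^ (m : ℕ) := by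
      rw [← mul_pow]; congr 1; field_simp
    simp only [lin]
    congr 3
    · linear_combination (-(1 - t⁻¹ ^ (m : ℕ)) / (m : ℕ)) * h3
    · linear_combination ((1 - t⁻¹ ^ (m : ℕ)) / (m : ℕ)) * h3

/-- With x = z₂/z₁ and q = t s², the products Λ¹Λ¹ and Λ²Λ² have contraction (1 - x)(1 - px)/((1 -
qx)(1 - x/t)), and Λ¹Λ² has (1 - px)(1 - tx)(1 - x/q)/((1 - qx)(1 - x/t)(1 - x/p)). All three vanish
at x = 1/p, so only Λ²Λ¹ contributes. -/
lemma isGenXTwo_normXTwo (K : Type*) [Field K] [CharZero K] [Algebra K L] (ht0 : t ≠ 0)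
    (ht : ∀ n : ℕ, 0 < n → t ^ n ≠ 1) (hs : s ≠ 0) (hq : t * s ^ 2 ≠ 1)
    (hp : s ^ 2 * s ^ 2 ≠ 1) (n : ℤ) :
    IsGenXTwo s t u n (normXTwo K s t u n) := by
  intro v d
  set a₁ : ℕ+ → Fock L := lin
    (fun m : ℕ+ => (1 - t⁻¹ ^ (m : ℕ)) / (m : ℕ) * s ^ (m : ℕ)) (fun _ => 0) with ha₁
  set a₂ : ℕ+ → Fock L := lin
    (fun m : ℕ+ => (1 - t⁻¹ ^ (m : ℕ)) / (m : ℕ) * (s ^ (m : ℕ) - s⁻¹ ^ (m : ℕ)))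
    (fun m : ℕ+ => (1 - t⁻¹ ^ (m : ℕ)) / (m : ℕ) * s⁻¹ ^ (m : ℕ)) with ha₂
  set β₁ : Fin 2 × ℕ+ → L :=
    bosonDir 0 fun m => -(1 - (t * s ^ 2) ^ (m : ℕ)) * s⁻¹ ^ (m : ℕ) with hβ₁
  set β₂ : Fin 2 × ℕ+ → L :=
    bosonDir 1 fun m => -(1 - (t * s ^ 2) ^ (m : ℕ)) * s⁻¹⁻¹ ^ (m : ℕ) with hβ₂
  have hE₁ := isExp_expSeries L a₁
  have hE₂ := isExp_expSeries L a₂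
  set E₁ := expSeries L (ogf a₁)
  set E₂ := expSeries L (ogf a₂)
  have hx : (s ^ 2)⁻¹ ≠ 0 := inv_ne_zero (pow_ne_zero _ hs)
  have ht1 : 1 - t ≠ 0 := by
    have := ht 1 one_pos
    rw [pow_one] at this
    exact sub_ne_zero.2 this.symm
  have hpow : ∀ m : ℕ, (t * s ^ 2) ^ m = t ^ m * (s ^ m) ^ 2 := fun m => by ring
  -- At x = 1/p the denominators become 1 - t and 1 - 1/q; the mixed product has the further factor
  -- 1 - 1/p², whence the hypothesis `hp`.
  have hQ : ((([t * s ^ 2, t⁻¹].map fun c => 1 - Polynomial.C c * Polynomial.X).prod :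
      Polynomial L)).eval (s ^ 2)⁻¹ ≠ 0 := by
    have h1 : 1 - t * s ^ 2 * (s ^ 2)⁻¹ = 1 - t := by field_simp
    have h2 : 1 - t⁻¹ * (s ^ 2)⁻¹ ≠ 0 := by
      rw [← mul_inv, sub_ne_zero]
      intro h
      exact hq (inv_eq_one.1 h.symm)
    simpa [h1, Polynomial.eval_mul] using ⟨ht1, h2⟩
  have hP : ((([1, s ^ 2].map fun c => 1 - Polynomial.C c * Polynomial.X).prod :
      Polynomial L)).eval (s ^ 2)⁻¹ = 0 := by
    have : s ^ 2 * (s ^ 2)⁻¹ = 1 := mul_inv_cancel₀ (pow_ne_zero _ hs)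
    simp [Polynomial.eval_mul, this]
  have hsame : ∀ γ : ℕ+ → L, (∀ m : ℕ+, γ m =
      -((1 - t⁻¹ ^ (m : ℕ)) / (m : ℕ) * (1 - (t * s ^ 2) ^ (m : ℕ)))) → ∀ m : ℕ+, γ m +
      ([t * s ^ 2, t⁻¹].map fun c => -(c ^ (m : ℕ) / ((m : ℕ) : L))).sum =
      ([1, s ^ 2].map fun c => -(c ^ (m : ℕ) / ((m : ℕ) : L))).sum := by
    intro γ hγ m
    rw [hγ]
    have h1 : ((m : ℕ) : L) ≠ 0 := by exact_mod_cast m.ne_zero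
    have h2 : t ^ (m : ℕ) ≠ 0 := pow_ne_zero _ ht0
    simp only [List.map_cons, List.map_nil, List.sum_cons, List.sum_nil, hpow, inv_pow, one_pow]
    field_simp
    ring
  have h11 := hasRationalValue_product bosonDeg (E₁ := E₁) (β₁ := β₁) β₁ hE₁
    (isExp_expSeries L _) (shift_lin β₁ _ _)
    (contraction_eq (isExp_expSeries L _) _ _ (hsame _ fun m => by
      have h3 : s ^ (m : ℕ) ≠ 0 := pow_ne_zero _ hs
      simp only [hβ₁, bosonDir, inv_pow]; simp; field_simp; ring)) hx hQ n v d
  have h22 := hasRationalValue_product bosonDeg (E₁ := E₂) (β₁ := β₂) β₂ hE₂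
    (isExp_expSeries L _) (shift_lin β₂ _ _)
    (contraction_eq (isExp_expSeries L _) _ _ (hsame _ fun m => by
      have h3 : s ^ (m : ℕ) ≠ 0 := pow_ne_zero _ hs
      simp only [hβ₂, bosonDir, inv_pow]; simp; field_simp; ring)) hx hQ n v d
  have h12 := hasRationalValue_product bosonDeg (E₁ := E₁) (β₁ := β₁) β₂ hE₂
    (isExp_expSeries L _) (shift_lin β₁ _ _)
    (contraction_eq (isExp_expSeries L _) [t * s ^ 2, t⁻¹, (s ^ 2)⁻¹] [s ^ 2, t, (t * s ^ 2)⁻¹]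
      fun m => by
        have h1 : ((m : ℕ) : L) ≠ 0 := by exact_mod_cast m.ne_zero
        have h2 : t ^ (m : ℕ) ≠ 0 := pow_ne_zero _ ht0
        have h3 : s ^ (m : ℕ) ≠ 0 := pow_ne_zero _ hs
        have h4 : (s ^ 2) ^ (m : ℕ) = (s ^ (m : ℕ)) ^ 2 := by ring
        simp only [List.map_cons, List.map_nil, List.sum_cons, List.sum_nil, hpow, inv_pow, hβ₁,
          bosonDir, if_true, h4]
        simp
        field_simp
        ring) hx (by
        have h1 : 1 - t * s ^ 2 * (s ^ 2)⁻¹ = 1 - t := by field_simp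
        have h2 : 1 - t⁻¹ * (s ^ 2)⁻¹ ≠ 0 := by
          rw [← mul_inv, sub_ne_zero]
          intro h
          exact hq (inv_eq_one.1 h.symm)
        have h3 : 1 - (s ^ 2)⁻¹ * (s ^ 2)⁻¹ ≠ 0 := by
          rw [← mul_inv, sub_ne_zero]
          intro h
          exact hp (inv_eq_one.1 h.symm)
        simpa [h1, Polynomial.eval_mul] using ⟨ht1, h2, h3⟩) n v d
  -- Λ² annihilates only the second boson and Λ¹ creates only the first, so this contraction is 1.
  have h21 := hasRationalValue_product bosonDeg (E₁ := E₂) (β₁ := β₂) β₁ hE₁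
    (isExp_expSeries L _) (shift_lin β₂ _ _)
    (contraction_eq (isExp_expSeries L _) [] [] fun m => by
      simp [hβ₂, bosonDir]) hx (by simp) n v d
  have key := (((h11.const_mul (u 0 * u 0)).add (h12.const_mul (u 0 * u 1))).add
    (h21.const_mul (u 1 * u 0))).add (h22.const_mul (u 1 * u 1))
  convert key using 1
  · funext j
    simp only [genXOne, lambdaOne_eq u ht hE₁, lambdaTwo_eq u ht hs hE₂, map_add, map_mul, shift_C,
      pair_C_mul, MvPolynomial.coeff_add, MvPolynomial.coeff_C_mul]
    ring
  · have h5 := congrArg (MvPolynomial.coeff d) (normXTwo_eq u K hs n v hE₁ hE₂)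
    rw [MvPolynomial.coeff_C_mul, MvPolynomial.coeff_C_mul] at h5
    have hP' : ((([s ^ 2, t, (t * s ^ 2)⁻¹].map fun c => 1 - Polynomial.C c * Polynomial.X).prod :
        Polynomial L)).eval (s ^ 2)⁻¹ = 0 := by
      have : s ^ 2 * (s ^ 2)⁻¹ = 1 := mul_inv_cancel₀ (pow_ne_zero _ hs)
      simp [Polynomial.eval_mul, this]
    rw [hP, hP', ← h5, List.map_nil, List.prod_nil, Polynomial.eval_one]
    ring

lemma genXTwo_spec (K : Type*) [Field K] [CharZero K] [Algebra K L] (ht0 : t ≠ 0)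
    (ht : ∀ n : ℕ, 0 < n → t ^ n ≠ 1) (hs : s ≠ 0) (hq : t * s ^ 2 ≠ 1)
    (hp : s ^ 2 * s ^ 2 ≠ 1) (n : ℤ) :
    IsGenXTwo s t u n (genXTwo s t u n) ∧ genXTwo s t u n = normXTwo K s t u n := by
  have h0 := isGenXTwo_normXTwo u K ht0 ht hs hq hp n
  have h : IsGenXTwo s t u n (genXTwo s t u n) := by
    rw [genXTwo, dif_pos ⟨_, h0⟩]
    exact Exists.choose_spec _
  refine ⟨h, ?_⟩
  funext v
  ext d
  exact mul_left_cancel₀ (zpow_ne_zero n (pow_ne_zero 2 hs)) ((h v d).unique (h0 v d))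

end GenX

end Crystal
namespace Crystal
open Finset

/-! ### The limit `q → 0` -/

section Limit
variable {K : Type*} [Field K]

lemma HasValueAtZero.unique {f : RatFunc K} {a b : K} (h : HasValueAtZero f a)
    (h' : HasValueAtZero f b) : a = b := by
  obtain ⟨P, Q, hQ, hf, rfl⟩ := h
  obtain ⟨P', Q', hQ', hf', rfl⟩ := h'
  have hne : ∀ Q : Polynomial K, Q.eval 0 ≠ 0 → algebraMap (Polynomial K) (RatFunc K) Q ≠ 0 := by
    intro Q hQ h
    rw [map_eq_zero_iff _ (RatFunc.algebraMap_injective K)] at h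
    simp [h] at hQ
  rw [hf, div_eq_div_iff (hne Q hQ) (hne Q' hQ'), ← map_mul, ← map_mul] at hf'
  have h := congrArg (Polynomial.eval 0) (RatFunc.algebraMap_injective K hf')
  rw [Polynomial.eval_mul, Polynomial.eval_mul] at h
  rw [div_eq_div_iff hQ hQ', h]

lemma IsCrystalLimit.unique {A : Fock (RatFunc K) → Fock (RatFunc K)} {B B' : Fock K → Fock K}
    (h : IsCrystalLimit A B) (h' : IsCrystalLimit A B') : B = B' := by
  funext v
  ext d
  exact (h v d).unique (h' v d)

lemma crystalLimit_spec {A : Fock (RatFunc K) → Fock (RatFunc K)} {B : Fock K → Fock K}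
    (h : IsCrystalLimit A B) : IsCrystalLimit A (crystalLimit A) ∧ crystalLimit A = B := by
  have h2 : IsCrystalLimit A (crystalLimit A) := by
    rw [crystalLimit, dif_pos ⟨_, h⟩]
    exact Exists.choose_spec _
  exact ⟨h2, h2.unique h⟩

/-- An operator defined over K[s] has its limit by evaluation at s = 0; no denominators occur. -/
lemma isCrystalLimit_of_polynomial {A : Fock (RatFunc K) → Fock (RatFunc K)} {B : Fock K → Fock K}
    (F : Fock K → MvPolynomial (Fin 2 × ℕ+) (Polynomial K))
    (hA : ∀ v, A (MvPolynomial.map RatFunc.C v) =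
      MvPolynomial.map (algebraMap (Polynomial K) (RatFunc K)) (F v))
    (hB : ∀ v, B v = MvPolynomial.map (Polynomial.evalRingHom 0) (F v)) :
    IsCrystalLimit A B := by
  intro v d
  rw [hA, hB, MvPolynomial.coeff_map, MvPolynomial.coeff_map]
  exact ⟨MvPolynomial.coeff d (F v), 1, by simp, by simp, by simp⟩

variable {t : K} (u : Fin 2 → K)

instance [CharZero K] : CharZero (RatFunc K) :=
  charZero_of_injective_algebraMap (RatFunc.algebraMap_injective K)

lemma map_algebraMap_map_C (v : Fock K) :
    MvPolynomial.map (algebraMap (Polynomial K) (RatFunc K)) (MvPolynomial.map Polynomial.C v) =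
      MvPolynomial.map RatFunc.C v := by
  rw [MvPolynomial.map_map]
  congr 1

lemma map_eval_map_C (v : Fock K) :
    MvPolynomial.map (Polynomial.evalRingHom 0) (MvPolynomial.map Polynomial.C v) = v := by
  rw [MvPolynomial.map_map]
  have : (Polynomial.evalRingHom (0 : K)).comp Polynomial.C = RingHom.id K := by ext; simp
  rw [this, MvPolynomial.map_id]

lemma RatFunc_C_pow_ne_one (ht : ∀ n : ℕ, 0 < n → t ^ n ≠ 1) (n : ℕ) (hn : 0 < n) :
    (RatFunc.C t : RatFunc K) ^ n ≠ 1 := by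
  rw [← map_pow, ← map_one (RatFunc.C : K →+* RatFunc K)]
  exact fun h => ht n hn (RatFunc.C_injective h)

lemma RatFunc_C_mul_X_pow_ne_one (c : K) (n : ℕ) (hn : 0 < n) :
    (RatFunc.C c : RatFunc K) * RatFunc.X ^ n ≠ 1 := by
  rw [← RatFunc.algebraMap_C, ← RatFunc.algebraMap_X, ← map_pow, ← map_mul,
    ← map_one (algebraMap (Polynomial K) (RatFunc K))]
  intro h
  have h2 := congrArg (Polynomial.eval 0) (RatFunc.algebraMap_injective K h)
  simp [hn.ne'] at h2

section
variable {R R' : Type*} [CommRing R] [CommRing R'] [Algebra K R] [Algebra K R'] {σ : Type*}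
  (deg : σ → ℕ)

lemma map_C_mul_vop [CharZero K] (φ : R →+* R') (c : R) (a : ℕ+ → MvPolynomial σ R) (β : σ → R)
    (n : ℤ) (v : MvPolynomial σ R) : MvPolynomial.map φ (MvPolynomial.C c * vop K deg a β n v) =
      MvPolynomial.C (φ c) * vop K deg (fun m => MvPolynomial.map φ (a m)) (fun i => φ (β i)) n
        (MvPolynomial.map φ v) := by
  rw [map_mul, map_vop, MvPolynomial.map_C]

lemma C_mul_vop_congr {c c' : R} {a a' : ℕ+ → MvPolynomial σ R} {β β' : σ → R}
    {v v' : MvPolynomial σ R} (hc : c = c') (ha : a = a') (hβ : β = β') (hv : v = v') (n : ℤ) :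
    MvPolynomial.C c * vop K deg a β n v = MvPolynomial.C c' * vop K deg a' β' n v' := by
  rw [hc, ha, hβ, hv]

end

variable [CharZero K]

lemma genXTwo_ratFunc (ht0 : t ≠ 0) (ht : ∀ n : ℕ, 0 < n → t ^ n ≠ 1) (n : ℤ) :
    IsGenXTwo RatFunc.X (RatFunc.C t) (fun i => RatFunc.C (u i)) n
        (genXTwo RatFunc.X (RatFunc.C t) (fun i => RatFunc.C (u i)) n) ∧
      genXTwo RatFunc.X (RatFunc.C t) (fun i => RatFunc.C (u i)) n =
        normXTwo K RatFunc.X (RatFunc.C t) (fun i => RatFunc.C (u i)) n := by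
  refine genXTwo_spec _ K ?_ (RatFunc_C_pow_ne_one ht) RatFunc.X_ne_zero
    (RatFunc_C_mul_X_pow_ne_one t 2 two_pos) ?_ n
  · exact (map_ne_zero_iff _ RatFunc.C_injective).2 ht0
  · have := RatFunc_C_mul_X_pow_ne_one (1 : K) 4 (by norm_num)
    rwa [map_one, one_mul, show 4 = 2 + 2 from rfl, pow_add] at this

/-- The coefficients `(1 - r^n) / n`. -/
def hlCoeff (r : K) (m : ℕ+) : K := (1 - r ^ (m : ℕ)) / (m : ℕ)

lemma ratFunc_C_hlCoeff (m : ℕ+) : (RatFunc.C (hlCoeff t⁻¹ m) : RatFunc K) =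
    (1 - (RatFunc.C t)⁻¹ ^ (m : ℕ)) / (m : ℕ) := by
  simp [hlCoeff, map_div₀, map_inv₀]

/-- The normalization s^n cancels the s^{-n} of `normXTwo`. At s = 0 the first boson drops out of
the creation part, while both bosons are still translated by -1. -/
lemma crystalXTwo_spec (ht0 : t ≠ 0) (ht : ∀ n : ℕ, 0 < n → t ^ n ≠ 1) (n : ℤ) :
    IsCrystalLimit (scaledXTwo t u n) (crystalXTwo t u n) ∧
      crystalXTwo t u n = fun v => MvPolynomial.C (u 0 * u 1) *
        vop K bosonDeg (lin 0 (hlCoeff t⁻¹)) (fun _ => -1) n v := by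
  apply crystalLimit_spec
  refine isCrystalLimit_of_polynomial
    (fun v => MvPolynomial.C (Polynomial.C (u 0 * u 1)) * vop K bosonDeg
      (lin (fun m : ℕ+ => Polynomial.C (hlCoeff t⁻¹ m) * (Polynomial.X ^ 2) ^ (m : ℕ))
        (fun m : ℕ+ => Polynomial.C (hlCoeff t⁻¹ m)))
      (fun x => -(1 - (Polynomial.C t * Polynomial.X ^ 2) ^ (x.2 : ℕ))) n
      (MvPolynomial.map Polynomial.C v)) (fun v => ?_) fun v => ?_
  · rw [map_C_mul_vop, scaledXTwo, (genXTwo_ratFunc u ht0 ht n).2,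
      normXTwo, MvPolynomial.smul_eq_C_mul, ← mul_assoc, ← map_mul]
    refine C_mul_vop_congr _ ?_ ?_ ?_ (map_algebraMap_map_C v).symm n
    · have : (RatFunc.X : RatFunc K) ^ n * RatFunc.X ^ (-n) = 1 := by
        rw [← zpow_add₀ RatFunc.X_ne_zero, add_neg_cancel, zpow_zero]
      simp only [RatFunc.algebraMap_C, map_mul]
      linear_combination (RatFunc.C (u 0) * RatFunc.C (u 1)) * this
    · funext m
      simp only [map_lin, map_mul, map_pow, RatFunc.algebraMap_C, RatFunc.algebraMap_X,
        ratFunc_C_hlCoeff]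
    · funext x
      simp only [map_mul, map_pow, RatFunc.algebraMap_C, RatFunc.algebraMap_X, map_neg, map_sub,
        map_one]
  · rw [map_C_mul_vop]
    refine C_mul_vop_congr _ ?_ ?_ ?_ (map_eval_map_C v).symm n
    · simp
    · funext m
      simp [lin]
    · funext x
      simp

/-- The scalars are s^{|n| - n} for Λ¹ and s^{|n| + n} for Λ². With 0^0 = 1 they select Λ¹ for n >
0, Λ² for n < 0, and both for n = 0. -/
lemma crystalXOne_spec (ht : ∀ n : ℕ, 0 < n → t ^ n ≠ 1) (n : ℤ) :
    IsCrystalLimit (scaledXOne t u n) (crystalXOne t u n) ∧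
      crystalXOne t u n = fun v =>
        MvPolynomial.C (u 0 * 0 ^ (n.natAbs - n).toNat) *
          vop K bosonDeg (lin (hlCoeff t⁻¹) 0) (bosonDir 0 fun _ => -1) n v +
        MvPolynomial.C (u 1 * 0 ^ (n.natAbs + n).toNat) *
          vop K bosonDeg (lin (-hlCoeff t⁻¹) (hlCoeff t⁻¹)) (bosonDir 1 fun _ => -1) n v := by
  apply crystalLimit_spec
  refine isCrystalLimit_of_polynomial
    (fun v => MvPolynomial.C (Polynomial.C (u 0) * Polynomial.X ^ (n.natAbs - n).toNat) *
        vop K bosonDeg (lin (fun m : ℕ+ => Polynomial.C (hlCoeff t⁻¹ m)) (fun _ => 0))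
        (bosonDir 0 fun m => -(1 - (Polynomial.C t * Polynomial.X ^ 2) ^ (m : ℕ))) n
        (MvPolynomial.map Polynomial.C v) +
      MvPolynomial.C (Polynomial.C (u 1) * Polynomial.X ^ (n.natAbs + n).toNat) *
        vop K bosonDeg
        (lin (fun m : ℕ+ => Polynomial.C (hlCoeff t⁻¹ m) * ((Polynomial.X ^ 2) ^ (m : ℕ) - 1))
          (fun m : ℕ+ => Polynomial.C (hlCoeff t⁻¹ m)))
        (bosonDir 1 fun m => -(1 - (Polynomial.C t * Polynomial.X ^ 2) ^ (m : ℕ))) n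
        (MvPolynomial.map Polynomial.C v)) (fun v => ?_) fun v => ?_
  · rw [map_add, map_C_mul_vop, map_C_mul_vop, scaledXOne,
      genXOne_eq _ K (RatFunc_C_pow_ne_one ht) RatFunc.X_ne_zero, MvPolynomial.smul_eq_C_mul,
      mul_add, ← mul_assoc, ← mul_assoc, ← map_mul, ← map_mul]
    have h1 : (RatFunc.X : RatFunc K) ^ n.natAbs * RatFunc.X ^ (-n) =
        RatFunc.X ^ (n.natAbs - n).toNat := by
      rw [← zpow_natCast, ← zpow_natCast, ← zpow_add₀ RatFunc.X_ne_zero]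
      congr 1; omega
    have h2 : (RatFunc.X : RatFunc K) ^ n.natAbs * RatFunc.X ^ n =
        RatFunc.X ^ (n.natAbs + n).toNat := by
      rw [← zpow_natCast, ← zpow_natCast, ← zpow_add₀ RatFunc.X_ne_zero]
      congr 1; omega
    refine congrArg₂ _ (C_mul_vop_congr _ ?_ ?_ ?_ (map_algebraMap_map_C v).symm n)
      (C_mul_vop_congr _ ?_ ?_ ?_ (map_algebraMap_map_C v).symm n)
    · rw [map_mul, map_pow, RatFunc.algebraMap_C, RatFunc.algebraMap_X, ← h1]
      ring
    · funext m
      simp only [map_lin, RatFunc.algebraMap_C, ratFunc_C_hlCoeff, map_zero]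
    · funext x
      simp only [bosonDir, apply_ite (algebraMap (Polynomial K) (RatFunc K)), map_mul, map_pow,
        RatFunc.algebraMap_C, RatFunc.algebraMap_X, map_neg, map_sub, map_one, map_zero]
    · rw [map_mul, map_pow, RatFunc.algebraMap_C, RatFunc.algebraMap_X, ← h2]
      ring
    · funext m
      simp only [map_lin, map_mul, map_pow, RatFunc.algebraMap_C, RatFunc.algebraMap_X,
        ratFunc_C_hlCoeff, map_sub, map_one]
    · funext x
      simp only [bosonDir, apply_ite (algebraMap (Polynomial K) (RatFunc K)), map_mul, map_pow,
        RatFunc.algebraMap_C, RatFunc.algebraMap_X, map_neg, map_sub, map_one, map_zero]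
  · rw [map_add, map_C_mul_vop, map_C_mul_vop]
    refine congrArg₂ _ (C_mul_vop_congr _ ?_ ?_ ?_ (map_eval_map_C v).symm n)
      (C_mul_vop_congr _ ?_ ?_ ?_ (map_eval_map_C v).symm n)
    · simp
    · funext m
      simp [lin]
    · funext x
      simp [bosonDir, apply_ite (Polynomial.eval (0 : K))]
    · simp
    · funext m
      simp [lin]
    · funext x
      simp [bosonDir, apply_ite (Polynomial.eval (0 : K))]

lemma crystalXOne_of_pos (ht : ∀ n : ℕ, 0 < n → t ^ n ≠ 1) {n : ℕ} (hn : 0 < n) (v : Fock K) :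
    crystalXOne t u n v = MvPolynomial.C (u 0) *
      vop K bosonDeg (lin (hlCoeff t⁻¹) 0) (bosonDir 0 fun _ => -1) n v := by
  rw [(crystalXOne_spec u ht n).2]
  have h1 : (((n : ℤ).natAbs : ℤ) + n).toNat ≠ 0 := by omega
  have h2 : (((n : ℤ).natAbs : ℤ) - n).toNat = 0 := by omega
  simp only [h2, pow_zero, mul_one, zero_pow h1, mul_zero, map_zero, zero_mul, add_zero]

lemma crystalXOne_of_neg (ht : ∀ n : ℕ, 0 < n → t ^ n ≠ 1) {n : ℕ} (hn : 0 < n) (v : Fock K) :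
    crystalXOne t u (-n) v = MvPolynomial.C (u 1) *
      vop K bosonDeg (lin (-hlCoeff t⁻¹) (hlCoeff t⁻¹)) (bosonDir 1 fun _ => -1) (-n) v := by
  rw [(crystalXOne_spec u ht (-n)).2]
  have h1 : (((-(n : ℤ)).natAbs : ℤ) - -n).toNat ≠ 0 := by omega
  have h2 : (((-(n : ℤ)).natAbs : ℤ) + -n).toNat = 0 := by omega
  simp only [h2, pow_zero, mul_one, zero_pow h1, mul_zero, map_zero, zero_mul, zero_add]

end Limit

end Crystal
namespace Crystal
open Finset

/-! ### The scalar product on symmetric functions -/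

section Form
variable {K : Type*} [Field K]

/-- Summation over a common finite set makes symmetry and bilinearity of the form visible. -/
lemma innerQT_eq_sum (q t : K) (f g : Sym K) (s : Finset (ℕ+ →₀ ℕ)) (hs : f.support ⊆ s) :
    innerQT q t f g = ∑ d ∈ s, f.coeff d * g.coeff d * powerSumNorm q t d := by
  unfold innerQT
  refine Finset.sum_subset hs fun d _ hd => ?_
  rw [MvPolynomial.notMem_support_iff.1 hd, zero_mul, zero_mul]

lemma innerQT_comm (q t : K) (f g : Sym K) : innerQT q t f g = innerQT q t g f := by
  classical
  rw [innerQT_eq_sum q t f g _ (Finset.subset_union_left (s₂ := g.support)),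
    innerQT_eq_sum q t g f _ (Finset.subset_union_right (s₁ := f.support))]
  exact Finset.sum_congr rfl fun d _ => by ring

lemma innerQT_add_left (q t : K) (f f' g : Sym K) :
    innerQT q t (f + f') g = innerQT q t f g + innerQT q t f' g := by
  classical
  rw [innerQT_eq_sum q t (f + f') g _ MvPolynomial.support_add,
    innerQT_eq_sum q t f g _ (Finset.subset_union_left (s₂ := f'.support)),
    innerQT_eq_sum q t f' g _ (Finset.subset_union_right (s₁ := f.support)),
    ← Finset.sum_add_distrib]
  exact Finset.sum_congr rfl fun d _ => by rw [MvPolynomial.coeff_add]; ring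

lemma innerQT_smul_left (q t c : K) (f g : Sym K) :
    innerQT q t (c • f) g = c * innerQT q t f g := by
  rw [innerQT_eq_sum q t (c • f) g _ MvPolynomial.support_smul, innerQT, Finset.mul_sum]
  exact Finset.sum_congr rfl fun d _ => by rw [MvPolynomial.coeff_smul, smul_eq_mul]; ring

/-- `innerQT` as a bilinear form. -/
noncomputable def formQT (q t : K) : Sym K →ₗ[K] Sym K →ₗ[K] K :=
  LinearMap.mk₂ K (innerQT q t) (innerQT_add_left q t) (innerQT_smul_left q t)
    (fun f g g' => by
      rw [innerQT_comm, innerQT_add_left, innerQT_comm q t g, innerQT_comm q t g'])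
    (fun c f g => by rw [innerQT_comm, innerQT_smul_left, innerQT_comm q t g]; rfl)

lemma formQT_apply (q t : K) (f g : Sym K) : formQT q t f g = innerQT q t f g := rfl

lemma formQT_comm (q t : K) (f g : Sym K) : formQT q t f g = formQT q t g f :=
  innerQT_comm q t f g

lemma formQT_monomial_left (q t : K) (d : ℕ+ →₀ ℕ) (c : K) (g : Sym K) :
    formQT q t (MvPolynomial.monomial d c) g = c * g.coeff d * powerSumNorm q t d := by
  classical
  rw [formQT_apply, innerQT_eq_sum q t _ g {d} MvPolynomial.support_monomial_subset]
  simp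

lemma powerSumNorm_add_single (q t : K) (d : ℕ+ →₀ ℕ) (m : ℕ+) :
    powerSumNorm q t (d + Finsupp.single m 1) = powerSumNorm q t d * ((d m + 1) *
      ((m : ℕ) * ((1 - q ^ (m : ℕ)) / (1 - t ^ (m : ℕ))))) := by
  classical
  unfold powerSumNorm
  set h : ℕ+ → ℕ → K := fun n k => ((n : ℕ) : K) ^ k * (k.factorial : K) *
    ((1 - q ^ (n : ℕ)) / (1 - t ^ (n : ℕ))) ^ k with hh
  have h0 : ∀ n, h n 0 = 1 := by simp [hh]
  rw [Finsupp.prod_of_support_subset (d + Finsupp.single m 1) (s := insert m d.support) ?_ h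
    (fun n _ => h0 n), Finsupp.prod_of_support_subset d (s := insert m d.support)
    (Finset.subset_insert _ _) h (fun n _ => h0 n),
    ← Finset.mul_prod_erase _ _ (Finset.mem_insert_self m _),
    ← Finset.mul_prod_erase _ _ (Finset.mem_insert_self m _)]
  · have h1 : ∀ n ∈ (insert m d.support).erase m,
        h n ((d + Finsupp.single m 1 : ℕ+ →₀ ℕ) n) = h n (d n) := fun n hn => by
      rw [Finsupp.add_apply, Finsupp.single_eq_of_ne (Finset.ne_of_mem_erase hn), add_zero]
    rw [Finset.prod_congr rfl h1]
    simp only [hh, Finsupp.add_apply, Finsupp.single_eq_same, Nat.factorial_succ]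
    push_cast
    ring
  · refine Finsupp.support_add.trans (Finset.union_subset (Finset.subset_insert _ _) ?_)
    exact Finsupp.support_single_subset.trans (by simp)

/-- The adjoint of the multiplication by a power sum. -/
lemma formQT_X_mul (q t : K) (m : ℕ+) (f g : Sym K) :
    formQT q t (MvPolynomial.X m * f) g =
      (m : ℕ) * ((1 - q ^ (m : ℕ)) / (1 - t ^ (m : ℕ))) *
        formQT q t f (MvPolynomial.pderiv m g) := by
  induction f using MvPolynomial.induction_on' with
  | monomial d c =>
    rw [mul_comm, MvPolynomial.X, MvPolynomial.monomial_mul, formQT_monomial_left,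
      formQT_monomial_left, MvPolynomial.coeff_pderiv, powerSumNorm_add_single]
    ring
  | add f f' hf hf' => rw [mul_add, map_add, map_add, LinearMap.add_apply, LinearMap.add_apply,
      hf, hf', mul_add]

lemma formQT_one (q t : K) (f : Sym K) : formQT q t 1 f = MvPolynomial.constantCoeff f := by
  have h : (1 : Sym K) = MvPolynomial.monomial 0 1 := rfl
  rw [h, formQT_monomial_left, MvPolynomial.constantCoeff_eq]
  simp [powerSumNorm]

lemma negVars_X (m : ℕ+) : Sym.negVars (MvPolynomial.X m : Sym K) = -MvPolynomial.X m := by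
  simp [Sym.negVars]

lemma negVars_negVars (f : Sym K) : Sym.negVars (Sym.negVars f) = f := by
  have : (Sym.negVars (K := K)).comp Sym.negVars = AlgHom.id K _ := by
    ext m; simp [negVars_X]
  exact congrArg (fun φ => φ f) this

lemma pderiv_negVars (m : ℕ+) (f : Sym K) :
    MvPolynomial.pderiv m (Sym.negVars f) = -Sym.negVars (MvPolynomial.pderiv m f) := by
  classical
  induction f using MvPolynomial.induction_on with
  | C a =>
    rw [← MvPolynomial.algebraMap_eq, AlgHom.commutes]
    simp [MvPolynomial.algebraMap_eq]
  | add f g hf hg => simp only [map_add, hf, hg, neg_add]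
  | mul_X f i hf =>
    simp only [map_mul, Derivation.leibniz, hf, negVars_X, map_neg, smul_eq_mul, map_add,
      MvPolynomial.pderiv_X, Pi.single_apply]
    split_ifs
    · simp; ring
    · simp

/-- The sign change turns both p_m and its adjoint, a multiple of ∂/∂p_m, into their negatives,
hence is self-adjoint. -/
lemma formQT_negVars (q t : K) (f g : Sym K) :
    formQT q t (Sym.negVars f) g = formQT q t f (Sym.negVars g) := by
  induction f using MvPolynomial.induction_on generalizing g with
  | C a =>
    rw [← MvPolynomial.algebraMap_eq, AlgHom.commutes, Algebra.algebraMap_eq_smul_one, map_smul,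
      LinearMap.smul_apply, LinearMap.smul_apply, formQT_one, formQT_one]
    congr 1
    induction g using MvPolynomial.induction_on with
    | C a => rw [← MvPolynomial.algebraMap_eq, AlgHom.commutes]
    | add f g hf hg => simp only [map_add, hf, hg]
    | mul_X f i hf => simp only [map_mul, negVars_X, map_neg]; simp
  | add f f' hf hf' => simp only [map_add, LinearMap.add_apply, hf, hf']
  | mul_X f i hf =>
    rw [map_mul, negVars_X, mul_neg, mul_comm, map_neg, LinearMap.neg_apply, formQT_X_mul, hf,
      mul_comm f, formQT_X_mul, pderiv_negVars, map_neg]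
    ring

end Form

/-! ### Jing's vertex operators -/

section Jing
variable {K : Type*} [Field K]

/-- The degree of a power sum. -/
def symDeg (m : ℕ+) : ℕ := m

/-- The exponents `ε (1 - r^m) / m p_m`. -/
noncomputable def jingExp (r ε : K) (m : ℕ+) : Sym K :=
  MvPolynomial.C (ε * hlCoeff r m) * MvPolynomial.X m

/-- The generating series `exp (ε ∑ (1 - r^m) / m p_m z^m)`. -/
noncomputable def hlSeries (r ε : K) : PowerSeries (Sym K) := expSeries K (ogf (jingExp r ε))

/-- The modes of Jing's vertex operator (`ε = 1`) and of its dual (`ε = -1`). -/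
noncomputable def jing (r ε : K) (n : ℤ) : Sym K →ₗ[K] Sym K :=
  vop K symDeg (jingExp r ε) (fun _ => -ε) n

lemma jing_apply (r ε : K) (n : ℤ) (f : Sym K) :
    jing r ε n f = pair (hlSeries r ε) n (shift symDeg (fun _ => -ε) f) := rfl

variable [CharZero K] {r : K}

lemma isExp_hlSeries (r ε : K) : IsExp (ogf (jingExp r ε)) (hlSeries r ε) :=
  isExp_expSeries K _

/-- The adjoint of multiplication by (1 - r^m)/m p_m is ∂/∂p_m, so the adjoint of the creation
exponential is a translation. The proof compares the two recursions in k. -/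
lemma formQT_hlSeries_mul (hr : ∀ n : ℕ, 0 < n → r ^ n ≠ 1) (ε : K) (k : ℕ) (f g : Sym K) :
    formQT 0 r (PowerSeries.coeff k (hlSeries r ε) * f) g =
      formQT 0 r f ((shift symDeg (fun _ => ε) g).coeff k) := by
  induction k using Nat.strong_induction_on generalizing g with
  | _ k ih =>
    rcases Nat.eq_zero_or_pos k with rfl | hk
    · rw [(isExp_hlSeries r ε).1, one_mul]
      congr 1
      -- Rescaling by 0 turns the translation into the identity because all degrees are positive,
      -- and leaves the coefficient of T^0 unchanged.
      have h := coeff_shift_smul symDeg (0 : K) (fun _ => ε) g 0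
      have h2 : (fun i => (0 : K) ^ symDeg i * ε) = 0 := by
        funext i; simp [symDeg, i.ne_zero]
      rw [h2, shift_zero] at h
      simpa using h
    · have hk' : (k : K) ≠ 0 := by exact_mod_cast hk.ne'
      refine mul_left_cancel₀ hk' ?_
      rw [← smul_eq_mul (k : K), ← smul_eq_mul (k : K), ← LinearMap.smul_apply, ← map_smul,
        ← map_smul, coeff_shift_rec (deg := symDeg) (β := fun _ => ε) (ι := id)
          (fun m => rfl) (by simp), map_sum]
      have h1 := (isExp_hlSeries r ε).coeff_rec k
      rw [← Finset.Nat.sum_antidiagonal_swap,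
        Finset.Nat.sum_antidiagonal_eq_sum_range_succ_mk, Finset.sum_range_succ'] at h1
      simp only [Prod.fst_swap, Prod.snd_swap, coeff_zero_ogf, mul_zero, add_zero] at h1
      rw [← smul_mul_assoc, MvPolynomial.smul_eq_C_mul, map_natCast, h1, Finset.sum_mul, map_sum,
        LinearMap.sum_apply]
      refine Finset.sum_congr rfl fun m hm => ?_
      have hm' := Finset.mem_range.1 hm
      have h4 : PowerSeries.coeff (m + 1) (ogf (jingExp r ε)) = jingExp r ε m.succPNat :=
        coeff_ogf _ m.succPNat
      have h5 : PowerSeries.coeff (k - (m + 1)) (hlSeries r ε) *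
          (((m + 1 : ℕ) : Sym K) * jingExp r ε m.succPNat) * f =
          (((m + 1 : ℕ) : K) * (ε * hlCoeff r m.succPNat)) • (MvPolynomial.X m.succPNat *
            (PowerSeries.coeff (k - (m + 1)) (hlSeries r ε) * f)) := by
        simp only [jingExp, MvPolynomial.smul_eq_C_mul, map_mul, map_natCast]
        ring
      rw [h4, h5, map_smul, LinearMap.smul_apply, formQT_X_mul, ih _ (by omega), map_smul,
        map_smul, Polynomial.coeff_smul, map_smul, smul_eq_mul, smul_eq_mul, smul_eq_mul]
      have h6 : ((m + 1 : ℕ) : K) ≠ 0 := by exact_mod_cast Nat.succ_ne_zero m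
      have h7 : 1 - r ^ (m + 1) ≠ 0 := sub_ne_zero.2 (hr _ (Nat.succ_pos m)).symm
      simp only [hlCoeff, Nat.succPNat_coe, Nat.succ_eq_add_one, id, zero_pow (Nat.succ_ne_zero m)]
      field_simp
      ring

/-- The two vertex operators are adjoint. -/
lemma formQT_jing (hr : ∀ n : ℕ, 0 < n → r ^ n ≠ 1) (ε : K) (n : ℕ) (f g : Sym K) :
    formQT 0 r (jing r ε (-n) f) g = formQT 0 r f (jing r (-ε) n g) := by
  rw [jing_apply, jing_apply, neg_neg]
  set P := shift symDeg (fun _ => -ε) f with hP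
  set P' := shift symDeg (fun _ => ε) g with hP'
  obtain ⟨M, hM, hM'⟩ : ∃ M, P.natDegree < M ∧ P'.natDegree < M :=
    ⟨P.natDegree + P'.natDegree + 1, by omega, by omega⟩
  -- The second sum is n terms longer; its first n terms vanish and the others match termwise after
  -- an index shift by n.
  rw [pair_eq_sum _ _ P hM, pair_eq_sum _ _ P' (M := n + M) (by omega),
    Finset.sum_range_add, map_add, map_sum, map_sum, map_sum, LinearMap.sum_apply]
  have h0 : ∑ k ∈ range n, formQT 0 r f (coeffZ (hlSeries r (-ε)) ((k : ℤ) - n) * P'.coeff k) = 0 := by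
    refine Finset.sum_eq_zero fun k hk => ?_
    rw [coeffZ_of_neg _ (by have := Finset.mem_range.1 hk; omega), zero_mul, map_zero]
  rw [h0, zero_add]
  refine Finset.sum_congr rfl fun k _ => ?_
  have h1 : ((k : ℤ) - -n) = (n + k : ℕ) := by push_cast; ring
  have h2 : (((n + k : ℕ) : ℤ) - n) = k := by push_cast; ring
  rw [h1, h2, coeffZ_natCast, coeffZ_natCast, formQT_hlSeries_mul hr, formQT_comm,
    formQT_comm 0 r f, formQT_hlSeries_mul hr, formQT_comm]

end Jing
end Crystal
namespace Crystal
open Finset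

/-! ### Algebra homomorphisms that intertwine vertex operators. -/

section Intertwine
variable {R : Type*} [CommRing R] {σ τ : Type*} {deg : σ → ℕ} {deg' : τ → ℕ}
  {β : σ → R} {β' : τ → R}

lemma shift_algHom (Φ : MvPolynomial σ R →ₐ[R] MvPolynomial τ R)
    (h : ∀ i, shift deg' β' (Φ (MvPolynomial.X i)) =
      Polynomial.C (Φ (MvPolynomial.X i)) +
        Polynomial.C (MvPolynomial.C (β i)) * Polynomial.X ^ deg i) (f : MvPolynomial σ R) :
    shift deg' β' (Φ f) = (shift deg β f).map (Φ : MvPolynomial σ R →+* MvPolynomial τ R) := by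
  have hC : ∀ c, Φ (MvPolynomial.C c) = MvPolynomial.C c := fun c => by
    rw [← MvPolynomial.algebraMap_eq, AlgHom.commutes]; rfl
  have key : (shift deg' β').comp Φ = (Polynomial.mapAlgHom Φ).comp (shift deg β) := by
    refine MvPolynomial.algHom_ext fun i => ?_
    rw [AlgHom.comp_apply, AlgHom.comp_apply, h, shift_X]
    simp [hC]
  exact congrArg (fun ψ => ψ f) key

lemma algHom_vop (K : Type*) [Field K] [CharZero K] [Algebra K R]
    (Φ : MvPolynomial σ R →ₐ[R] MvPolynomial τ R)
    (h : ∀ i, shift deg' β' (Φ (MvPolynomial.X i)) =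
      Polynomial.C (Φ (MvPolynomial.X i)) +
        Polynomial.C (MvPolynomial.C (β i)) * Polynomial.X ^ deg i)
    {a : ℕ+ → MvPolynomial σ R} {a' : ℕ+ → MvPolynomial τ R} (ha : ∀ m, a' m = Φ (a m)) (n : ℤ)
    (f : MvPolynomial σ R) : Φ (vop K deg a β n f) = vop K deg' a' β' n (Φ f) := by
  have h1 := (isExp_expSeries K a).map (Φ : MvPolynomial σ R →+* MvPolynomial τ R)
  rw [ogf_map] at h1
  obtain rfl : a' = fun m => (Φ : MvPolynomial σ R →+* MvPolynomial τ R) (a m) := funext ha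
  rw [vop_apply, ← vop_eq K deg' h1, shift_algHom Φ h, pair_map]
  rfl

end Intertwine

/-! ### The commutation relation between Jing's operators and their duals. -/

section Jing
variable {K : Type*} [Field K]

lemma jing_one (r ε : K) (n : ℤ) : jing r ε n 1 = coeffZ (hlSeries r ε) (-n) := by
  rw [jing_apply, map_one, ← Polynomial.C_1, pair_C, mul_one]

lemma negVars_C (c : K) : Sym.negVars (MvPolynomial.C c : Sym K) = MvPolynomial.C c := by
  rw [← MvPolynomial.algebraMap_eq, AlgHom.commutes]

lemma negVars_jing [CharZero K] (r ε : K) (n : ℤ) (f : Sym K) :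
    Sym.negVars (jing r ε n f) = jing r (-ε) n (Sym.negVars f) := by
  refine algHom_vop K Sym.negVars (fun i => ?_) (fun m => ?_) n f
  · simp [negVars_X]
    ring
  · simp only [jingExp, map_mul, negVars_X, negVars_C, map_neg]
    ring

/-- The contraction `(1 - r x) / (1 - x)`. -/
noncomputable def dualContraction (r : K) : PowerSeries K :=
  PowerSeries.mk fun i => if i = 0 then 1 else 1 - r

lemma coeffZ_dualContraction_zero (r : K) : coeffZ (dualContraction r) 0 = 1 := by
  simp [coeffZ, dualContraction]

lemma coeffZ_dualContraction_of_pos (r : K) {n : ℤ} (hn : 0 < n) :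
    coeffZ (dualContraction r) n = 1 - r := by
  have : n.toNat ≠ 0 := by omega
  simp [coeffZ, dualContraction, hn.le, this]

variable [CharZero K]

lemma isExp_dualContraction (r : K) :
    IsExp (ogf fun m => hlCoeff r m) (dualContraction r) := by
  have h0 := isExp_expSeries K (fun m => hlCoeff r m)
  have h := contraction_eq h0 [1] [r] (fun m => by simp [hlCoeff]; ring)
  have h2 : dualContraction r * ((([1].map fun c : K =>
      1 - Polynomial.C c * Polynomial.X).prod : Polynomial K) : PowerSeries K) =
      ((([r].map fun c : K => 1 - Polynomial.C c * Polynomial.X).prod : Polynomial K) :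
        PowerSeries K) := by
    simp only [List.map_cons, List.map_nil, List.prod_cons, List.prod_nil, mul_one, map_one, one_mul,
      Polynomial.coe_sub, Polynomial.coe_one, Polynomial.coe_X, Polynomial.coe_mul, Polynomial.coe_C]
    ext k
    rcases k with _ | k
    · simp [dualContraction, mul_sub]
    · rw [mul_sub, map_sub, map_sub, mul_one, PowerSeries.coeff_succ_mul_X,
        PowerSeries.coeff_C_mul, PowerSeries.coeff_X, PowerSeries.coeff_one]
      rcases k with _ | k <;> simp [dualContraction]
  have hne : ((([1].map fun c : K => 1 - Polynomial.C c * Polynomial.X).prod : Polynomial K) :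
      PowerSeries K) ≠ 0 := by
    intro h
    have := congrArg PowerSeries.constantCoeff h
    simp at this
  rw [mul_right_cancel₀ hne (h2.trans h.symm)]
  exact h0

/-- The vanishing sums form a triangular system whose leading terms are F(-i), so F is zero on
negative integers. The sum on the left then runs over k ≥ 0 with weights 1, 1 - r, 1 - r, …, that
is, (1 - r) times the full sum plus r F(0), and F(0) is the last sum. -/
lemma finsum_contraction {A : Type*} [CommRing A] (g : ℤ → A) (r : A) (hneg : ∀ i < 0, g i = 0)
    (h0 : g 0 = 1) (hpos : ∀ i > 0, g i = 1 - r) (F : ℤ → A) (hF : (Function.support F).Finite)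
    (h : ∀ i : ℤ, 0 < i → ∑ᶠ k, g (-i - k) * F k = 0) :
    ∑ᶠ k, g k * F k = (1 - r) * ∑ᶠ k, F k + r * ∑ᶠ k, g (-k) * F k := by
  obtain ⟨N, hN⟩ : ∃ N : ℕ, ∀ k : ℤ, k < -(N : ℤ) → F k = 0 := by
    obtain ⟨a, ha⟩ := hF.bddBelow
    refine ⟨a.natAbs, fun k hk => ?_⟩
    by_contra hne
    have := ha (show k ∈ Function.support F from hne)
    omega
  have hz : ∀ k : ℤ, k < 0 → F k = 0 := by
    have : ∀ j : ℕ, ∀ k : ℤ, k < 0 → k < -(N : ℤ) + j → F k = 0 := by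
      intro j
      induction j with
      | zero => intro k _ hk; exact hN k (by simpa using hk)
      | succ j ih =>
        intro k hk hk'
        have h1 := h (-k) (by omega)
        rw [finsum_eq_single _ k] at h1
        · simpa [h0] using h1
        · intro l hl
          rcases lt_or_gt_of_ne hl with hl | hl
          · rw [ih l (by omega) (by push_cast at hk'; omega), mul_zero]
          · rw [hneg _ (by omega), zero_mul]
    exact fun k hk => this (N + 1) k hk (by push_cast; omega)
  have hr : ∀ k, g (-k) * F k = if k = 0 then F 0 else 0 := by
    intro k
    split_ifs with hk
    · rw [hk, neg_zero, h0, one_mul]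
    · rcases lt_or_gt_of_ne hk with hk | hk
      · rw [hz k hk, mul_zero]
      · rw [hneg _ (by omega), zero_mul]
  rw [mul_finsum' _ _ hF, mul_finsum', ← finsum_add_distrib]
  · refine finsum_congr fun k => ?_
    rw [hr]
    split_ifs with hk
    · rw [hk, h0]; ring
    · rcases lt_or_gt_of_ne hk with hk | hk
      · rw [hz k hk]; ring
      · rw [hpos k hk]; ring
  · exact hF.subset (Function.support_mul_subset_right (fun _ => 1 - r) F)
  · refine hF.subset ?_
    exact (Function.support_mul_subset_right (fun _ => r) fun k => g (-k) * F k).trans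
      (Function.support_mul_subset_right _ _)
  · exact hF.subset (Function.support_mul_subset_right _ _)

lemma map_shift_hlSeries (r ε : K) (hε : ε * ε = 1) :
    (hlSeries r ε).map (shiftHom symDeg fun _ => ε) =
      (hlSeries r ε).map Polynomial.C * PowerSeries.mk fun i =>
        Polynomial.C (PowerSeries.coeff i ((dualContraction r).map MvPolynomial.C)) *
          Polynomial.X ^ i := by
  have h := map_shift_exp symDeg K (fun _ => ε) (isExp_hlSeries r ε) (isExp_dualContraction r)
    (fun m => by
      rw [jingExp, map_mul, shift_C, shift_X, map_mul]
      have : (MvPolynomial.C ε : Sym K) * MvPolynomial.C ε = 1 := by rw [← map_mul, hε, map_one]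
      have h2 : Polynomial.C (MvPolynomial.C ε : Sym K) * Polynomial.C (MvPolynomial.C ε) = 1 := by
        rw [← map_mul, this, map_one]
      simp only [map_mul, symDeg]
      linear_combination (Polynomial.C (MvPolynomial.C (hlCoeff r m)) *
        Polynomial.X ^ (m : ℕ)) * h2)
  simpa using h

/-- The commutation relation of the two vertex operators. -/
lemma jing_dual_mul (r : K) (a b : ℤ) (v : Sym K)
    (h : ∀ i : ℤ, 0 < i → jing r (-1) (b + i) v = 0) :
    jing r (-1) b (jing r 1 (-a) v) =
      MvPolynomial.C (1 - r) * (if a = b then v else 0) +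
        MvPolynomial.C r * jing r 1 (-a) (jing r (-1) b v) := by
  set E := hlSeries r 1
  set E' := hlSeries r (-1)
  set W := (shift symDeg (fun _ => -1) v).map (shiftHom symDeg fun _ => (1 : K)) with hW
  set g := coeffZ ((dualContraction r).map (MvPolynomial.C : K →+* Sym K)) with hg
  -- These are the normally ordered terms common to both orders of the product; one order weights
  -- them by g(k) and the other by g(-i - k).
  set F : ℤ → Sym K := fun k => nord E' E (b - a - (k - a)) (k - a) W with hF
  have hFs : (Function.support F).Finite := by
    have h1 := finite_nord_line E' E (b - a) W
    exact (h1.preimage (f := fun k : ℤ => k - a) (fun x _ y _ hxy => by simpa using hxy))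
  have h1 : jing r (-1) b (jing r 1 (-a) v) = ∑ᶠ k, g k * F k := by
    rw [jing_apply, jing_apply, neg_neg]
    have h2 := pair_map_pair' E' E (shiftHom symDeg fun _ => (1 : K)) _
      (map_shift_hlSeries r 1 (by ring)) b (-a) (shift symDeg (fun _ => -1) v)
    rw [RingHom.coe_coe] at h2
    rw [h2, ← finsum_comp_equiv (Equiv.subRight a)]
    refine finsum_congr fun k => ?_
    simp only [hF, hg, Equiv.subRight_apply, sub_neg_eq_add, sub_add_cancel, ← sub_eq_add_neg]
    rfl
  have h3 : ∀ i : ℤ, jing r 1 (-(a + i)) (jing r (-1) (b + i) v) = ∑ᶠ k, g (-i - k) * F k := by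
    intro i
    rw [jing_apply, jing_apply, neg_neg]
    have h2 := pair_map_pair' E E' (shiftHom symDeg fun _ => (-1 : K)) _
      (map_shift_hlSeries r (-1) (by ring)) (-(a + i)) (b + i) (shift symDeg (fun _ => 1) v)
    rw [RingHom.coe_coe] at h2
    rw [h2, ← swap_map_shift, ← finsum_comp_equiv (Equiv.subLeft b)]
    refine finsum_congr fun k => ?_
    rw [nord_swap]
    simp only [hF, hg, Equiv.subLeft_apply]
    have e1 : b - k - (b + i) = -i - k := by ring
    have e2 : b - a - (k - a) = b - k := by ring
    have e3 : -(a + i) + (b + i) - (b - k) = k - a := by ring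
    rw [e1, e2, e3]
  have h4 : ∑ᶠ k, F k = if a = b then v else 0 := by
    have h5 := finsum_nord E' E (b - a) W
    rw [← finsum_comp_equiv (Equiv.subRight a)] at h5
    simp only [Equiv.subRight_apply] at h5
    rw [hF, h5, hW, eval_map_shift]
    -- Creation and annihilation exponents of the two operators are opposite, so the normally
    -- ordered product is the identity at z₁ = z₂; this is the delta term.
    have hE : E' * E = 1 := by
      have h6 := (isExp_hlSeries r (-1)).mul (isExp_hlSeries r 1)
      rw [← ogf_add] at h6
      have h7 : ogf (fun m => jingExp r (-1) m + jingExp r 1 m) = 0 := by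
        refine ogf_ext (by simp) fun m => ?_
        simp [coeff_ogf, jingExp]
      rw [h7] at h6
      exact h6.unique K isExp_zero
    have h8 : (fun _ : ℕ+ => (1 : K) + -1) = 0 := by funext; simp
    rw [hE, h8, shift_zero, pair_C, neg_sub]
    split_ifs with hab
    · simp [hab, coeffZ]
    · have : coeffZ (1 : PowerSeries (Sym K)) (a - b) = 0 := by
        unfold coeffZ
        split_ifs with hc
        · rw [PowerSeries.coeff_one, if_neg (by omega)]
        · rfl
      rw [this, zero_mul]
  have h0 := h3 0
  simp only [add_zero, neg_zero, zero_sub] at h0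
  rw [h1, finsum_contraction g (MvPolynomial.C r) (fun i hi => coeffZ_of_neg _ hi)
    (by rw [hg, coeffZ_map, coeffZ_dualContraction_zero, map_one])
    (fun i hi => by rw [hg, coeffZ_map, coeffZ_dualContraction_of_pos _ hi, map_sub, map_one])
    F hFs (fun i hi => by rw [← h3, h i hi, map_zero]), h4, h0, map_sub, map_one]

end Jing
end Crystal
namespace Crystal
open Finset

/-! ### Orthogonality of the Hall–Littlewood functions -/

section Orthogonality
variable {K : Type*} [Field K]

/-- The vector `J_{-k₁} J_{-k₂} ⋯ 1`. -/
noncomputable def jingVec (r : K) (l : List ℕ) : Sym K :=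
  l.foldr (fun (k : ℕ) v => jing r 1 (-(k : ℤ)) v) 1

@[simp] lemma jingVec_nil (r : K) : jingVec r [] = 1 := rfl

@[simp] lemma jingVec_cons (r : K) (k : ℕ) (l : List ℕ) :
    jingVec r (k :: l) = jing r 1 (-(k : ℤ)) (jingVec r l) := rfl

/-- The square norms of the vectors `jingVec`. -/
def listNorm (r : K) : List ℕ → K
  | [] => 1
  | k :: l => (1 - r ^ (l.count k + 1)) * listNorm r l

variable [CharZero K] {r : K}

/-- The dual mode passes every J_{-k} with k < b, without delta term, and finally kills 1. The
hypothesis of `jing_dual_mul` holds inductively, as b + i also exceeds all entries. -/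
lemma dual_jingVec_eq_zero (b : ℤ) (hb : 0 < b) (l : List ℕ) (h : ∀ k ∈ l, (k : ℤ) < b) :
    jing r (-1) b (jingVec r l) = 0 := by
  induction l generalizing b with
  | nil => rw [jingVec_nil, jing_one, coeffZ_of_neg _ (by omega)]
  | cons k l ih =>
    have h1 : ∀ i : ℤ, 0 ≤ i → jing r (-1) (b + i) (jingVec r l) = 0 := fun i hi =>
      ih (b + i) (by omega) fun j hj => by have := h j (by simp [hj]); omega
    have h2 := h k (by simp)
    rw [jingVec_cons, jing_dual_mul r k b _ fun i hi => h1 i hi.le, if_neg (by omega)]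
    have h3 := h1 0 le_rfl
    rw [add_zero] at h3
    rw [h3, map_zero, mul_zero, mul_zero, add_zero]

/-- Each further copy of k replaces the factor 1 - r^c by (1 - r) + r(1 - r^c) = 1 - r^{c+1}; these
factors build up b_λ. -/
lemma dual_jingVec_cons (k : ℕ) (hk : 0 < k) (l : List ℕ) (hl : l.Pairwise (· ≥ ·))
    (h : ∀ j ∈ l, j ≤ k) : jing r (-1) k (jingVec r (k :: l)) =
      MvPolynomial.C (1 - r ^ (l.count k + 1)) * jingVec r l := by
  induction l with
  | nil =>
    rw [jingVec_cons, jing_dual_mul r k k _ fun i hi => dual_jingVec_eq_zero _ (by omega) _ (by simp),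
      if_pos rfl, dual_jingVec_eq_zero _ (by omega) _ (by simp)]
    simp
  | cons j l ih =>
    rw [jingVec_cons, jing_dual_mul r k k _ fun i hi => dual_jingVec_eq_zero _ (by omega) _
      fun x hx => by have := h x hx; omega, if_pos rfl]
    rcases (h j (by simp)).lt_or_eq with hj | rfl
    · have h1 : ∀ x ∈ j :: l, x < k := by
        intro x hx
        rcases List.mem_cons.1 hx with rfl | hx
        · exact hj
        · exact lt_of_le_of_lt ((List.pairwise_cons.1 hl).1 x hx) hj
      rw [dual_jingVec_eq_zero _ (by omega) _ fun x hx => by exact_mod_cast h1 x hx,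
        List.count_eq_zero_of_not_mem fun hk => lt_irrefl _ (h1 k hk)]
      simp
    · rw [ih (List.pairwise_cons.1 hl).2 fun x hx => h x (by simp [hx]), List.count_cons_self,
        ← MvPolynomial.smul_eq_C_mul (jingVec r l), map_smul, ← jingVec_cons,
        MvPolynomial.smul_eq_C_mul, ← mul_assoc, ← map_mul, ← add_mul, ← map_add]
      congr 2
      ring

lemma formQT_jingVec_cons (hr : ∀ n : ℕ, 0 < n → r ^ n ≠ 1) (k : ℕ) (l : List ℕ) (f : Sym K) :
    formQT 0 r (jingVec r (k :: l)) f = formQT 0 r (jingVec r l) (jing r (-1) k f) :=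
  formQT_jing hr 1 k _ _

/-- The larger of the two first entries is moved to the other side, where its dual mode kills the
vector; equal first entries are stripped off. -/
lemma formQT_jingVec (hr : ∀ n : ℕ, 0 < n → r ^ n ≠ 1) (l m : List ℕ)
    (hl : l.Pairwise (· ≥ ·)) (hm : m.Pairwise (· ≥ ·)) (hl0 : ∀ k ∈ l, 0 < k)
    (hm0 : ∀ k ∈ m, 0 < k) :
    formQT 0 r (jingVec r l) (jingVec r m) = if l = m then listNorm r l else 0 := by
  induction l generalizing m with
  | nil =>
    cases m with
    | nil => simp [formQT_one, listNorm]
    | cons c m =>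
      rw [formQT_comm, formQT_jingVec_cons hr,
        dual_jingVec_eq_zero _ (by exact_mod_cast hm0 c (by simp)) _ (by simp), map_zero]
      simp
  | cons a l ih =>
    have ha := hl0 a (by simp)
    have hl' := List.pairwise_cons.1 hl
    cases m with
    | nil =>
      rw [formQT_jingVec_cons hr, dual_jingVec_eq_zero _ (by exact_mod_cast ha) _ (by simp),
        map_zero]
      simp
    | cons c m =>
      have hm' := List.pairwise_cons.1 hm
      rcases lt_trichotomy a c with h | rfl | h
      · rw [formQT_comm, formQT_jingVec_cons hr, dual_jingVec_eq_zero _ (by omega), map_zero, if_neg]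
        · simp [h.ne]
        · intro k hk
          rcases List.mem_cons.1 hk with rfl | hk
          · exact_mod_cast h
          · have := hl'.1 k hk; omega
      · rw [formQT_jingVec_cons hr, dual_jingVec_cons _ ha m hm'.2 hm'.1,
          ← MvPolynomial.smul_eq_C_mul, map_smul, ih m hl'.2 hm'.2 (fun k hk => hl0 k (by simp [hk]))
          fun k hk => hm0 k (by simp [hk])]
        by_cases hlm : l = m
        · subst hlm; simp [listNorm]
        · simp [hlm]
      · rw [formQT_jingVec_cons hr, dual_jingVec_eq_zero _ (by omega), map_zero, if_neg]
        · simp [h.ne']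
        · intro k hk
          rcases List.mem_cons.1 hk with rfl | hk
          · exact_mod_cast h
          · have := hm'.1 k hk; omega

end Orthogonality

/-! ### The norms b_λ, and partitions as decreasing lists. -/

section BFactor
variable {K : Type*} [Field K]

lemma prod_count_cons (r : K) (a : ℕ) (s : Multiset ℕ) :
    ∏ i ∈ (a ::ₘ s).toFinset, ∏ k ∈ Icc 1 ((a ::ₘ s).count i), (1 - r ^ k) =
      (1 - r ^ (s.count a + 1)) *
        ∏ i ∈ s.toFinset, ∏ k ∈ Icc 1 (s.count i), (1 - r ^ k) := by
  have h1 : ∏ i ∈ s.toFinset, ∏ k ∈ Icc 1 (s.count i), (1 - r ^ k) =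
      ∏ i ∈ (a ::ₘ s).toFinset, ∏ k ∈ Icc 1 (s.count i), (1 - r ^ k) := by
    refine Finset.prod_subset (fun x hx => by simp at hx ⊢; exact Or.inr hx) fun x _ hx => ?_
    rw [Multiset.count_eq_zero_of_notMem (by simpa using hx)]
    simp
  have ha : a ∈ (a ::ₘ s).toFinset := by simp
  rw [h1, ← Finset.mul_prod_erase _ _ ha, ← Finset.mul_prod_erase _ _ ha, Multiset.count_cons_self,
    Finset.prod_Icc_succ_top (by omega), ← mul_assoc, mul_comm (∏ k ∈ _, _) (1 - _)]
  congr 1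
  refine Finset.prod_congr rfl fun x hx => ?_
  rw [Multiset.count_cons_of_ne (Finset.ne_of_mem_erase hx)]

lemma listNorm_eq (r : K) (l : List ℕ) : listNorm r l =
    ∏ i ∈ (l : Multiset ℕ).toFinset, ∏ k ∈ Icc 1 ((l : Multiset ℕ).count i), (1 - r ^ k) := by
  induction l with
  | nil => simp [listNorm]
  | cons a l ih =>
    rw [listNorm, ih, ← Multiset.cons_coe, prod_count_cons, Multiset.coe_count]

lemma coe_rows (l : Ptn) : (l.rows : Multiset ℕ) = l.2.parts := Multiset.sort_eq _ _

lemma pairwise_rows (l : Ptn) : l.rows.Pairwise (· ≥ ·) := Multiset.pairwise_sort _ _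

lemma rows_pos (l : Ptn) (k : ℕ) (hk : k ∈ l.rows) : 0 < k := by
  refine l.2.parts_pos ?_
  rw [← coe_rows]
  exact hk

lemma length_rows (l : Ptn) : l.rows.length = l.len := by
  rw [Ptn.len, ← coe_rows, Multiset.coe_card]

lemma sum_rows (l : Ptn) : l.rows.sum = l.1 := by
  rw [← Multiset.sum_coe, coe_rows, l.2.parts_sum]

lemma rows_injective : Function.Injective Ptn.rows := by
  rintro ⟨n, l⟩ ⟨m, l'⟩ h
  have h1 := sum_rows ⟨n, l⟩
  have h2 := sum_rows ⟨m, l'⟩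
  rw [h] at h1
  obtain rfl : n = m := h1.symm.trans h2
  have h3 : l.parts = l'.parts := by
    rw [← coe_rows ⟨n, l⟩, ← coe_rows ⟨n, l'⟩, h]
  rw [Nat.Partition.ext h3]

lemma listNorm_rows (r : K) (l : Ptn) : listNorm r l.rows = bFactor r l := by
  rw [listNorm_eq, coe_rows, bFactor]

lemma bFactor_ne_zero {r : K} (hr : ∀ n : ℕ, 0 < n → r ^ n ≠ 1) (l : Ptn) : bFactor r l ≠ 0 := by
  refine Finset.prod_ne_zero_iff.2 fun i _ => Finset.prod_ne_zero_iff.2 fun k hk => ?_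
  exact sub_ne_zero.2 (hr k (by simp at hk; omega)).symm

variable [CharZero K] {r : K}

lemma formQT_jingVec_rows (hr : ∀ n : ℕ, 0 < n → r ^ n ≠ 1) (l m : Ptn) :
    formQT 0 r (jingVec r l.rows) (jingVec r m.rows) = if l = m then bFactor r l else 0 := by
  rw [formQT_jingVec hr _ _ (pairwise_rows l) (pairwise_rows m) (rows_pos l) (rows_pos m),
    listNorm_rows]
  simp only [rows_injective.eq_iff]

end BFactor
end Crystal
namespace Crystal
open Finset

/-! ### Triangularity -/

section Triangularity
variable {K : Type*} [Field K]

/-- The function `q_k`, the coefficient of `z^k` in `exp (∑ (1 - r^m) / m p_m z^m)`. -/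
noncomputable def hlq (r : K) (k : ℕ) : Sym K := PowerSeries.coeff k (hlSeries r 1)

variable (r : K)

/-- The products `q_{k₁} q_{k₂} ⋯`. -/
noncomputable def qprod (s : Multiset ℕ) : Sym K := (s.map (hlq r)).prod

lemma qprod_add (s s' : Multiset ℕ) : qprod r (s + s') = qprod r s * qprod r s' := by
  simp [qprod]

lemma qprod_cons (k : ℕ) (s : Multiset ℕ) : qprod r (k ::ₘ s) = hlq r k * qprod r s := by
  simp [qprod]

variable [CharZero K]

lemma hlq_zero : hlq r 0 = 1 := (isExp_hlSeries r 1).1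

lemma shift_hlq (m : ℕ) : shift symDeg (fun _ => (-1 : K)) (hlq r m) =
    ∑ x ∈ antidiagonal m, Polynomial.C (hlq r x.1) *
      (Polynomial.C (MvPolynomial.C (PowerSeries.coeff x.2
        (expSeries K (ogf fun m => -hlCoeff r m)))) * Polynomial.X ^ x.2) := by
  have h := map_shift_exp symDeg K (fun _ => (-1 : K)) (isExp_hlSeries r 1)
    (isExp_expSeries K fun m => -hlCoeff r m) (fun m => by
      simp only [jingExp, map_mul, shift_C, shift_X, symDeg, one_mul, map_neg, map_one]
      ring)
  have h2 := congrArg (PowerSeries.coeff m) h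
  rw [PowerSeries.coeff_map, PowerSeries.coeff_mul] at h2
  refine h2.trans (Finset.sum_congr rfl fun x _ => ?_)
  rw [PowerSeries.coeff_map, PowerSeries.coeff_mk]
  rfl

/-- Translating q_m lowers its index by j at the price of T^j, which raises the mode to n + j. This
is the source of the raising operators in `Raises`. -/
lemma jing_hlq_mul (n : ℤ) (m : ℕ) (f : Sym K) : jing r 1 (-n) (hlq r m * f) =
    ∑ x ∈ antidiagonal m, PowerSeries.coeff x.2 (expSeries K (ogf fun m => -hlCoeff r m)) •
      (hlq r x.1 * jing r 1 (-(n + x.2)) f) := by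
  rw [jing_apply, map_mul, shift_hlq, Finset.sum_mul, map_sum]
  refine Finset.sum_congr rfl fun x _ => ?_
  rw [mul_assoc, mul_assoc, pair_C_mul, pair_C_mul, pair_X_pow_mul, jing_apply,
    MvPolynomial.smul_eq_C_mul]
  have : -n - (x.2 : ℤ) = -(n + x.2) := by ring
  rw [this]
  ring

lemma qprod_filter (s : Multiset ℕ) : qprod r (s.filter (0 < ·)) = qprod r s := by
  induction s using Multiset.induction with
  | empty => rfl
  | cons a s ih =>
    rcases Nat.eq_zero_or_pos a with rfl | (h : 0 < a)
    · rw [Multiset.filter_cons_of_neg (p := (0 < ·)) _ (lt_irrefl 0), ih, qprod_cons, hlq_zero, one_mul]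
    · rw [Multiset.filter_cons_of_pos (p := (0 < ·)) _ h, qprod_cons, qprod_cons, ih]

/-- The lists obtained from `n :: M` by raising the first entry at the cost of the others. -/
def Raises (n : ℕ) (M L : List ℕ) : Prop :=
  ∃ a B, L = a :: B ∧ n < a ∧ List.Forall₂ (· ≤ ·) B M ∧ a + B.sum = n + M.sum

lemma jing_qprod (n : ℕ) (M : List ℕ) : jing r 1 (-(n : ℤ)) (qprod r M) - qprod r ↑(n :: M) ∈
    Submodule.span K ((fun L : List ℕ => qprod r L) '' {L | Raises n M L}) := by
  induction M generalizing n with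
  | nil =>
    have h : qprod r ↑([] : List ℕ) = 1 := rfl
    rw [h, jing_one, neg_neg, coeffZ_natCast, ← Multiset.cons_coe, qprod_cons, h, mul_one, hlq,
      sub_self]
    exact Submodule.zero_mem _
  | cons m M ih =>
    set c := fun i => PowerSeries.coeff i (expSeries K (ogf fun m => -hlCoeff r m)) with hc
    have hmul : ∀ (i j : ℕ), i + j = m → ∀ v ∈ Submodule.span K
        ((fun L : List ℕ => qprod r L) '' {L | Raises (n + j) M L}),
        hlq r i * v ∈ Submodule.span K
        ((fun L : List ℕ => qprod r L) '' {L | Raises n (m :: M) L}) := by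
      intro i j hij v hv
      induction hv using Submodule.span_induction with
      | mem v hv =>
        obtain ⟨_, ⟨a, B, rfl, ha, hB, hs⟩, rfl⟩ := hv
        refine Submodule.subset_span ⟨a :: i :: B, ⟨a, i :: B, rfl, by omega,
          List.Forall₂.cons (by omega) hB, ?_⟩, ?_⟩
        · simp only [List.sum_cons]; omega
        · simp only [← Multiset.cons_coe, qprod_cons]; ring
      | zero => rw [mul_zero]; exact Submodule.zero_mem _
      | add x y _ _ hx hy => rw [mul_add]; exact Submodule.add_mem _ hx hy
      | smul a x _ hx => rw [mul_smul_comm]; exact Submodule.smul_mem _ _ hx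
    have hmul' : ∀ (i j : ℕ), i + j = m → 0 < j → hlq r i * jing r 1 (-((n : ℤ) + j)) (qprod r M) ∈
        Submodule.span K ((fun L : List ℕ => qprod r L) '' {L | Raises n (m :: M) L}) := by
      intro i j hij hj
      have h1 := hmul i j hij _ (ih (n + j))
      rw [mul_sub] at h1
      have h2 : hlq r i * qprod r ↑((n + j) :: M) ∈ Submodule.span K
          ((fun L : List ℕ => qprod r L) '' {L | Raises n (m :: M) L}) := by
        refine Submodule.subset_span ⟨(n + j) :: i :: M, ⟨n + j, i :: M, rfl, by omega,
          List.Forall₂.cons (by omega) (List.forall₂_same.2 fun _ _ => le_rfl), ?_⟩, ?_⟩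
        · simp only [List.sum_cons]; omega
        · simp only [← Multiset.cons_coe, qprod_cons]; ring
      have h3 := Submodule.add_mem _ h1 h2
      rw [sub_add_cancel] at h3
      rwa [Nat.cast_add] at h3
    have h0 : qprod r ↑(m :: M) = hlq r m * qprod r M := by rw [← Multiset.cons_coe, qprod_cons]
    have h4 : qprod r ↑(n :: m :: M) = hlq r m * qprod r ↑(n :: M) := by
      simp only [← Multiset.cons_coe, qprod_cons]; ring
    have h5 := hmul m 0 rfl _ (ih n)
    rw [mul_sub, ← h4] at h5
    have hmem : ((m, 0) : ℕ × ℕ) ∈ antidiagonal m := by simp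
    rw [h0, jing_hlq_mul, ← Finset.add_sum_erase _ _ hmem]
    have hc0 : PowerSeries.coeff 0 (expSeries K (ogf fun m => -hlCoeff r m)) = 1 :=
      (isExp_expSeries K _).1
    simp only [hc0, one_smul, Nat.cast_zero, add_zero]
    rw [add_sub_right_comm]
    refine Submodule.add_mem _ h5 (Submodule.sum_mem _ fun x hx => Submodule.smul_mem _ _ ?_)
    have hx' := Finset.mem_erase.1 hx
    have hx2 := mem_antidiagonal.1 hx'.2
    refine hmul' x.1 x.2 hx2 (Nat.pos_of_ne_zero fun h => hx'.1 ?_)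
    ext <;> simp <;> omega

/-- The sum of the `k` largest elements. -/
def topSum (s : Multiset ℕ) (k : ℕ) : ℕ := ((s.sort (fun a b => b ≤ a)).take k).sum

lemma sum_le_sum_take (L : List ℕ) (hL : L.Pairwise (· ≥ ·)) (u : Multiset ℕ) (k : ℕ)
    (hu : u ≤ (L : Multiset ℕ)) (hk : u.card ≤ k) : u.sum ≤ (L.take k).sum := by
  induction L generalizing u k with
  | nil =>
    have : u = 0 := Multiset.le_zero.1 hu
    simp [this]
  | cons a L ih =>
    have hL' := List.pairwise_cons.1 hL
    rcases k with _ | k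
    · have : u = 0 := Multiset.card_eq_zero.1 (by omega)
      simp [this]
    · rw [List.take_succ_cons, List.sum_cons]
      by_cases ha : a ∈ u
      · obtain ⟨v, rfl⟩ := Multiset.exists_cons_of_mem ha
        rw [← Multiset.cons_coe, Multiset.cons_le_cons_iff] at hu
        rw [Multiset.sum_cons]
        rw [Multiset.card_cons] at hk
        exact Nat.add_le_add_left (ih hL'.2 v k hu (by omega)) a
      · rw [← Multiset.cons_coe, Multiset.le_cons_of_notMem ha] at hu
        rcases Multiset.empty_or_exists_mem u with rfl | ⟨b, hb⟩
        · simp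
        · obtain ⟨v, rfl⟩ := Multiset.exists_cons_of_mem hb
          have hba : b ≤ a := hL'.1 b (by simpa using Multiset.mem_of_le hu hb)
          rw [Multiset.sum_cons]
          rw [Multiset.card_cons] at hk
          exact Nat.add_le_add hba (ih hL'.2 v k ((Multiset.le_cons_self v b).trans hu) (by omega))

lemma sum_le_topSum {s u : Multiset ℕ} {k : ℕ} (hu : u ≤ s) (hk : u.card ≤ k) :
    u.sum ≤ topSum s k :=
  sum_le_sum_take _ (Multiset.pairwise_sort _ _) u k (by rwa [Multiset.sort_eq]) hk

/-- The multiset `s` of positive integers dominates the list `L`. -/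
def DominatesList (s : Multiset ℕ) (L : List ℕ) : Prop :=
  0 ∉ s ∧ s.sum = L.sum ∧ ∀ k, (L.take k).sum ≤ topSum s k

lemma DominatesList.cons {s : Multiset ℕ} {M : List ℕ} (h : DominatesList s M) {n : ℕ}
    (hn : 0 < n) : DominatesList (n ::ₘ s) (n :: M) := by
  obtain ⟨h0, h1, h2⟩ := h
  refine ⟨by simp [h0, hn.ne], by simp [h1], fun k => ?_⟩
  rcases k with _ | k
  · simp
  · have h3 : (n ::ₘ ((s.sort (fun a b => b ≤ a)).take k : Multiset ℕ)).sum ≤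
        topSum (n ::ₘ s) (k + 1) := by
      refine sum_le_topSum (Multiset.cons_le_cons _ ?_) (by simp)
      conv_rhs => rw [← Multiset.sort_eq s (fun a b => b ≤ a)]
      exact Multiset.coe_le.2 (List.take_sublist _ _).subperm
    rw [Multiset.sum_cons, Multiset.sum_coe] at h3
    rw [List.take_succ_cons, List.sum_cons]
    exact (Nat.add_le_add_left (h2 k) n).trans h3

lemma sum_filter_pos (s : Multiset ℕ) : (s.filter (0 < ·)).sum = s.sum := by
  induction s using Multiset.induction with
  | empty => rfl
  | cons a s ih =>
    rcases Nat.eq_zero_or_pos a with rfl | (h : 0 < a)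
    · rw [Multiset.filter_cons_of_neg (p := (0 < ·)) _ (lt_irrefl 0), ih, Multiset.sum_cons,
        zero_add]
    · rw [Multiset.filter_cons_of_pos (p := (0 < ·)) _ h, Multiset.sum_cons, Multiset.sum_cons, ih]

/-- The total is preserved while all entries after the first decrease, so tails shrink and initial
sums grow. Zero entries may be discarded since q_0 = 1. -/
lemma Raises.dominatesList {n : ℕ} {s : Multiset ℕ} {M L : List ℕ} (h : DominatesList s M)
    (hL : Raises n (s.sort (fun a b => b ≤ a)) L) :
    DominatesList ((L : Multiset ℕ).filter (0 < ·)) (n :: M) := by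
  obtain ⟨a, B, rfl, ha, hB, hs⟩ := hL
  obtain ⟨h0, h1, h2⟩ := h
  have h4 : (s.sort (fun a b => b ≤ a)).sum = s.sum := by
    rw [← Multiset.sum_coe, Multiset.sort_eq]
  refine ⟨by simp, ?_, fun k => ?_⟩
  · rw [sum_filter_pos, Multiset.sum_coe, List.sum_cons, List.sum_cons, hs, h4, h1]
  · rcases k with _ | k
    · simp
    · have h5 : (((a :: B.take k : List ℕ) : Multiset ℕ).filter (0 < ·)).sum ≤
          topSum (((a :: B : List ℕ) : Multiset ℕ).filter (0 < ·)) (k + 1) := by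
        refine sum_le_topSum (Multiset.filter_le_filter _ (Multiset.coe_le.2
          ((List.take_sublist k B).cons_cons a).subperm)) ?_
        refine (Multiset.card_le_card (Multiset.filter_le _ _)).trans ?_
        simp
      rw [sum_filter_pos, Multiset.sum_coe, List.sum_cons] at h5
      refine le_trans ?_ h5
      rw [List.take_succ_cons, List.sum_cons]
      have h6 := (List.forall₂_drop k hB).sum_le_sum
      have h7 := List.sum_take_add_sum_drop B k
      have h8 := List.sum_take_add_sum_drop (s.sort (fun a b => b ≤ a)) k
      have h9 := h2 k
      unfold topSum at h9
      omega

lemma jingVec_sub_qprod (L : List ℕ) (hL : L.Pairwise (· ≥ ·)) (h0 : ∀ k ∈ L, 0 < k) :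
    jingVec r L - qprod r L ∈
      Submodule.span K (qprod r '' {s | DominatesList s L ∧ s ≠ L}) := by
  induction L with
  | nil => simp [qprod]
  | cons n M ih =>
    have hL' := List.pairwise_cons.1 hL
    have hn : 0 < n := h0 n (by simp)
    have key : ∀ s, DominatesList s M → jing r 1 (-(n : ℤ)) (qprod r s) - qprod r (n ::ₘ s) ∈
        Submodule.span K (qprod r '' {s | DominatesList s (n :: M) ∧ s ≠ ↑(n :: M)}) := by
      intro s hs
      have h1 := jing_qprod r n (s.sort (fun a b => b ≤ a))
      rw [← Multiset.cons_coe, Multiset.sort_eq] at h1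
      refine Submodule.span_mono ?_ h1
      rintro _ ⟨L', hL', rfl⟩
      refine ⟨_, ⟨Raises.dominatesList hs hL', fun h => ?_⟩, qprod_filter r _⟩
      -- Strictness: a raised list contains an entry a > n, whereas n is the largest entry of n ::
      -- M.
      obtain ⟨a, B, rfl, ha, -, -⟩ := hL'
      have h2 : a ∈ (n :: M : List ℕ) := by
        rw [← Multiset.mem_coe, ← h]
        simp; omega
      rcases List.mem_cons.1 h2 with rfl | h2
      · exact lt_irrefl _ ha
      · have := hL'.1 a h2; omega
    have hspan : ∀ v ∈ Submodule.span K (qprod r '' {s | DominatesList s M ∧ s ≠ M}),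
        jing r 1 (-(n : ℤ)) v ∈
        Submodule.span K (qprod r '' {s | DominatesList s (n :: M) ∧ s ≠ ↑(n :: M)}) := by
      intro v hv
      induction hv using Submodule.span_induction with
      | mem v hv =>
        obtain ⟨s, ⟨hs, hs'⟩, rfl⟩ := hv
        have h1 := Submodule.add_mem _ (key s hs) (Submodule.subset_span
          ⟨n ::ₘ s, ⟨hs.cons hn, by rwa [← Multiset.cons_coe, Ne, Multiset.cons_inj_right]⟩, rfl⟩)
        rwa [sub_add_cancel] at h1
      | zero => rw [map_zero]; exact Submodule.zero_mem _
      | add x y _ _ hx hy => rw [map_add]; exact Submodule.add_mem _ hx hy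
      | smul a x _ hx => rw [map_smul]; exact Submodule.smul_mem _ _ hx
    have hM : DominatesList (M : Multiset ℕ) M := by
      refine ⟨fun h => ?_, by simp, fun k => ?_⟩
      · have := h0 0 (by simp only [Multiset.mem_coe] at h; simp [h])
        omega
      · rw [← Multiset.sum_coe]
        exact sum_le_topSum (Multiset.coe_le.2 (List.take_sublist _ _).subperm) (by simp)
    have h2 := Submodule.add_mem _ (hspan _ (ih hL'.2 fun k hk => h0 k (by simp [hk])))
      (key M hM)
    rw [map_sub, sub_add_sub_cancel, ← jingVec_cons] at h2
    exact h2

end Triangularity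
end Crystal
namespace Crystal
open Finset

/-! ### The dominance order -/

section Dominance

lemma Dominates.refl {n : ℕ} (l : n.Partition) : Dominates l l := fun _ => le_rfl

lemma Dominates.trans {n : ℕ} {l m k : n.Partition} (h : Dominates l m) (h' : Dominates m k) :
    Dominates l k := fun i => (h' i).trans (h i)

lemma eq_of_sum_take_eq {L M : List ℕ} (hL : ∀ k ∈ L, 0 < k) (hM : ∀ k ∈ M, 0 < k)
    (h : ∀ k, (L.take k).sum = (M.take k).sum) : L = M := by
  induction L generalizing M with
  | nil =>
    cases M with
    | nil => rfl
    | cons b M =>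
      have h1 := h 1
      have := hM b (by simp)
      simp at h1
      omega
  | cons a L ih =>
    cases M with
    | nil =>
      have h1 := h 1
      have := hL a (by simp)
      simp at h1
      omega
    | cons b M =>
      have h1 := h 1
      simp only [List.take_succ_cons, List.take_zero, List.sum_cons, List.sum_nil, add_zero] at h1
      subst h1
      congr 1
      refine ih (fun k hk => hL k (by simp [hk])) (fun k hk => hM k (by simp [hk])) fun k => ?_
      have h2 := h (k + 1)
      simpa using h2

lemma Dominates.antisymm {n : ℕ} {l m : n.Partition} (h : Dominates l m) (h' : Dominates m l) :
    l = m := by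
  have h1 := eq_of_sum_take_eq (rows_pos ⟨n, l⟩) (rows_pos ⟨n, m⟩) fun k => (h' k).antisymm (h k)
  exact eq_of_heq (Sigma.mk.inj (rows_injective h1)).2

/-- The strict dominance order. -/
def StrictDom {n : ℕ} (l m : n.Partition) : Prop := Dominates l m ∧ m ≠ l

lemma StrictDom.trans {n : ℕ} {l m k : n.Partition} (h : StrictDom l m) (h' : StrictDom m k) :
    StrictDom l k :=
  ⟨h.1.trans h'.1, fun hk => h'.2 (Dominates.antisymm (by rw [hk]; exact h.1) h'.1)⟩

lemma wellFounded_strictDom (n : ℕ) : WellFounded (StrictDom (n := n)) := by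
  have : IsTrans n.Partition StrictDom := ⟨fun _ _ _ => StrictDom.trans⟩
  have : Std.Irrefl (StrictDom (n := n)) := ⟨fun _ h => h.2 rfl⟩
  exact Finite.wellFounded_of_trans_of_irrefl _

lemma wellFounded_strictDom_swap (n : ℕ) :
    WellFounded (fun l m : n.Partition => StrictDom m l) := by
  have : IsTrans n.Partition (fun l m => StrictDom m l) := ⟨fun _ _ _ h h' => h'.trans h⟩
  have : Std.Irrefl (fun l m : n.Partition => StrictDom m l) := ⟨fun _ h => h.2 rfl⟩
  exact Finite.wellFounded_of_trans_of_irrefl _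

/-- A unitriangular change of families can be inverted. -/
lemma sub_mem_span_of_triangular {K V ι : Type*} [Field K] [AddCommGroup V] [Module K V]
    {lt : ι → ι → Prop} (hwf : WellFounded lt) (htr : ∀ i j k, lt i j → lt j k → lt i k)
    {a b : ι → V} (h : ∀ i, a i - b i ∈ Submodule.span K (b '' {j | lt j i})) (i : ι) :
    b i - a i ∈ Submodule.span K (a '' {j | lt j i}) := by
  induction i using hwf.induction with
  | _ i ih =>
    rw [← neg_sub]
    refine Submodule.neg_mem _ (Submodule.span_le.2 ?_ (h i))
    rintro _ ⟨j, hj, rfl⟩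
    have h1 := Submodule.add_mem (Submodule.span K (a '' {j | lt j i}))
      (Submodule.span_mono (Set.image_mono fun k hk => htr k j i hk hj) (ih j hj))
      (Submodule.subset_span ⟨j, hj, rfl⟩)
    rwa [sub_add_cancel] at h1

end Dominance

/-! ### Spanning families and nondegeneracy of the form. -/

section Spanning
variable {K : Type*} [Field K] [CharZero K] (r : K)

lemma jingVec_rows_sub_qprod {n : ℕ} (l : n.Partition) :
    jingVec r (Ptn.rows ⟨n, l⟩) - qprod r l.parts ∈ Submodule.span K
      ((fun m : n.Partition => qprod r m.parts) '' {m | StrictDom m l}) := by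
  have h := jingVec_sub_qprod r (Ptn.rows ⟨n, l⟩) (pairwise_rows _) (rows_pos _)
  rw [coe_rows] at h
  refine Submodule.span_mono ?_ h
  rintro _ ⟨s, ⟨⟨h0, h1, h2⟩, hs⟩, rfl⟩
  rw [sum_rows] at h1
  refine ⟨⟨s, fun hi => Nat.pos_of_ne_zero fun h => h0 (h ▸ hi), h1⟩, ⟨h2, fun h => hs ?_⟩, rfl⟩
  rw [h]

lemma qprod_sub_jingVec_rows {n : ℕ} (l : n.Partition) :
    qprod r l.parts - jingVec r (Ptn.rows ⟨n, l⟩) ∈ Submodule.span K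
      ((fun m : n.Partition => jingVec r (Ptn.rows ⟨n, m⟩)) '' {m | StrictDom m l}) :=
  sub_mem_span_of_triangular (wellFounded_strictDom n) (fun _ _ _ => StrictDom.trans)
    (jingVec_rows_sub_qprod r) l

/-- The span is closed under products, and Newton's recursion m q_m = ∑ (1 - r^j) q_{m-j} p_j can be
solved for p_m since 1 - r^m ≠ 0. -/
lemma span_qprod (hr : ∀ n : ℕ, 0 < n → r ^ n ≠ 1) :
    Submodule.span K (Set.range (qprod r)) = ⊤ := by
  set S := Submodule.span K (Set.range (qprod r)) with hS
  have hmul : ∀ f ∈ S, ∀ g ∈ S, f * g ∈ S := by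
    intro f hf g hg
    have h1 := Submodule.mul_mem_mul hf hg
    rw [hS, Submodule.span_mul_span] at h1
    refine Submodule.span_mono ?_ h1
    rintro _ ⟨_, ⟨s, rfl⟩, _, ⟨s', rfl⟩, rfl⟩
    exact ⟨s + s', qprod_add r s s'⟩
  have hq : ∀ k, hlq r k ∈ S := fun k => Submodule.subset_span ⟨{k}, by simp [qprod]⟩
  have hX : ∀ m : ℕ+, (MvPolynomial.X m : Sym K) ∈ S := by
    intro m
    induction m using PNat.strongInductionOn with
    | _ m ih =>
      have h1 := (isExp_hlSeries r 1).coeff_rec m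
      have hmem : ((0, (m : ℕ)) : ℕ × ℕ) ∈ antidiagonal (m : ℕ) := by simp
      rw [← Finset.add_sum_erase _ _ hmem, (isExp_hlSeries r 1).1, one_mul, coeff_ogf,
        ← sub_eq_iff_eq_add] at h1
      have h3 : ((m : ℕ) : Sym K) * jingExp r 1 m = (1 - r ^ (m : ℕ)) • MvPolynomial.X m := by
        have : ((m : ℕ) : K) ≠ 0 := by exact_mod_cast m.ne_zero
        rw [jingExp, ← map_natCast (MvPolynomial.C : K →+* Sym K), ← mul_assoc, ← map_mul,
          MvPolynomial.smul_eq_C_mul]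
        congr 2
        simp only [hlCoeff]
        field_simp
      have h4 : (1 - r ^ (m : ℕ)) • (MvPolynomial.X m : Sym K) ∈ S := by
        rw [← h3, ← h1]
        refine Submodule.sub_mem _ ?_ (Submodule.sum_mem _ fun x hx => ?_)
        · rw [← nsmul_eq_mul]
          exact Submodule.smul_of_tower_mem S (m : ℕ) (hq m)
        · obtain ⟨i, j⟩ := x
          have hx' := Finset.mem_erase.1 hx
          have hx2 : i + j = m := mem_antidiagonal.1 hx'.2
          refine hmul _ (hq i) _ ?_
          rcases Nat.eq_zero_or_pos j with rfl | h0
          · rw [Nat.cast_zero, zero_mul]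
            exact Submodule.zero_mem _
          · lift j to ℕ+ using h0
            rw [coeff_ogf, ← nsmul_eq_mul, jingExp, ← MvPolynomial.smul_eq_C_mul]
            refine Submodule.smul_of_tower_mem S _ (Submodule.smul_mem _ _ (ih j ?_))
            refine PNat.coe_lt_coe _ _ |>.1 (lt_of_le_of_ne (by omega) fun h => hx'.1 ?_)
            ext <;> dsimp only <;> omega
      have h6 : 1 - r ^ (m : ℕ) ≠ 0 := sub_ne_zero.2 (hr m m.pos).symm
      exact (Submodule.smul_mem_iff _ h6).1 h4
  refine Submodule.eq_top_iff'.2 fun f => ?_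
  induction f using MvPolynomial.induction_on with
  | C a =>
    rw [← mul_one (MvPolynomial.C a), ← MvPolynomial.smul_eq_C_mul]
    exact Submodule.smul_mem _ _ (Submodule.subset_span ⟨0, rfl⟩)
  | add f g hf hg => exact Submodule.add_mem _ hf hg
  | mul_X f i hf => exact hmul f hf _ (hX i)

/-- The partition whose parts are the nonzero elements of a multiset. -/
def ptnOf (s : Multiset ℕ) : Ptn :=
  ⟨s.sum, ⟨s.filter (0 < ·), fun hi => (Multiset.mem_filter.1 hi).2, sum_filter_pos s⟩⟩

lemma qprod_ptnOf (s : Multiset ℕ) : qprod r (ptnOf s).2.parts = qprod r s := qprod_filter r s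

lemma span_jingVec_rows (hr : ∀ n : ℕ, 0 < n → r ^ n ≠ 1) :
    Submodule.span K (Set.range fun l : Ptn => jingVec r l.rows) = ⊤ := by
  rw [eq_top_iff, ← span_qprod r hr, Submodule.span_le]
  rintro _ ⟨s, rfl⟩
  have h := qprod_sub_jingVec_rows r (ptnOf s).2
  have h1 : Submodule.span K ((fun m : (ptnOf s).1.Partition => jingVec r (Ptn.rows ⟨_, m⟩)) ''
      {m | StrictDom m (ptnOf s).2}) ≤
      Submodule.span K (Set.range fun l : Ptn => jingVec r l.rows) := by
    refine Submodule.span_mono ?_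
    rintro _ ⟨m, -, rfl⟩
    exact ⟨⟨_, m⟩, rfl⟩
  have h2 := Submodule.add_mem _ (h1 h) (Submodule.subset_span ⟨ptnOf s, rfl⟩)
  rwa [sub_add_cancel, qprod_ptnOf] at h2

variable {r}

/-- By orthogonality a vector in the span of some of the `jingVec` pairs nontrivially only with
those; triangularity thus becomes vanishing of pairings. -/
lemma formQT_mem_span (hr : ∀ n : ℕ, 0 < n → r ^ n ≠ 1) {n : ℕ} (S : Set n.Partition) (f : Sym K)
    (hf : f ∈ Submodule.span K ((fun m : n.Partition => jingVec r (Ptn.rows ⟨n, m⟩)) '' S))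
    (l : Ptn) (h : formQT 0 r f (jingVec r l.rows) ≠ 0) : ∃ m ∈ S, l = ⟨n, m⟩ := by
  by_contra! hc
  refine h ?_
  induction hf using Submodule.span_induction with
  | mem v hv =>
    obtain ⟨m, hm, rfl⟩ := hv
    rw [formQT_jingVec_rows hr, if_neg fun h => hc m hm h.symm]
  | zero => simp
  | add x y _ _ hx hy =>
    by_cases h1 : formQT 0 r x (jingVec r l.rows) = 0
    · by_cases h2 : formQT 0 r y (jingVec r l.rows) = 0
      · simp [h1, h2]
      · exact absurd (hy h2) h2
    · exact absurd (hx h1) h1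
  | smul a x _ hx =>
    by_cases h1 : formQT 0 r x (jingVec r l.rows) = 0
    · simp [h1]
    · exact absurd (hx h1) h1

lemma formQT_qprod_self (hr : ∀ n : ℕ, 0 < n → r ^ n ≠ 1) (l : Ptn) :
    formQT 0 r (qprod r l.2.parts) (jingVec r l.rows) = bFactor r l := by
  have h := formQT_mem_span hr _ _ (qprod_sub_jingVec_rows r l.2) l
  have h0 : formQT 0 r (qprod r l.2.parts - jingVec r l.rows) (jingVec r l.rows) = 0 := by
    by_contra hc
    obtain ⟨m, hm, hl⟩ := h hc
    have : l.2 = m := eq_of_heq (Sigma.mk.inj hl).2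
    exact hm.2 this
  rw [map_sub, LinearMap.sub_apply, formQT_jingVec_rows hr, if_pos rfl, sub_eq_zero] at h0
  exact h0

lemma dominates_of_formQT_qprod_ne_zero (hr : ∀ n : ℕ, 0 < n → r ^ n ≠ 1) {n : ℕ}
    (m : n.Partition) (l : Ptn) (h : formQT 0 r (qprod r m.parts) (jingVec r l.rows) ≠ 0) :
    ∃ k : n.Partition, l = ⟨n, k⟩ ∧ Dominates k m := by
  have h1 : qprod r m.parts ∈ Submodule.span K
      ((fun m : n.Partition => jingVec r (Ptn.rows ⟨n, m⟩)) '' {k | Dominates k m}) := by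
    have h2 := Submodule.add_mem _ (Submodule.span_mono (Set.image_mono fun k hk => hk.1)
      (qprod_sub_jingVec_rows r m)) (Submodule.subset_span ⟨m, Dominates.refl m, rfl⟩)
    rwa [sub_add_cancel] at h2
  obtain ⟨k, hk, rfl⟩ := formQT_mem_span hr _ _ h1 l h
  exact ⟨k, rfl, hk⟩

lemma powerSumNorm_ne_zero (hr : ∀ n : ℕ, 0 < n → r ^ n ≠ 1) (d : ℕ+ →₀ ℕ) :
    powerSumNorm 0 r d ≠ 0 := by
  refine Finset.prod_ne_zero_iff.2 fun n _ => mul_ne_zero (mul_ne_zero (pow_ne_zero _ ?_) ?_)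
    (pow_ne_zero _ (div_ne_zero ?_ (sub_ne_zero.2 (hr n n.pos).symm)))
  · exact_mod_cast n.ne_zero
  · exact_mod_cast Nat.factorial_ne_zero _
  · simp [n.ne_zero]

lemma eq_zero_of_formQT (hr : ∀ n : ℕ, 0 < n → r ^ n ≠ 1) {s : Set (Sym K)}
    (hs : Submodule.span K s = ⊤) (f : Sym K) (h : ∀ g ∈ s, formQT 0 r g f = 0) : f = 0 := by
  have h1 : ∀ g, formQT 0 r g f = 0 := fun g => by
    have hg : g ∈ Submodule.span K s := hs ▸ Submodule.mem_top
    induction hg using Submodule.span_induction with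
    | mem v hv => exact h v hv
    | zero => simp
    | add x y _ _ hx hy => simp [hx, hy]
    | smul a x _ hx => simp [hx]
  ext d
  have h2 := h1 (MvPolynomial.monomial d 1)
  rw [formQT_monomial_left, one_mul] at h2
  simpa [powerSumNorm_ne_zero hr d] using h2

end Spanning
end Crystal
namespace Crystal
open Finset

/-! ### Coefficients in finitely many variables -/

section Variables
variable {K : Type*} [Field K]

/-- Separating one variable x replaces p_m by p_m + x^m, which is a translation. -/
lemma finSuccEquiv_toVars (N : ℕ) (f : Sym K) :
    MvPolynomial.finSuccEquiv K N (Sym.toVars (N + 1) f) =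
      (shift symDeg (fun _ => (1 : K)) f).map
        ((Sym.toVars N : Sym K →ₐ[K] _) : Sym K →+* MvPolynomial (Fin N) K) := by
  have h : (MvPolynomial.finSuccEquiv K N : _ →ₐ[K] _).comp (Sym.toVars (N + 1)) =
      (Polynomial.mapAlgHom (Sym.toVars N)).comp (shift symDeg (fun _ => (1 : K))) := by
    refine MvPolynomial.algHom_ext fun m => ?_
    simp [Sym.toVars, MvPolynomial.psum, Fin.sum_univ_succ, symDeg,
      MvPolynomial.finSuccEquiv_X_zero, MvPolynomial.finSuccEquiv_X_succ]
    ring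
  exact congrArg (fun φ => φ f) h

lemma toVars_zero (f : Sym K) :
    Sym.toVars 0 f = MvPolynomial.C (MvPolynomial.constantCoeff f) := by
  induction f using MvPolynomial.induction_on with
  | C a => rw [← MvPolynomial.algebraMap_eq, AlgHom.commutes]; simp [MvPolynomial.algebraMap_eq]
  | add f g hf hg => simp only [map_add, hf, hg]
  | mul_X f i hf => simp [Sym.toVars, MvPolynomial.psum]

variable [CharZero K] {r : K}

/-- The products q_μ are dual to the monomial functions. One variable is removed at a time: its
exponent k is read off by a translation, whose adjoint is multiplication by q_k. -/
lemma coeff_toVars (hr : ∀ n : ℕ, 0 < n → r ^ n ≠ 1) (N : ℕ) (α : Fin N →₀ ℕ) (f : Sym K) :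
    (Sym.toVars N f).coeff α = formQT 0 r (∏ i, hlq r (α i)) f := by
  induction N generalizing f with
  | zero =>
    rw [toVars_zero, Finset.univ_eq_empty, Finset.prod_empty, formQT_one, Subsingleton.elim α 0,
      MvPolynomial.coeff_zero_C]
  | succ N ih =>
    rw [← Finsupp.cons_tail α, ← MvPolynomial.finSuccEquiv_coeff_coeff, finSuccEquiv_toVars,
      Polynomial.coeff_map, Fin.prod_univ_succ, hlq, formQT_hlSeries_mul hr]
    simp only [Finsupp.cons_zero, Finsupp.cons_succ]
    exact ih _ _

lemma coeff_toVars_eq (hr : ∀ n : ℕ, 0 < n → r ^ n ≠ 1) (N : ℕ) (α : Fin N →₀ ℕ) (f : Sym K) :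
    (Sym.toVars N f).coeff α = formQT 0 r (qprod r (univ.val.map α)) f := by
  rw [coeff_toVars hr, qprod, Multiset.map_map]
  rfl

lemma toVars_injective (hr : ∀ n : ℕ, 0 < n → r ^ n ≠ 1) (f : Sym K)
    (h : ∀ N, Sym.toVars N f = 0) : f = 0 := by
  refine eq_zero_of_formQT hr (span_qprod r hr) f ?_
  rintro _ ⟨s, rfl⟩
  induction s using Quotient.inductionOn with
  | _ L =>
    have h1 := coeff_toVars_eq hr L.length (Finsupp.equivFunOnFinite.symm L.get) f
    rw [h, MvPolynomial.coeff_zero] at h1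
    have h2 : univ.val.map (Finsupp.equivFunOnFinite.symm L.get) = (L : Multiset ℕ) := by
      rw [Finsupp.coe_equivFunOnFinite_symm, Fin.univ_val_map, List.ofFn_get]
    rw [h2] at h1
    exact h1.symm

end Variables

/-! ### Coefficients of the monomial symmetric polynomials. -/

section Monomial

lemma Ptn.ext_parts {l m : Ptn} (h : l.2.parts = m.2.parts) : l = m := by
  refine rows_injective ?_
  rw [Ptn.rows, Ptn.rows, h]

lemma parts_ptnOf {N : ℕ} (α : Fin N →₀ ℕ) : (ptnOf (univ.val.map α)).2.parts =
    (Finsupp.toMultiset α).dedup.map (Finsupp.toMultiset α).count := by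
  have h1 : (Finsupp.toMultiset α).dedup = α.support.val := by
    rw [← Multiset.toFinset_val, Finsupp.toFinset_toMultiset]
  have h2 : α.support = univ.filter fun i => 0 < α i := by
    ext i; simp [Nat.pos_iff_ne_zero]
  have h3 : (Finsupp.toMultiset α).count = α := funext fun i => Finsupp.count_toMultiset α i
  rw [h1, h2, h3, Finset.filter_val]
  change Multiset.filter (0 < ·) (univ.val.map α) = _
  rw [Multiset.filter_map]
  rfl

lemma prod_map_X {K σ : Type*} [Field K] [DecidableEq σ] (s : Multiset σ) :
    (s.map (MvPolynomial.X : σ → MvPolynomial σ K)).prod =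
      MvPolynomial.monomial (Multiset.toFinsupp s) 1 := by
  induction s using Multiset.induction with
  | empty => simp
  | cons a s ih =>
    rw [Multiset.map_cons, Multiset.prod_cons, ih, MvPolynomial.X, MvPolynomial.monomial_mul,
      ← Multiset.singleton_add, map_add, Multiset.toFinsupp_singleton, mul_one]

lemma coeff_msymm {K : Type*} [Field K] {N n : ℕ} (α : Fin N →₀ ℕ) (m : n.Partition) :
    (MvPolynomial.msymm (Fin N) K m).coeff α =
      if ptnOf (univ.val.map α) = ⟨n, m⟩ then 1 else 0 := by
  rw [MvPolynomial.msymm, MvPolynomial.coeff_sum]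
  have hα : ∀ s : Multiset (Fin N), Multiset.toFinsupp s = α ↔ s = Finsupp.toMultiset α :=
    fun s => Multiset.toFinsupp_eq_iff
  simp only [prod_map_X, MvPolynomial.coeff_monomial, hα]
  split_ifs with h
  · have h1 : (Finsupp.toMultiset α).card = n := by
      rw [Finsupp.card_toMultiset, Finsupp.sum_fintype _ _ fun _ => rfl]
      exact congrArg Sigma.fst h
    have h2 : Nat.Partition.ofSym (⟨Finsupp.toMultiset α, h1⟩ : _root_.Sym (Fin N) n) = m := by
      refine Nat.Partition.ext ?_
      have h3 := parts_ptnOf α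
      rw [h] at h3
      exact h3.symm
    rw [Finset.sum_eq_single ⟨⟨Finsupp.toMultiset α, h1⟩, h2⟩, if_pos rfl]
    · intro s _ hs
      exact if_neg fun h => hs (Subtype.ext (Subtype.ext h))
    · simp
  · refine Finset.sum_eq_zero fun s _ => if_neg fun hs => h (Ptn.ext_parts ?_)
    rw [parts_ptnOf, ← hs]
    exact congrArg Nat.Partition.parts s.2

end Monomial

/-! ### The Hall–Littlewood functions -/

section HallLittlewood
variable {K : Type*} [Field K] {r : K}

/-- The explicit Hall–Littlewood functions. -/
noncomputable def jingP (r : K) (l : Ptn) : Sym K := (bFactor r l)⁻¹ • jingVec r l.rows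

/-- Symmetric functions as sequences of symmetric polynomials. -/
noncomputable def toVarsAll : Sym K →ₗ[K] (∀ N : ℕ, MvPolynomial (Fin N) K) :=
  LinearMap.pi fun N => (Sym.toVars N).toLinearMap

lemma IsMacdonald.toVarsAll_sub_mem {q t : K} {P : Ptn → Sym K} (h : IsMacdonald q t P) {n : ℕ}
    (l : n.Partition) : toVarsAll (P ⟨n, l⟩) - (fun N => MvPolynomial.msymm (Fin N) K l) ∈
      Submodule.span K ((fun (m : n.Partition) N => MvPolynomial.msymm (Fin N) K m) ''
        {m | StrictDom l m}) := by
  obtain ⟨c, hc, hP⟩ := h.2 n l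
  have h1 : toVarsAll (P ⟨n, l⟩) - (fun N => MvPolynomial.msymm (Fin N) K l) =
      ∑ m : n.Partition, c m • fun N => MvPolynomial.msymm (Fin N) K m := by
    funext N
    rw [Pi.sub_apply, Finset.sum_apply]
    simp only [Pi.smul_apply]
    exact sub_eq_of_eq_add' (hP N)
  rw [h1]
  refine Submodule.sum_mem _ fun m _ => ?_
  by_cases hm : c m = 0
  · rw [hm, zero_smul]; exact Submodule.zero_mem _
  · exact Submodule.smul_mem _ _ (Submodule.subset_span ⟨m, hc m hm, rfl⟩)

lemma IsMacdonald.form_eq_zero {q t : K} {P : Ptn → Sym K} (h : IsMacdonald q t P) (l : Ptn)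
    {n : ℕ} {s : Set n.Partition} (hs : ∀ m ∈ s, l ≠ ⟨n, m⟩) {f : Sym K}
    (hf : f ∈ Submodule.span K ((fun m : n.Partition => P ⟨n, m⟩) '' s)) :
    formQT q t f (P l) = 0 := by
  induction hf using Submodule.span_induction with
  | mem v hv =>
    obtain ⟨m, hm, rfl⟩ := hv
    exact h.1 _ _ (hs m hm).symm
  | zero => simp
  | add x y _ _ hx hy => simp [hx, hy]
  | smul a x _ hx => simp [hx]

variable [CharZero K]

/-- The coefficient of m_μ is the pairing with q_μ. It vanishes unless λ ≥ μ, because q_μ is a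
combination of Jing vectors of partitions dominating μ, and it is 1 for μ = λ. -/
lemma isMacdonald_jingP (hr : ∀ n : ℕ, 0 < n → r ^ n ≠ 1) : IsMacdonald 0 r (jingP r) := by
  classical
  refine ⟨fun l m h => ?_, fun n l => ?_⟩
  · rw [← formQT_apply, jingP, jingP, map_smul, map_smul, LinearMap.smul_apply,
      formQT_jingVec_rows hr, if_neg h, smul_zero, smul_zero]
  · set c : n.Partition → K := fun m => formQT 0 r (qprod r m.parts) (jingP r ⟨n, l⟩) with hc
    have hcl : c l = 1 := by
      have h := formQT_qprod_self hr ⟨n, l⟩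
      simp only [hc, jingP, map_smul, h, smul_eq_mul]
      exact inv_mul_cancel₀ (bFactor_ne_zero hr _)
    refine ⟨fun m => if m = l then 0 else c m, fun m hm => ?_, fun N => ?_⟩
    · have hml : m ≠ l := fun h => hm (if_pos h)
      replace hm : c m ≠ 0 := by simpa only [if_neg hml] using hm
      simp only [hc, jingP, map_smul, smul_eq_mul] at hm
      obtain ⟨k, hk, hkm⟩ := dominates_of_formQT_qprod_ne_zero hr m _ (right_ne_zero_of_mul hm)
      obtain rfl : l = k := eq_of_heq (Sigma.mk.inj hk).2
      exact ⟨hkm, hml⟩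
    · have h1 : MvPolynomial.msymm (Fin N) K l + ∑ m : n.Partition,
          (if m = l then 0 else c m) • MvPolynomial.msymm (Fin N) K m =
          ∑ m : n.Partition, c m • MvPolynomial.msymm (Fin N) K m := by
        rw [← Finset.add_sum_erase univ (fun m => c m • MvPolynomial.msymm (Fin N) K m)
          (Finset.mem_univ l), ← Finset.add_sum_erase univ
          (fun m => (if m = l then 0 else c m) • MvPolynomial.msymm (Fin N) K m)
          (Finset.mem_univ l), hcl, one_smul, if_pos rfl, zero_smul, zero_add]
        congr 1
        exact Finset.sum_congr rfl fun m hm => by rw [if_neg (Finset.ne_of_mem_erase hm)]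
      rw [h1]
      ext α
      rw [coeff_toVars_eq hr, MvPolynomial.coeff_sum]
      simp only [MvPolynomial.coeff_smul, coeff_msymm, smul_eq_mul, mul_ite, mul_one, mul_zero]
      rw [← qprod_ptnOf]
      generalize ptnOf (univ.val.map α) = a
      obtain ⟨k, a⟩ := a
      by_cases hk : k = n
      · subst hk
        rw [Finset.sum_eq_single a]
        · rw [if_pos rfl]
        · intro m _ hm
          exact if_neg fun h => hm (eq_of_heq (Sigma.mk.inj h).2).symm
        · simp
      · rw [Finset.sum_eq_zero fun m _ => if_neg fun h => hk (congrArg Sigma.fst h)]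
        by_contra h
        rw [jingP, map_smul, smul_eq_mul] at h
        obtain ⟨j, hj, -⟩ := dominates_of_formQT_qprod_ne_zero hr a _ (right_ne_zero_of_mul h)
        exact hk (congrArg Sigma.fst hj).symm

lemma toVarsAll_injective (hr : ∀ n : ℕ, 0 < n → r ^ n ≠ 1) :
    Function.Injective (toVarsAll (K := K)) := by
  refine (injective_iff_map_eq_zero _).2 fun f hf => toVars_injective hr f fun N => ?_
  exact congrFun hf N

/-- Both families are unitriangular over the monomial functions, hence over each other. The argument
runs inside sequences of symmetric polynomials and is pulled back by injectivity of `toVarsAll`. -/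
lemma IsMacdonald.sub_mem (hr : ∀ n : ℕ, 0 < n → r ^ n ≠ 1) {q t : K} {P P' : Ptn → Sym K}
    (h : IsMacdonald q t P) (h' : IsMacdonald q t P') {n : ℕ} (l : n.Partition) :
    P' ⟨n, l⟩ - P ⟨n, l⟩ ∈
      Submodule.span K ((fun m : n.Partition => P ⟨n, m⟩) '' {m | StrictDom l m}) := by
  have key := sub_mem_span_of_triangular (wellFounded_strictDom_swap n)
    (fun i j k h h' => h'.trans h) fun l => h.toVarsAll_sub_mem l
  set S := Submodule.span K ((fun m : n.Partition => toVarsAll (P ⟨n, m⟩)) '' {m | StrictDom l m})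
    with hS
  have h1 : Submodule.span K ((fun (m : n.Partition) N => MvPolynomial.msymm (Fin N) K m) ''
      {m | StrictDom l m}) ≤ S := by
    rw [Submodule.span_le]
    rintro _ ⟨m, hm, rfl⟩
    have h2 := Submodule.add_mem S (Submodule.span_mono
      (Set.image_mono fun k (hk : StrictDom m k) => StrictDom.trans hm hk) (key m))
      (Submodule.subset_span ⟨m, hm, rfl⟩)
    rwa [sub_add_cancel] at h2
  have h2 := Submodule.sub_mem S (h1 (h'.toVarsAll_sub_mem l)) (h1 (h.toVarsAll_sub_mem l))
  rw [sub_sub_sub_cancel_right, ← map_sub] at h2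
  have h3 : S = (Submodule.span K ((fun m : n.Partition => P ⟨n, m⟩) '' {m | StrictDom l m})).map
      toVarsAll := by
    rw [Submodule.map_span, Set.image_image]
  rw [h3] at h2
  obtain ⟨f, hf, hf'⟩ := h2
  rwa [← toVarsAll_injective hr hf']

/-- The difference of the two families at λ lies in the span of lower `jingP`, and is orthogonal to
each of these by triangularity in both directions; the form is nondegenerate. -/
lemma IsMacdonald.eq_jingP (hr : ∀ n : ℕ, 0 < n → r ^ n ≠ 1) {P : Ptn → Sym K}
    (h : IsMacdonald 0 r P) : P = jingP r := by
  funext l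
  obtain ⟨n, l⟩ := l
  have h0 := isMacdonald_jingP hr
  have hspan : Submodule.span K (Set.range (jingP r)) = ⊤ := by
    rw [eq_top_iff, ← span_jingVec_rows r hr, Submodule.span_le]
    rintro _ ⟨m, rfl⟩
    have h1 := Submodule.smul_mem _ (bFactor r m)
      (Submodule.subset_span (R := K) ⟨m, rfl⟩ : jingP r m ∈ Submodule.span K (Set.range (jingP r)))
    rwa [jingP, smul_smul, mul_inv_cancel₀ (bFactor_ne_zero hr m), one_smul] at h1
  rw [← sub_eq_zero]
  have hd := h0.sub_mem hr h l
  refine eq_zero_of_formQT hr hspan _ ?_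
  rintro _ ⟨m, rfl⟩
  rw [formQT_comm]
  by_cases hm : ∃ k, m = ⟨n, k⟩ ∧ StrictDom l k
  · obtain ⟨k, rfl, hk⟩ := hm
    have h1 : formQT 0 r (jingP r ⟨n, l⟩) (jingP r ⟨n, k⟩) = 0 :=
      h0.1 _ _ fun h => hk.2 (eq_of_heq (Sigma.mk.inj h).2).symm
    have h2 : formQT 0 r (jingP r ⟨n, k⟩) (P ⟨n, l⟩) = 0 := by
      have h3 : formQT 0 r (P ⟨n, k⟩) (P ⟨n, l⟩) = 0 :=
        h.1 _ _ fun h => hk.2 (eq_of_heq (Sigma.mk.inj h).2)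
      have h4 := h.form_eq_zero ⟨n, l⟩ (fun m hm hl => ?_) (h.sub_mem hr h0 k)
      · rw [map_sub, LinearMap.sub_apply, h3, sub_zero] at h4
        exact h4
      · obtain rfl : l = m := eq_of_heq (Sigma.mk.inj hl).2
        exact (hk.trans hm).2 rfl
    rw [map_sub, LinearMap.sub_apply, formQT_comm, h1, h2, sub_zero]
  · refine h0.form_eq_zero m (fun k hk hmk => hm ⟨k, hmk, hk⟩) hd

lemma existsUnique_isMacdonald (hr : ∀ n : ℕ, 0 < n → r ^ n ≠ 1) :
    ∃! P : Ptn → Sym K, IsMacdonald 0 r P :=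
  ⟨jingP r, isMacdonald_jingP hr, fun _ h => h.eq_jingP hr⟩

lemma hallLittlewoodQ_eq (hr : ∀ n : ℕ, 0 < n → r ^ n ≠ 1) (l : Ptn) :
    hallLittlewoodQ r l = jingVec r l.rows := by
  have h : ∃ P : Ptn → Sym K, IsMacdonald 0 r P := ⟨_, isMacdonald_jingP hr⟩
  have h1 : macdonaldP 0 r = jingP r := by
    rw [macdonaldP, dif_pos h]
    exact h.choose_spec.eq_jingP hr
  rw [hallLittlewoodQ, hallLittlewoodP, h1, jingP, smul_smul,
    mul_inv_cancel₀ (bFactor_ne_zero hr l), one_smul]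

end HallLittlewood
end Crystal
namespace Crystal
open Finset

/-! ### Expansion in an orthogonal basis -/

section Parseval
variable {K : Type*} [Field K] [CharZero K] {r : K}

lemma finite_formQT_jingVec (hr : ∀ n : ℕ, 0 < n → r ^ n ≠ 1) (f : Sym K) :
    {k : Ptn | formQT 0 r f (jingVec r k.rows) ≠ 0}.Finite := by
  have hf : f ∈ Submodule.span K (Set.range fun l : Ptn => jingVec r l.rows) :=
    span_jingVec_rows r hr ▸ Submodule.mem_top
  induction hf using Submodule.span_induction with
  | mem v hv =>
    obtain ⟨l, rfl⟩ := hv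
    refine (Set.finite_singleton l).subset fun k hk => ?_
    by_contra h
    exact hk (by rw [formQT_jingVec_rows hr, if_neg fun h' => h h'.symm])
  | zero => simp
  | add x y _ _ hx hy =>
    refine (hx.union hy).subset fun k hk => ?_
    by_contra h
    simp only [Set.mem_union, Set.mem_ofPred_eq, not_or, not_not] at h
    exact hk (by rw [map_add, LinearMap.add_apply, h.1, h.2, add_zero])
  | smul a x _ hx =>
    refine hx.subset fun k hk h => hk ?_
    rw [map_smul, LinearMap.smul_apply, h, smul_zero]

/-- Parseval's formula: by linearity f may be a basis vector, and then one term survives. -/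
lemma finsum_formQT_jingVec (hr : ∀ n : ℕ, 0 < n → r ^ n ≠ 1) (f g : Sym K) :
    ∑ᶠ k : Ptn, (bFactor r k)⁻¹ *
      (formQT 0 r f (jingVec r k.rows) * formQT 0 r (jingVec r k.rows) g) = formQT 0 r f g := by
  have hfin : ∀ f, (Function.support fun k : Ptn => (bFactor r k)⁻¹ *
      (formQT 0 r f (jingVec r k.rows) * formQT 0 r (jingVec r k.rows) g)).Finite := fun f =>
    (finite_formQT_jingVec hr f).subset fun k hk => left_ne_zero_of_mul (right_ne_zero_of_mul hk)
  have hf : f ∈ Submodule.span K (Set.range fun l : Ptn => jingVec r l.rows) :=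
    span_jingVec_rows r hr ▸ Submodule.mem_top
  induction hf using Submodule.span_induction with
  | mem v hv =>
    obtain ⟨l, rfl⟩ := hv
    dsimp only
    rw [finsum_eq_single _ l, formQT_jingVec_rows hr, if_pos rfl, ← mul_assoc,
      inv_mul_cancel₀ (bFactor_ne_zero hr l), one_mul]
    intro k hk
    rw [formQT_jingVec_rows hr, if_neg hk.symm, zero_mul, mul_zero]
  | zero => simp
  | add x y _ _ hx hy =>
    rw [map_add, LinearMap.add_apply, ← hx, ← hy, ← finsum_add_distrib (hfin x) (hfin y)]
    refine finsum_congr fun k => ?_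
    rw [LinearMap.add_apply]
    ring
  | smul a x _ hx =>
    rw [map_smul, LinearMap.smul_apply, ← hx, smul_eq_mul, mul_finsum]
    refine finsum_congr fun k => ?_
    rw [LinearMap.smul_apply, smul_eq_mul]
    ring

end Parseval

/-! ### Matrices indexed by pairs -/

section Matrix
variable {α β K : Type*} [Field K]

lemma finsum_prod_single (a : α) (F : α × β → K) (h : ∀ j, j.1 ≠ a → F j = 0) :
    ∑ᶠ j, F j = ∑ᶠ b, F (a, b) := by
  rw [← finsum_mem_range (f := F) (g := fun b => (a, b)) fun _ _ h => (Prod.mk.inj h).2,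
    ← finsum_mem_univ]
  refine finsum_mem_inter_support_eq F _ _ ?_
  ext j
  simp only [Set.mem_inter_iff, Set.mem_univ, true_and, Function.mem_support, Set.mem_range]
  refine ⟨fun hj => ⟨⟨j.2, ?_⟩, hj⟩, fun hj => hj.2⟩
  by_contra hc
  exact hj (h j fun hja => hc (by rw [← hja]))

lemma finite_prod_single (a : α) (F : α × β → K) (h : ∀ j, j.1 ≠ a → F j = 0)
    (hfin : {b | F (a, b) ≠ 0}.Finite) : {j | F j ≠ 0}.Finite := by
  refine (hfin.image fun b => (a, b)).subset fun j hj => ?_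
  have hja : j.1 = a := by
    by_contra hc
    exact hj (h j hc)
  refine ⟨j.2, ?_, by rw [← hja]⟩
  rw [Set.mem_ofPred_eq, ← hja]
  exact hj

variable [DecidableEq α] {G : β → β → K} {w : β → K}

lemma finite_rows_columns
    (hfin : ∀ a, {b | G a b ≠ 0}.Finite ∧ {b | G b a ≠ 0}.Finite) {x y : α × β → K}
    {S : α × β → α × β → K}
    (hS : ∀ i j, S i j = x i * y j * G i.2 j.2 * if i.1 = j.1 then 1 else 0) (i : α × β) :
    {j | S i j ≠ 0}.Finite ∧ {j | S j i ≠ 0}.Finite := by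
  refine ⟨finite_prod_single i.1 _ (fun j hj => ?_) ?_, finite_prod_single i.1 _ (fun j hj => ?_) ?_⟩
  · rw [hS, if_neg hj.symm, mul_zero]
  · refine (hfin i.2).1.subset fun b hb h => hb ?_
    rw [hS, h, mul_zero, zero_mul]
  · rw [hS, if_neg hj, mul_zero]
  · refine (hfin i.2).2.subset fun b hb h => hb ?_
    rw [hS, h, mul_zero, zero_mul]

variable [DecidableEq β]

/-- Both matrices are the same G dressed by diagonal factors. The conditions `h` and `h'` make the
inner factors equal to the weight w and the outer ones cancel w⁻¹. They are symmetric enough to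
serve for both orders of the product. -/
lemma finsum_mul_eq (hw : ∀ b, w b ≠ 0)
    (hG : ∀ a b, ∑ᶠ c, w c * (G a c * G c b) = if a = b then (w a)⁻¹ else 0)
    {x y x' y' : α × β → K} {S T : α × β → α × β → K}
    (hS : ∀ i j, S i j = x i * y j * G i.2 j.2 * if i.1 = j.1 then 1 else 0)
    (hT : ∀ i j, T i j = x' i * y' j * G i.2 j.2 * if i.1 = j.1 then 1 else 0)
    (h : ∀ j, y j * x' j = w j.2) (h' : ∀ j, x j * y' j = w j.2) (i k : α × β) :
    ∑ᶠ j, S i j * T j k = if i = k then 1 else 0 := by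
  rw [finsum_prod_single i.1 _ fun j hj => by rw [hS, if_neg hj.symm, mul_zero, zero_mul]]
  have h1 : ∀ c, S i (i.1, c) * T (i.1, c) k = (x i * y' k * if i.1 = k.1 then 1 else 0) *
      (w c * (G i.2 c * G c k.2)) := fun c => by
    rw [hS, hT, if_pos rfl, ← h (i.1, c)]
    ring
  rw [finsum_congr h1, ← mul_finsum, hG]
  by_cases hik : i = k
  · subst hik
    rw [if_pos rfl, if_pos rfl, if_pos rfl, mul_one, h', mul_inv_cancel₀ (hw _)]
  · rw [if_neg hik]
    by_cases h1 : i.1 = k.1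
    · rw [if_neg fun h2 => hik (Prod.ext h1 h2), mul_zero]
    · rw [if_neg h1, mul_zero, zero_mul]

lemma isInverseMatrix_of_pairs (hfin : ∀ a, {b | G a b ≠ 0}.Finite ∧ {b | G b a ≠ 0}.Finite)
    (hw : ∀ b, w b ≠ 0)
    (hG : ∀ a b, ∑ᶠ c, w c * (G a c * G c b) = if a = b then (w a)⁻¹ else 0)
    {x y x' y' : α × β → K} {S T : α × β → α × β → K}
    (hS : ∀ i j, S i j = x i * y j * G i.2 j.2 * if i.1 = j.1 then 1 else 0)
    (hT : ∀ i j, T i j = x' i * y' j * G i.2 j.2 * if i.1 = j.1 then 1 else 0)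
    (h : ∀ j, y j * x' j = w j.2) (h' : ∀ j, x j * y' j = w j.2) : IsInverseMatrix S T :=
  ⟨finite_rows_columns hfin hS, finite_rows_columns hfin hT, finsum_mul_eq hw hG hS hT h h',
    finsum_mul_eq hw hG hT hS (fun j => by rw [mul_comm, h']) fun j => by rw [mul_comm, h]⟩

end Matrix

/-! ### The Shapovalov matrix -/

section Shapovalov
variable {K : Type*} [Field K]

/-- `p_n ↦ a^{(2)}_{-n}`. -/
noncomputable def embTwo : Sym K →ₐ[K] Fock K := MvPolynomial.aeval fun m => MvPolynomial.X (1, m)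

/-- `p_n ↦ a^{(2)}_{-n} - a^{(1)}_{-n}`. -/
noncomputable def embDiff : Sym K →ₐ[K] Fock K :=
  MvPolynomial.aeval fun m => MvPolynomial.X (1, m) - MvPolynomial.X (0, m)

/-- `a^{(1)}_{-n} ↦ -p_n`, `a^{(2)}_{-n} ↦ 0`. -/
noncomputable def projOne : Fock K →ₐ[K] Sym K :=
  MvPolynomial.aeval fun i => if i.1 = 0 then -MvPolynomial.X i.2 else 0

lemma algHom_C {σ τ : Type*} (Φ : MvPolynomial σ K →ₐ[K] MvPolynomial τ K) (c : K) :
    Φ (MvPolynomial.C c) = MvPolynomial.C c := by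
  rw [← MvPolynomial.algebraMap_eq, AlgHom.commutes, MvPolynomial.algebraMap_eq]

@[simp] lemma embTwo_X (m : ℕ+) : embTwo (MvPolynomial.X m : Sym K) = MvPolynomial.X (1, m) := by
  simp [embTwo]

@[simp] lemma embDiff_X (m : ℕ+) : embDiff (MvPolynomial.X m : Sym K) =
    MvPolynomial.X (1, m) - MvPolynomial.X (0, m) := by
  simp [embDiff]

@[simp] lemma projOne_X_zero (m : ℕ+) :
    projOne (MvPolynomial.X (0, m) : Fock K) = -MvPolynomial.X m := by
  simp [projOne]

@[simp] lemma projOne_X_one (m : ℕ+) : projOne (MvPolynomial.X (1, m) : Fock K) = 0 := by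
  simp [projOne]

lemma projOne_embDiff (f : Sym K) : projOne (embDiff f) = f := by
  have h : (projOne (K := K)).comp embDiff = AlgHom.id K _ :=
    MvPolynomial.algHom_ext fun m => by simp
  exact congrArg (fun φ => φ f) h

lemma projOne_embTwo (f : Sym K) :
    projOne (embTwo f) = MvPolynomial.C (MvPolynomial.constantCoeff f) := by
  induction f using MvPolynomial.induction_on with
  | C a => rw [algHom_C, algHom_C, MvPolynomial.constantCoeff_C]
  | add f g hf hg => simp only [map_add, hf, hg]
  | mul_X f i hf => simp

lemma constantCoeff_projOne (v : Fock K) :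
    MvPolynomial.constantCoeff (projOne v) = MvPolynomial.constantCoeff v := by
  induction v using MvPolynomial.induction_on with
  | C a => rw [algHom_C, MvPolynomial.constantCoeff_C, MvPolynomial.constantCoeff_C]
  | add f g hf hg => simp only [map_add, hf, hg]
  | mul_X f i hf =>
    obtain ⟨i, m⟩ := i
    fin_cases i <;> simp

/-- Translating both bosons by the same amount preserves their difference. -/
lemma shift_embDiff (f : Sym K) :
    shift bosonDeg (fun _ => (-1 : K)) (embDiff f) = Polynomial.C (embDiff f) := by
  have h := shift_algHom (deg := symDeg) (deg' := bosonDeg) (β := 0) (β' := fun _ => (-1 : K))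
    embDiff (fun m => by simp [bosonDeg]) f
  rw [h, shift_zero, Polynomial.map_C]
  rfl

variable [CharZero K] {t : K} (u : Fin 2 → K)

lemma crystalXTwo_mul (ht0 : t ≠ 0) (ht : ∀ n : ℕ, 0 < n → t ^ n ≠ 1) (n : ℤ) (c : K)
    (f g : Sym K) : crystalXTwo t u n (MvPolynomial.C c * (embTwo f * embDiff g)) =
      MvPolynomial.C (c * (u 0 * u 1)) * (embTwo (jing t⁻¹ 1 n f) * embDiff g) := by
  have h : embTwo (jing t⁻¹ 1 n f) =
      vop K bosonDeg (lin 0 (hlCoeff t⁻¹)) (fun _ => -1) n (embTwo f) := by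
    refine algHom_vop K embTwo (fun m => ?_) (fun m => ?_) n f
    · simp [bosonDeg, symDeg]
    · simp [lin, jingExp]
  rw [(crystalXTwo_spec u ht0 ht n).2, h]
  dsimp only
  rw [vop_apply, map_mul (shift _ _), map_mul (shift _ _), shift_embDiff, shift_C, pair_C_mul,
    mul_comm (shift _ _ _), pair_C_mul, ← vop_apply]
  simp only [map_mul]
  ring

lemma crystalXOne_embDiff (ht : ∀ n : ℕ, 0 < n → t ^ n ≠ 1) {n : ℕ} (hn : 0 < n) (c : K)
    (g : Sym K) : crystalXOne t u (-n) (MvPolynomial.C c * embDiff g) =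
      MvPolynomial.C (c * u 1) * embDiff (jing t⁻¹ 1 (-n) g) := by
  have h : embDiff (jing t⁻¹ 1 (-n) g) = vop K bosonDeg (lin (-hlCoeff t⁻¹) (hlCoeff t⁻¹))
      (bosonDir 1 fun _ => -1) (-n) (embDiff g) := by
    refine algHom_vop K embDiff (fun m => ?_) (fun m => ?_) _ g
    · simp [bosonDeg, symDeg, bosonDir]
      ring
    · simp [lin, jingExp]
      ring
  rw [crystalXOne_of_neg u ht hn, h, ← MvPolynomial.smul_eq_C_mul (embDiff g), map_smul,
    MvPolynomial.smul_eq_C_mul, ← mul_assoc, ← map_mul, mul_comm c]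

/-- Positive modes of X^(1) neither create nor differentiate the second boson, so it may be set to
0; the sign in a^(1) = -p_n turns the operator into the dual one. -/
lemma projOne_crystalXOne (ht : ∀ n : ℕ, 0 < n → t ^ n ≠ 1) {n : ℕ} (hn : 0 < n) (v : Fock K) :
    projOne (crystalXOne t u n v) = MvPolynomial.C (u 0) * jing t⁻¹ (-1) n (projOne v) := by
  rw [crystalXOne_of_pos u ht hn, map_mul, algHom_C]
  congr 1
  refine algHom_vop K projOne (fun i => ?_) (fun m => ?_) _ v
  · obtain ⟨i, m⟩ := i
    fin_cases i
    · simp [bosonDeg, symDeg, bosonDir]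
      ring
    · simp [bosonDir]
  · simp [lin, jingExp]

/-- In `ketX` and `braX` the mode index is an integer, and the list of parts is coerced to integers
by this `bind`. -/
lemma bind_pure_natCast (L : List ℕ) :
    (L >>= fun k : ℕ => pure (k : ℤ)) = L.map fun k : ℕ => (k : ℤ) := by
  rw [List.bind_eq_flatMap]
  exact List.flatMap_pure_eq_map _ L

lemma ketX_eq (ht0 : t ≠ 0) (ht : ∀ n : ℕ, 0 < n → t ^ n ≠ 1) (m : PtnPair) :
    ketX t u m = MvPolynomial.C (u 1 ^ m.1.len * (u 0 * u 1) ^ m.2.len) *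
      (embTwo (jingVec t⁻¹ m.2.rows) * embDiff (jingVec t⁻¹ m.1.rows)) := by
  have h1 : ∀ L : List ℕ, (∀ k ∈ L, 0 < k) →
      L.foldr (fun (k : ℕ) v => crystalXOne t u (-(k : ℤ)) v) 1 =
        MvPolynomial.C (u 1 ^ L.length) * embDiff (jingVec t⁻¹ L) := by
    intro L hL
    induction L with
    | nil => simp
    | cons k L ih =>
      rw [List.foldr_cons, ih fun j hj => hL j (by simp [hj]),
        crystalXOne_embDiff u ht (hL k (by simp)), List.length_cons, pow_succ, jingVec_cons]
  have h2 : ∀ (L : List ℕ) (c : K) (g : Sym K),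
      L.foldr (fun (k : ℕ) v => crystalXTwo t u (-(k : ℤ)) v) (MvPolynomial.C c * embDiff g) =
        MvPolynomial.C (c * (u 0 * u 1) ^ L.length) * (embTwo (jingVec t⁻¹ L) * embDiff g) := by
    intro L c g
    induction L with
    | nil => simp
    | cons k L ih =>
      rw [List.foldr_cons, ih, crystalXTwo_mul u ht0 ht, List.length_cons, pow_succ, jingVec_cons,
        mul_assoc c]
  rw [ketX, bind_pure_natCast, bind_pure_natCast, List.foldr_map, List.foldr_map, h1 _ (rows_pos _), h2, length_rows, length_rows]

/-- By adjointness the modes J_k move to the left as dual modes applied to 1, and the dual operators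
are the conjugates of J by p_n ↦ -p_n. -/
lemma constantCoeff_foldl_jing (r : K) (hr : ∀ n : ℕ, 0 < n → r ^ n ≠ 1) (L : List ℕ)
    (f : Sym K) : MvPolynomial.constantCoeff (L.foldl (fun w (k : ℕ) => jing r 1 (k : ℤ) w) f) =
      formQT 0 r (Sym.negVars (jingVec r L)) f := by
  induction L generalizing f with
  | nil => rw [List.foldl_nil, jingVec_nil, map_one, formQT_one]
  | cons k L ih =>
    rw [List.foldl_cons, ih, jingVec_cons, negVars_jing, formQT_jing hr, neg_neg]

/-- The modes of X^(2) act first and change only f. The constant term after the modes of X^(1) is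
computed through `projOne`, which keeps g and reduces f to its constant coefficient. -/
lemma braX_eq (ht0 : t ≠ 0) (ht : ∀ n : ℕ, 0 < n → t ^ n ≠ 1)
    (hr : ∀ n : ℕ, 0 < n → t⁻¹ ^ n ≠ 1) (l : PtnPair) (c : K) (f g : Sym K) :
    braX t u l (MvPolynomial.C c * (embTwo f * embDiff g)) =
      u 0 ^ l.1.len * (c * (u 0 * u 1) ^ l.2.len) *
        formQT 0 t⁻¹ (Sym.negVars (jingVec t⁻¹ l.2.rows)) f *
          formQT 0 t⁻¹ (jingVec t⁻¹ l.1.rows) g := by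
  have h1 : ∀ (L : List ℕ) (c : K) (f : Sym K),
      L.foldl (fun w (k : ℕ) => crystalXTwo t u (k : ℤ) w) (MvPolynomial.C c * (embTwo f * embDiff g)) =
        MvPolynomial.C (c * (u 0 * u 1) ^ L.length) *
          (embTwo (L.foldl (fun w (k : ℕ) => jing t⁻¹ 1 (k : ℤ) w) f) * embDiff g) := by
    intro L
    induction L with
    | nil => simp
    | cons k L ih =>
      intro c f
      rw [List.foldl_cons, crystalXTwo_mul u ht0 ht, ih, List.length_cons, pow_succ',
        List.foldl_cons, mul_assoc c]
  have h2 : ∀ (L : List ℕ) (v : Fock K), (∀ k ∈ L, 0 < k) →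
      MvPolynomial.constantCoeff (L.foldl (fun w (k : ℕ) => crystalXOne t u (k : ℤ) w) v) =
        u 0 ^ L.length * formQT 0 t⁻¹ (jingVec t⁻¹ L) (projOne v) := by
    intro L
    induction L with
    | nil =>
      intro v _
      rw [List.foldl_nil, jingVec_nil, formQT_one, constantCoeff_projOne, List.length_nil, pow_zero,
        one_mul]
    | cons k L ih =>
      intro v hL
      rw [List.foldl_cons, ih _ fun j hj => hL j (by simp [hj]),
        projOne_crystalXOne u ht (hL k (by simp)), ← MvPolynomial.smul_eq_C_mul, map_smul,
        formQT_jingVec_cons hr, List.length_cons, pow_succ, smul_eq_mul, mul_assoc]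
  rw [braX, bind_pure_natCast, bind_pure_natCast, List.foldl_map, List.foldl_map, h1, h2 _ _ (rows_pos _), map_mul projOne, map_mul projOne, algHom_C, projOne_embTwo, projOne_embDiff,
    constantCoeff_foldl_jing _ hr, ← MvPolynomial.smul_eq_C_mul, ← MvPolynomial.smul_eq_C_mul,
    map_smul, map_smul, length_rows, length_rows, smul_eq_mul, smul_eq_mul]
  ring

/-- The pairing of `Q_a(-p)` and `Q_b(p)`. -/
noncomputable def signedPairing (r : K) (a b : Ptn) : K :=
  formQT 0 r (Sym.negVars (jingVec r a.rows)) (jingVec r b.rows)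

lemma shapovalov_eq (ht0 : t ≠ 0) (ht : ∀ n : ℕ, 0 < n → t ^ n ≠ 1)
    (hr : ∀ n : ℕ, 0 < n → t⁻¹ ^ n ≠ 1) (l m : PtnPair) :
    shapovalov t u l m = (u 0 * u 1) ^ (l.2.len + m.2.len) * u 0 ^ l.1.len * u 1 ^ m.1.len *
      bFactor t⁻¹ l.1 * signedPairing t⁻¹ l.2 m.2 * (if l.1 = m.1 then 1 else 0) := by
  rw [shapovalov, ketX_eq u ht0 ht, braX_eq u ht0 ht hr, formQT_jingVec_rows hr, signedPairing,
    pow_add]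
  split_ifs <;> ring

lemma finite_signedPairing {r : K} (hr : ∀ n : ℕ, 0 < n → r ^ n ≠ 1) (a : Ptn) :
    {b | signedPairing r a b ≠ 0}.Finite ∧ {b | signedPairing r b a ≠ 0}.Finite := by
  refine ⟨finite_formQT_jingVec hr _, ?_⟩
  convert finite_formQT_jingVec hr (Sym.negVars (jingVec r a.rows)) using 4 with b
  rw [signedPairing, formQT_negVars, formQT_comm]

/-- Parseval's formula for Q_a(-p) and Q_b(-p); the two signs cancel and orthogonality remains. -/
lemma finsum_signedPairing {r : K} (hr : ∀ n : ℕ, 0 < n → r ^ n ≠ 1) (a b : Ptn) :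
    ∑ᶠ c, (bFactor r c)⁻¹ * (signedPairing r a c * signedPairing r c b) =
      if a = b then ((bFactor r a)⁻¹)⁻¹ else 0 := by
  have h := finsum_formQT_jingVec hr (Sym.negVars (jingVec r a.rows))
    (Sym.negVars (jingVec r b.rows))
  rw [formQT_negVars, negVars_negVars, formQT_jingVec_rows hr] at h
  rw [inv_inv, ← h]
  refine finsum_congr fun c => ?_
  rw [signedPairing, signedPairing, formQT_negVars (K := K) 0 r (jingVec r c.rows)]

lemma isInverseMatrix_shapovalov (ht0 : t ≠ 0) (ht : ∀ n : ℕ, 0 < n → t ^ n ≠ 1)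
    (hr : ∀ n : ℕ, 0 < n → t⁻¹ ^ n ≠ 1) (hu : ∀ i, u i ≠ 0) :
    IsInverseMatrix (shapovalov t u) fun l m : PtnPair =>
      ((u 0 * u 1) ^ (m.2.len + l.2.len))⁻¹ * (u 0 ^ m.1.len)⁻¹ * (u 1 ^ l.1.len)⁻¹ *
        (1 / (bFactor t⁻¹ m.1 * bFactor t⁻¹ l.2 * bFactor t⁻¹ m.2)) *
        signedPairing t⁻¹ l.2 m.2 * (if l.1 = m.1 then 1 else 0) := by
  have h0 := hu 0
  have h1 := hu 1
  have hb := bFactor_ne_zero hr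
  refine isInverseMatrix_of_pairs (w := fun b => (bFactor t⁻¹ b)⁻¹)
    (x := fun i => (u 0 * u 1) ^ i.2.len * u 0 ^ i.1.len * bFactor t⁻¹ i.1)
    (y := fun j => (u 0 * u 1) ^ j.2.len * u 1 ^ j.1.len)
    (x' := fun i => ((u 0 * u 1) ^ i.2.len)⁻¹ * (u 1 ^ i.1.len)⁻¹ * (bFactor t⁻¹ i.2)⁻¹)
    (y' := fun j => ((u 0 * u 1) ^ j.2.len)⁻¹ * (u 0 ^ j.1.len)⁻¹ * (bFactor t⁻¹ j.1)⁻¹ *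
      (bFactor t⁻¹ j.2)⁻¹)
    (finite_signedPairing hr) (fun b => inv_ne_zero (hb b)) (finsum_signedPairing hr)
    (fun i j => ?_) (fun i j => ?_) (fun j => ?_) fun j => ?_
  · rw [shapovalov_eq u ht0 ht hr, pow_add]
    ring
  · rw [pow_add, one_div, mul_inv, mul_inv, mul_inv]
    ring
  · field_simp
  · have h2 := hb j.1
    generalize bFactor t⁻¹ j.1 = b at h2
    field_simp

end Shapovalov
end Crystal
-- Assembly of the main theorem.
theorem mainTheorem6 {K : Type*} [Field K] [CharZero K] (t : K) (u : Fin 2 → K)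
    (ht0 : t ≠ 0) (ht : ∀ n : ℕ, 0 < n → t ^ n ≠ 1) (hu : ∀ i, u i ≠ 0) :
    -- the generators at generic `q` and their limits as `q → 0` exist
    (∀ n : ℤ, Crystal.IsGenXTwo RatFunc.X (RatFunc.C t) (fun i => RatFunc.C (u i)) n
        (Crystal.genXTwo RatFunc.X (RatFunc.C t) (fun i => RatFunc.C (u i)) n)) ∧
    (∀ n : ℤ, Crystal.IsCrystalLimit (Crystal.scaledXOne t u n) (Crystal.crystalXOne t u n)) ∧
    (∀ n : ℤ, Crystal.IsCrystalLimit (Crystal.scaledXTwo t u n) (Crystal.crystalXTwo t u n)) ∧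
    -- the Hall-Littlewood functions are well defined
    (∃! P : Crystal.Ptn → Crystal.Sym K, Crystal.IsMacdonald 0 t⁻¹ P) ∧
    -- the Shapovalov matrix
    (∀ l m : Crystal.PtnPair,
      Crystal.shapovalov t u l m =
        (u 0 * u 1) ^ (l.2.len + m.2.len) * u 0 ^ l.1.len * u 1 ^ m.1.len *
        Crystal.bFactor t⁻¹ l.1 *
        Crystal.innerQT 0 t⁻¹ (Crystal.hallLittlewoodQ t⁻¹ l.2)
          (Crystal.Sym.negVars (Crystal.hallLittlewoodQ t⁻¹ m.2)) *
        (if l.1 = m.1 then 1 else 0)) ∧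
    -- its inverse
    Crystal.IsInverseMatrix (Crystal.shapovalov t u) (fun l m =>
        ((u 0 * u 1) ^ (m.2.len + l.2.len))⁻¹ * (u 0 ^ m.1.len)⁻¹ * (u 1 ^ l.1.len)⁻¹ *
        (1 / (Crystal.bFactor t⁻¹ m.1 * Crystal.bFactor t⁻¹ l.2 * Crystal.bFactor t⁻¹ m.2)) *
        Crystal.innerQT 0 t⁻¹ (Crystal.Sym.negVars (Crystal.hallLittlewoodQ t⁻¹ l.2))
          (Crystal.hallLittlewoodQ t⁻¹ m.2) *
        (if l.1 = m.1 then 1 else 0)) := by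
  have hr : ∀ n : ℕ, 0 < n → t⁻¹ ^ n ≠ 1 := fun n hn h => ht n hn (by rwa [inv_pow, inv_eq_one] at h)
  have hN : ∀ a b : Crystal.Ptn,
      Crystal.innerQT 0 t⁻¹ (Crystal.Sym.negVars (Crystal.hallLittlewoodQ t⁻¹ a))
        (Crystal.hallLittlewoodQ t⁻¹ b) = Crystal.signedPairing t⁻¹ a b := fun a b => by
    rw [Crystal.hallLittlewoodQ_eq hr, Crystal.hallLittlewoodQ_eq hr]
    rfl
  refine ⟨fun n => (Crystal.genXTwo_ratFunc u ht0 ht n).1,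
    fun n => (Crystal.crystalXOne_spec u ht n).1, fun n => (Crystal.crystalXTwo_spec u ht0 ht n).1,
    Crystal.existsUnique_isMacdonald hr, fun l m => ?_, ?_⟩
  -- The sign change sits on the right factor in the formula for S and on the left one in
  -- `signedPairing`; self-adjointness moves it across.
  · rw [← Crystal.formQT_apply, ← Crystal.formQT_negVars, Crystal.formQT_apply, hN,
      Crystal.shapovalov_eq u ht0 ht hr]
  · simp only [hN]
    exact Crystal.isInverseMatrix_shapovalov u ht0 ht hr hu
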